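/- **Setting.** Consider a game with $N\ge 1$ players, finite non-empty action sets $\mathcal A_1,\dots,\mathcal A_N$, $\mathcal A=\prod_i\mathcal A_i$, and utilities $u_i:\mathcal A\to[0,1]$. Let $A=\max_i|\mathcal A_i|$ and $\varepsilon,\Delta\in(0,1]$, $\delta\in(0,1)$. In each play the players choose a joint action $a\in\mathcal A$ (each drawing independently from its current mixed strategy, given the past), and each player $j$ observes a random payoff in $[0,1]$ whose conditional mean, given the past and $a$, is $u_j(a)$. One play is one sample. Let $E_0=\emptyset$, and let $E_{l}$ be the set of actions $a\in\mathcal A_i$, $i\in[N]$, for which there is a mixed strategy $x\in\Delta(\mathcal A_i)$ with $u_i(a,a_{-i})\le u_i(x,a_{-i})-\Delta$ for all $a_{-i}$ that contain no action of $E_{l-1}$. Let $L=\inf\{l\ge 0:E_{l+1}=E_l\}$. An action is $\Delta$-rationalizable if it is not in $E_L$. A distribution $\Pi$ on $\mathcal A$ is an $\varepsilon$-CE if $\mathbb E_{a\sim\Pi}[u_i(a)]\ge\mathbb E_{a\sim\Pi}[u_i(\phi(a_i),a_{-i})]-\varepsilon$ for all $i$ and all $\phi:\mathcal A_i\to\mathcal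 A_i$; it is a $\Delta$-rationalizable $\varepsilon$-CE if moreover every joint action in its support consists of $\Delta$-rationalizable actions. **Algorithm.** Put $p=\min\{\varepsilon,\Delta\}/(8AN)$. 1. (Iterative best response.) Start from an arbitrary $a^{(0)}\in\mathcal A$. For $l=1,\dots,L$: for every $i$ and every $a\in\mathcal A_i$ play $(a,a^{(l-1)}_{-i})$ for $\lceil 64\ln(LNA/\delta)/\Delta^2\rceil$ times, and let $a^{(l)}_i$ be an action with the largest average payoff of player $i$. Put $a^\star=a^{(L)}$. 2. Put $\theta_i^{(1)}(a)=(1-|\mathcal A_i|p)\mathbf 1[a=a_i^\star]+p$. 3. For $t=1,\dots,T$ and every player $i$: for every $a\in\mathcal A_i$ play $(a,\theta_{-i}^{(t)})$ for $$M_i^{(t)}=\Big\lceil\max_a\frac{64\ln(ANT/\delta)\,\theta_i^{(t)}(a)}{\Delta^2\sum_{\tau=1}^t\theta_i^{(\tau)}(a)}\Big\rceil$$ times, and let $u_i^{(t)}(a)$ be player $i$'s average payoff; for every $b\in\mathcal A_i$ let $$\hat\theta_i^{(t+1)}(\cdot|b)\propto\exp\Big(\eta_{t,i}^b\sum_{\tau=1}^tu_i^{(\tau)}(\cdot)\theta_i^{(\tau)}(b)\Big),\qquad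 \eta_{t,i}^b=\max\Big\{\frac{2\ln(1/p)}{\Delta\sum_{\tau=1}^t\theta_i^{(\tau)}(b)},\sqrt{\frac{A\ln A}{t}}\Big\};$$ let $\theta_i^{(t+1)}\in\Delta(\mathcal A_i)$ satisfy $\theta_i^{(t+1)}(a)=\sum_b\hat\theta_i^{(t+1)}(a|b)\,\theta_i^{(t+1)}(b)$ for all $a$. 4. Remove from each $\theta_i^{(t)}$ all actions of probability at most $p$, renormalize to $\bar\theta_i^{(t)}$, and output $\frac1T\sum_{t=1}^T\bigotimes_{i=1}^N\bar\theta_i^{(t)}$. **Theorem.** There are universal constants $C_1,C_2>0$ and $\kappa_1,\kappa_2\in\mathbb N$ such that, with $\Lambda=1+\ln\frac{NA}{\varepsilon\Delta\delta}$, for every such game and all such $\varepsilon,\Delta,\delta$, the algorithm run with $$T=\Big\lceil C_1\Big(\frac{A}{\varepsilon^2}+\frac{A}{\Delta^2}\Big)\Lambda^{\kappa_1}\Big\rceil=\tilde O\Big(\frac A{\varepsilon^2}+\frac A{\Delta^2}\Big)$$ outputs, with probability at least $1-3\delta$, a $\Delta$-rationalizable $\varepsilon$-CE, and the total number of samples it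 uses (in steps 1 and 3) is always at most $$C_2\Big(\frac{LNA}{\Delta^2}+\frac{NA^2}{\min\{\varepsilon^2,\Delta^2\}}\Big)\Lambda^{\kappa_2}=\tilde O\Big(\frac{LNA}{\Delta^2}+\frac{NA^2}{\min\{\varepsilon^2,\Delta^2\}}\Big).$$ -/

import Mathlib

open MeasureTheory

noncomputable section

namespace RatCE

/-! ### Games, dominance elimination, correlated equilibria

Player `i : Fin N` has the action set `Fin (k i)`; `u i x` is the utility of player `i` at the
action profile `x`. -/

/-- Joint (pure) action profiles. -/
abbrev Profile {N : ℕ} (k : Fin N → ℕ) : Type := (i : Fin N) → Fin (k i)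

/-- One vector of weights for each player (a mixed strategy profile when each is in the simplex). -/
abbrev Weights {N : ℕ} (k : Fin N → ℕ) : Type := (i : Fin N) → Fin (k i) → ℝ

/-- The maximal number of actions of a player. -/
def maxActions {N : ℕ} (k : Fin N → ℕ) : ℕ := Finset.univ.sup k

/-- `elim u Δ l i` is the set of actions of player `i` eliminated within `l` rounds of iterated
elimination of actions that are `Δ`-dominated by a mixed strategy. The opponents' actions are the
coordinates `j ≠ i` of the profile `y`. -/
def elim {N : ℕ} {k : Fin N → ℕ} (u : Fin N → Profile k → ℝ) (Δ : ℝ) :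
    ℕ → (i : Fin N) → Set (Fin (k i))
  | 0 => fun _ => ∅
  | l + 1 => fun i => {a | ∃ x ∈ stdSimplex ℝ (Fin (k i)),
      ∀ y : Profile k, (∀ j, j ≠ i → y j ∉ elim u Δ l j) →
        u i (Function.update y i a) ≤ (∑ c, x c * u i (Function.update y i c)) - Δ}

/-- The minimum elimination length `L`. -/
def elimLength {N : ℕ} {k : Fin N → ℕ} (u : Fin N → Profile k → ℝ) (Δ : ℝ) : ℕ :=
  sInf {l | elim u Δ (l + 1) = elim u Δ l}

/-- Action `a` of player `i` is `Δ`-rationalizable. -/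
def Rationalizable {N : ℕ} {k : Fin N → ℕ} (u : Fin N → Profile k → ℝ) (Δ : ℝ)
    (i : Fin N) (a : Fin (k i)) : Prop :=
  a ∉ elim u Δ (elimLength u Δ) i

/-- `D` is a distribution on action profiles and an `ε`-correlated equilibrium. -/
def IsApproxCE {N : ℕ} {k : Fin N → ℕ} (u : Fin N → Profile k → ℝ) (ε : ℝ)
    (D : Profile k → ℝ) : Prop :=
  D ∈ stdSimplex ℝ (Profile k) ∧
    ∀ (i : Fin N) (φ : Fin (k i) → Fin (k i)),
      (∑ x, D x * u i (Function.update x i (φ (x i)))) - ε ≤ ∑ x, D x * u i x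

/-- A `Δ`-rationalizable `ε`-CE: an `ε`-CE that only plays `Δ`-rationalizable actions. -/
def IsRationalizableCE {N : ℕ} {k : Fin N → ℕ} (u : Fin N → Profile k → ℝ) (ε Δ : ℝ)
    (D : Profile k → ℝ) : Prop :=
  IsApproxCE u ε D ∧ ∀ x, D x ≠ 0 → ∀ i, Rationalizable u Δ i (x i)

/-! ### Bandit feedback with players exploring in turn

The interaction consists of rounds `r = 0, 1, …`. In round `r`, for each player `i` in turn and for
each action `a` of player `i` in turn, the joint strategy "`i` plays `a`, every other player `j`
draws an action from `strat r j`" is played `batch r i` times. A play is labelled by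
`(r, i, a, m)` with `m < batch r i`, and plays happen in the lexicographic order of their labels.
Labels with `batch r i ≤ m` are not played: nothing is assumed about their outcomes except that
they are adapted and take values in the right sets, and the algorithm does not read them. -/

/-- Labels of plays, in lexicographic order. -/
abbrev Slot : Type := ℕ ×ₗ (ℕ ×ₗ (ℕ ×ₗ ℕ))

/-- The label of the `m`-th play, in round `r`, of action `a` by the exploring player `i`. -/
def slot (r i a m : ℕ) : Slot := toLex (r, toLex (i, toLex (a, m)))

/-- The random objects of an interaction on a sample space `Ω`. -/
structure Interaction {N : ℕ} (k : Fin N → ℕ) (Ω : Type*) [mΩ : MeasurableSpace Ω] where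
  /-- `hist s` is the information available just before the play with label `s`. -/
  hist : Filtration Slot mΩ
  /-- The mixed strategies in force in round `r`. -/
  strat : ℕ → Ω → Weights k
  /-- The number of repetitions, in round `r`, for each action of the exploring player. -/
  batch : ℕ → Ω → Fin N → ℕ
  /-- The joint action realized in a play. -/
  act : Slot → Ω → Profile k
  /-- The payoffs observed by the players in a play. -/
  fb : Slot → Ω → Fin N → ℝ

namespace Interaction

variable {N : ℕ} {k : Fin N → ℕ} {Ω : Type*} [mΩ : MeasurableSpace Ω]

/-- Player `i`'s average payoff over the plays of action `a` in round `r`. -/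
def avg (I : Interaction k Ω) (r : ℕ) (ω : Ω) (i : Fin N) (a : Fin (k i)) : ℝ :=
  (∑ m ∈ Finset.range (I.batch r ω i), I.fb (slot r i a m) ω i) / I.batch r ω i

/-- The total number of plays (samples) in the first `R` rounds. -/
def samples (I : Interaction k Ω) (R : ℕ) (ω : Ω) : ℕ :=
  ∑ r ∈ Finset.range R, ∑ i, k i * I.batch r ω i

/-- The first `R` rounds are an interaction with the game `u` under bandit feedback: strategies and
repetition numbers are decided at the beginning of the round; given the past, the players draw their
actions independently from their strategies; given the past and the realized joint action, the
feedback is `[0,1]`-valued with mean the utility at that joint action. -/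
structure IsBandit (I : Interaction k Ω) (u : Fin N → Profile k → ℝ) (μ : Measure Ω) (R : ℕ) :
    Prop where
  strat_meas : ∀ r < R, ∀ i a, Measurable[I.hist (slot r 0 0 0)] fun ω => I.strat r ω i a
  batch_meas : ∀ r < R, ∀ i, Measurable[I.hist (slot r 0 0 0)] fun ω => I.batch r ω i
  act_meas : ∀ s s', s < s' → Measurable[I.hist s'] (I.act s)
  fb_meas : ∀ s s', s < s' → Measurable[I.hist s'] (I.fb s)
  fb_mem : ∀ s ω j, I.fb s ω j ∈ Set.Icc (0 : ℝ) 1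
  act_law : ∀ r < R, ∀ (i : Fin N) (a : Fin (k i)) (m : ℕ) (x : Profile k),
    ∀ᵐ ω ∂μ, m < I.batch r ω i →
      (μ[(I.act (slot r i a m) ⁻¹' {x}).indicator (fun _ => (1 : ℝ)) | I.hist (slot r i a m)]) ω =
        (if x i = a then 1 else 0) * ∏ j ∈ Finset.univ.erase i, I.strat r ω j (x j)
  fb_mean : ∀ r < R, ∀ (i : Fin N) (a : Fin (k i)) (m : ℕ) (j : Fin N),
    ∀ᵐ ω ∂μ, m < I.batch r ω i →
      (μ[fun ω' => I.fb (slot r i a m) ω' j |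
        I.hist (slot r i a m) ⊔ MeasurableSpace.comap (I.act (slot r i a m)) inferInstance]) ω =
        u j (I.act (slot r i a m) ω)

end Interaction

/-! ### The algorithm -/

/-- The threshold `p = min{ε, Δ} / (8 A N)`. -/
def thr {N : ℕ} (k : Fin N → ℕ) (ε Δ : ℝ) : ℝ := min ε Δ / (8 * maxActions k * N)

/-- The exponential-weights distribution `∝ exp (η * U ·)`. -/
def softmax {n : ℕ} (η : ℝ) (U : Fin n → ℝ) (a : Fin n) : ℝ :=
  Real.exp (η * U a) / ∑ c, Real.exp (η * U c)

/-- Remove the actions of weight at most `p` and renormalize. -/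
def clip {n : ℕ} (p : ℝ) (x : Fin n → ℝ) (a : Fin n) : ℝ :=
  if x a ≤ p then 0 else x a / ∑ c, if x c ≤ p then 0 else x c

/-- The number of repetitions in the iterative best response phase. -/
def ibrBatch {N : ℕ} {k : Fin N → ℕ} (u : Fin N → Profile k → ℝ) (Δ δ : ℝ) : ℕ :=
  ⌈64 * Real.log (elimLength u Δ * N * maxActions k / δ) / Δ ^ 2⌉₊

/-- The cumulative weight `∑_{τ=1}^{t+1} θ_i^{(τ)}(a)`, where `θ τ` stands for `θ^{(τ+1)}`. -/
def cumWeight {N : ℕ} {k : Fin N → ℕ} (θ : ℕ → Weights k) (t : ℕ) (i : Fin N) (a : Fin (k i)) : ℝ :=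
  ∑ τ ∈ Finset.range (t + 1), θ τ i a

/-- The adaptive minibatch size `M_i^{(t+1)}`. -/
def ceBatch {N : ℕ} {k : Fin N → ℕ} (Δ δ : ℝ) (T : ℕ) (θ : ℕ → Weights k) (t : ℕ) (i : Fin N) : ℕ :=
  ⌈⨆ a : Fin (k i), 64 * Real.log (maxActions k * N * T / δ) * θ t i a /
    (Δ ^ 2 * cumWeight θ t i a)⌉₊

/-- The adaptive learning rate `η_{t+1,i}^b` of expert `b`. -/
def ceRate {N : ℕ} {k : Fin N → ℕ} (ε Δ : ℝ) (θ : ℕ → Weights k) (t : ℕ) (i : Fin N)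
    (b : Fin (k i)) : ℝ :=
  max (2 * Real.log (1 / thr k ε Δ) / (Δ * cumWeight θ t i b))
    (Real.sqrt (maxActions k * Real.log (maxActions k) / (t + 1 : ℕ)))

/-- The interaction `I` is a run of the algorithm with `T` rounds. Rounds `r < L` are the iterative
best response phase, with joint actions `br 0, br 1, …, br L` (the first is arbitrary, and ties
between best responses are broken arbitrarily); round `L + t` with `t < T` is round `t + 1` of
adaptive Hedge, whose strategies are `θ t = I.strat (L + t)`. -/
structure IsAdaptiveHedgeRun {N : ℕ} {k : Fin N → ℕ} {Ω : Type*} [MeasurableSpace Ω]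
    (u : Fin N → Profile k → ℝ) (ε Δ δ : ℝ) (T : ℕ)
    (I : Interaction k Ω) (br : ℕ → Ω → Profile k) : Prop where
  ibr_strat : ∀ r < elimLength u Δ, ∀ ω i, I.strat r ω i = Pi.single (br r ω i) 1
  ibr_batch : ∀ r < elimLength u Δ, ∀ ω i, I.batch r ω i = ibrBatch u Δ δ
  ibr_best : ∀ r < elimLength u Δ, ∀ ω i a, I.avg r ω i a ≤ I.avg r ω i (br (r + 1) ω i)
  init : ∀ ω i a, I.strat (elimLength u Δ) ω i a =
    (1 - k i * thr k ε Δ) * (if a = br (elimLength u Δ) ω i then 1 else 0) + thr k ε Δ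
  ce_batch : ∀ t < T, ∀ ω i, I.batch (elimLength u Δ + t) ω i =
    ceBatch Δ δ T (fun τ => I.strat (elimLength u Δ + τ) ω) t i
  ce_simplex : ∀ t, t + 1 < T → ∀ ω i,
    I.strat (elimLength u Δ + (t + 1)) ω i ∈ stdSimplex ℝ (Fin (k i))
  ce_fixed : ∀ t, t + 1 < T → ∀ ω i a,
    I.strat (elimLength u Δ + (t + 1)) ω i a =
      ∑ b, softmax (ceRate ε Δ (fun τ => I.strat (elimLength u Δ + τ) ω) t i b)
          (fun c => ∑ τ ∈ Finset.range (t + 1),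
            I.avg (elimLength u Δ + τ) ω i c * I.strat (elimLength u Δ + τ) ω i b) a *
        I.strat (elimLength u Δ + (t + 1)) ω i b

/-- The output `(∑_t ⊗_i clip (θ_i^{(t)})) / T`. -/
def ceOutput {N : ℕ} {k : Fin N → ℕ} (p : ℝ) (T : ℕ) (θ : ℕ → Weights k) (x : Profile k) : ℝ :=
  (∑ t ∈ Finset.range T, ∏ i, clip p (θ t i) (x i)) / T

/-- The logarithmic factor suppressed by `Õ`, at least `1` when `N, A ≥ 1` and
`ε, Δ, δ ≤ 1`. -/
def logFactor {N : ℕ} (k : Fin N → ℕ) (ε Δ δ : ℝ) : ℝ :=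
  1 + Real.log (N * maxActions k / (ε * Δ * δ))

/-- The number of rounds `T = ⌈C (A/ε² + A/Δ²) logFactor ^ κ⌉`. -/
def ceRounds {N : ℕ} (C : ℝ) (κ : ℕ) (k : Fin N → ℕ) (ε Δ δ : ℝ) : ℕ :=
  ⌈C * (maxActions k / ε ^ 2 + maxActions k / Δ ^ 2) * logFactor k ε Δ δ ^ κ⌉₊

end RatCE

end

open MeasureTheory RatCE

/-! Call noise the difference between an observed average payoff and the corresponding expected
utility. The output must be supported on rationalizable actions and have small swap regret. Both
follow deterministically from three noise events, each failing with probability at most δ.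

Support. An action of E_l loses Δ to a fixed mixed strategy while the opponents avoid E_{l-1}; it
still loses 3Δ/4 when each opponent gives every eliminated action weight at most p, since the total
bad mass is then at most min{ε,Δ}/8 (`oppExp_le_of_dominated`). If the noise in these comparisons is
below Δ, the l-th best response leaves E_l (`br_notMem_elim`), so adaptive Hedge starts with weight
p on every action of E_L. This persists by induction on the round (`ce_strat_le_thr`). Let S be the
cumulative weight of expert b, whose utilities are scaled by θ(b). Up to noise ΔS/4 the expert sees
a gap 3ΔS/4, and a rate of at least 2 ln(1/p)/(ΔS) turns the remaining ΔS/2 into a softmax weight of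
at most p. The next strategy is a mixture of the experts, so it obeys the same bound, and the final
clipping removes these actions.

The noise of an expert must therefore be small relative to the random S, not merely to the number of
rounds. The minibatch sizes make its variance proxy at most S²Δ²/(256 l), where l = ln(ANT/δ)
(`expert_variance_le`). A union bound over a geometric grid of exponential slopes then provides a
slope of the right order 1/S (`le_of_grid_bound`).

Equilibrium. The fixed point condition turns the regrets of the experts into swap regret
(`swap_regret`). Large early rates are harmless: their cost is a sum of terms of the form w/(S+w),
which telescopes to a logarithm. Adding the noise, uniformly over all swap functions, and the
clipping error gives less than ε per round (`isApproxCE_ceOutput`).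

All tail bounds come from one exponential supermartingale over single plays
(`integral_exp_sum_le_one`). The sample bound uses the same telescoping of weight over cumulative
weight (`sum_div_cumWeight_le`). -/

open MeasureTheory

namespace RatCE

/-! ### Expectations under product strategies. -/

section ProductDistributions

variable {N : ℕ} {k : Fin N → ℕ}

/-- The expectation of `f` when player `i` plays `c` and the others follow `θ`. -/
noncomputable def oppExp (f : Profile k → ℝ) (θ : Weights k) (i : Fin N) (c : Fin (k i)) : ℝ :=
  ∑ x, ((if x i = c then 1 else 0) * ∏ j ∈ Finset.univ.erase i, θ j (x j)) * f x

theorem sum_prod_mul_eq_sum_oppExp (f : Profile k → ℝ) (θ : Weights k) (i : Fin N) :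
    ∑ x, (∏ j, θ j (x j)) * f x = ∑ c, θ i c * oppExp f θ i c := by
  simp only [oppExp, Finset.mul_sum]
  rw [Finset.sum_comm]
  refine Finset.sum_congr rfl fun x _ => ?_
  rw [Finset.sum_eq_single (x i)]
  · rw [← Finset.mul_prod_erase Finset.univ (fun j => θ j (x j)) (Finset.mem_univ i)]
    simp; ring
  · intro c _ hc
    simp [Ne.symm hc]
  · simp

theorem oppExp_congr {f g : Profile k → ℝ} (θ : Weights k) (i : Fin N) (c : Fin (k i))
    (h : ∀ x, x i = c → f x = g x) : oppExp f θ i c = oppExp g θ i c := by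
  refine Finset.sum_congr rfl fun x _ => ?_
  by_cases hx : x i = c
  · rw [h x hx]
  · simp [hx]

/-- The weights involve only the opponents' coordinates, so overwriting coordinate `i` is a
weight-preserving bijection between the slices `x i = c` and `x i = d`. -/
theorem oppExp_update (f : Profile k → ℝ) (θ : Weights k) (i : Fin N) (c d : Fin (k i)) :
    oppExp (fun x => f (Function.update x i d)) θ i c = oppExp f θ i d := by
  have key : ∀ (c : Fin (k i)) (g : Profile k → ℝ), oppExp g θ i c =
      ∑ x with x i = c, (∏ j ∈ Finset.univ.erase i, θ j (x j)) * g x := by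
    intro c g
    rw [Finset.sum_filter]
    refine Finset.sum_congr rfl fun x _ => ?_
    by_cases hx : x i = c <;> simp [hx]
  rw [key, key]
  refine Finset.sum_nbij' (fun x => Function.update x i d) (fun x => Function.update x i c)
    ?_ ?_ ?_ ?_ ?_
  · simp
  · simp
  · intro x hx
    simp only [Finset.mem_filter, Finset.mem_univ, true_and] at hx
    simp [← hx]
  · intro x hx
    simp only [Finset.mem_filter, Finset.mem_univ, true_and] at hx
    simp [← hx]
  · intro x _
    congr 1
    refine Finset.prod_congr rfl fun j hj => ?_
    rw [Function.update_of_ne (Finset.ne_of_mem_erase hj)]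

theorem sum_prod_mul_update (f : Profile k → ℝ) (θ : Weights k) (i : Fin N)
    (φ : Fin (k i) → Fin (k i)) :
    ∑ x, (∏ j, θ j (x j)) * f (Function.update x i (φ (x i))) =
      ∑ c, θ i c * oppExp f θ i (φ c) := by
  rw [sum_prod_mul_eq_sum_oppExp (fun x => f (Function.update x i (φ (x i)))) θ i]
  refine Finset.sum_congr rfl fun c _ => ?_
  rw [← oppExp_update f θ i c (φ c)]
  congr 1
  exact oppExp_congr θ i c fun x hx => by rw [hx]

theorem sum_prod_eq_one (θ : Weights k) (h : ∀ i, ∑ c, θ i c = 1) :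
    ∑ x : Profile k, ∏ j, θ j (x j) = 1 := by
  have := Finset.prod_univ_sum (fun i : Fin N => (Finset.univ : Finset (Fin (k i)))) θ
  rw [Fintype.piFinset_univ] at this
  rw [← this]
  simp [h]

/-- Replacing player `i`'s strategy by a point mass makes this an ordinary product expectation, to
which normalization, monotonicity and the union bound apply. -/
theorem oppExp_eq_sum_prod (f : Profile k → ℝ) (θ : Weights k) (i : Fin N) (c : Fin (k i)) :
    oppExp f θ i c = ∑ x, (∏ j, Function.update θ i (Pi.single c 1) j (x j)) * f x := by
  refine Finset.sum_congr rfl fun x _ => ?_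
  rw [← Finset.mul_prod_erase Finset.univ (fun j => Function.update θ i (Pi.single c 1) j (x j))
    (Finset.mem_univ i)]
  congr 2
  · simp [Pi.single_apply]
  · refine Finset.prod_congr rfl fun j hj => ?_
    rw [Function.update_of_ne (Finset.ne_of_mem_erase hj)]

theorem update_single_mem_stdSimplex {θ : Weights k} (h : ∀ i, θ i ∈ stdSimplex ℝ (Fin (k i)))
    (i : Fin N) (c : Fin (k i)) (j : Fin N) :
    Function.update θ i (Pi.single c 1) j ∈ stdSimplex ℝ (Fin (k j)) := by
  by_cases hj : j = i
  · subst hj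
    simpa using single_mem_stdSimplex ℝ c
  · rw [Function.update_of_ne hj]
    exact h j

theorem prod_nonneg_of_simplex {θ : Weights k} (h : ∀ i, θ i ∈ stdSimplex ℝ (Fin (k i)))
    (x : Profile k) : 0 ≤ ∏ j, θ j (x j) :=
  Finset.prod_nonneg fun j _ => (h j).1 _

theorem oppExp_const {θ : Weights k} (h : ∀ i, θ i ∈ stdSimplex ℝ (Fin (k i)))
    (i : Fin N) (c : Fin (k i)) (r : ℝ) : oppExp (fun _ => r) θ i c = r := by
  rw [oppExp_eq_sum_prod, ← Finset.sum_mul, sum_prod_eq_one, one_mul]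
  exact fun j => (update_single_mem_stdSimplex h i c j).2

theorem oppExp_mono {θ : Weights k} (h : ∀ i, θ i ∈ stdSimplex ℝ (Fin (k i)))
    (i : Fin N) (c : Fin (k i)) {f g : Profile k → ℝ} (hfg : ∀ x, f x ≤ g x) :
    oppExp f θ i c ≤ oppExp g θ i c := by
  rw [oppExp_eq_sum_prod, oppExp_eq_sum_prod]
  exact Finset.sum_le_sum fun x _ => mul_le_mul_of_nonneg_left (hfg x)
    (prod_nonneg_of_simplex (update_single_mem_stdSimplex h i c) x)

theorem oppExp_mem_Icc {θ : Weights k} (h : ∀ i, θ i ∈ stdSimplex ℝ (Fin (k i)))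
    (i : Fin N) (c : Fin (k i)) {f : Profile k → ℝ} (hf : ∀ x, f x ∈ Set.Icc (0 : ℝ) 1) :
    oppExp f θ i c ∈ Set.Icc (0 : ℝ) 1 :=
  ⟨(oppExp_const h i c 0).symm.le.trans (oppExp_mono h i c fun x => (hf x).1),
    (oppExp_mono h i c fun x => (hf x).2).trans (oppExp_const h i c 1).le⟩

theorem sum_prod_mul_marginal {θ : Weights k} (h : ∀ i, θ i ∈ stdSimplex ℝ (Fin (k i)))
    (j : Fin N) (g : Fin (k j) → ℝ) :
    ∑ x : Profile k, (∏ l, θ l (x l)) * g (x j) = ∑ c, θ j c * g c := by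
  rw [sum_prod_mul_eq_sum_oppExp _ _ j]
  refine Finset.sum_congr rfl fun c _ => ?_
  rw [oppExp_congr (g := fun _ => g c) θ j c (fun x hx => by rw [hx]), oppExp_const h]

open Classical in
/-- Union bound: the probability of a bad action under a product distribution. -/
theorem sum_prod_mul_exists_le {θ : Weights k} (h : ∀ i, θ i ∈ stdSimplex ℝ (Fin (k i)))
    (bad : (j : Fin N) → Set (Fin (k j))) :
    ∑ x : Profile k, (∏ l, θ l (x l)) * (if ∃ j, x j ∈ bad j then 1 else 0) ≤
      ∑ j, ∑ c, θ j c * (if c ∈ bad j then 1 else 0) := by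
  calc _ ≤ ∑ x : Profile k, (∏ l, θ l (x l)) * ∑ j, (if x j ∈ bad j then (1 : ℝ) else 0) := by
        refine Finset.sum_le_sum fun x _ => mul_le_mul_of_nonneg_left ?_
          (prod_nonneg_of_simplex h x)
        split_ifs with hx
        · obtain ⟨j, hj⟩ := hx
          refine le_trans (by simp [hj]) (Finset.single_le_sum
            (f := fun j => if x j ∈ bad j then (1 : ℝ) else 0) (fun j _ => ?_) (Finset.mem_univ j))
          split_ifs <;> norm_num
        · exact Finset.sum_nonneg fun j _ => by split_ifs <;> norm_num
    _ = _ := by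
        simp only [Finset.mul_sum]
        rw [Finset.sum_comm]
        refine Finset.sum_congr rfl fun j _ => ?_
        exact sum_prod_mul_marginal h j (fun c => if c ∈ bad j then (1 : ℝ) else 0)

theorem le_maxActions (k : Fin N → ℕ) (i : Fin N) : k i ≤ maxActions k :=
  Finset.le_sup (f := k) (Finset.mem_univ i)

open Classical in
theorem sum_bad_mass_le {θ : Weights k} {p : ℝ} (hp : 0 ≤ p)
    (bad : (j : Fin N) → Set (Fin (k j))) (hbad : ∀ j, ∀ c ∈ bad j, θ j c ≤ p) :
    ∑ j, ∑ c, θ j c * (if c ∈ bad j then 1 else 0) ≤ N * maxActions k * p := by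
  have h1 : ∀ j ∈ (Finset.univ : Finset (Fin N)),
      ∑ c, θ j c * (if c ∈ bad j then (1 : ℝ) else 0) ≤ maxActions k * p := by
    intro j _
    have h2 : ∀ c ∈ (Finset.univ : Finset (Fin (k j))),
        θ j c * (if c ∈ bad j then (1 : ℝ) else 0) ≤ p := by
      intro c _
      split_ifs with hc
      · simpa using hbad j c hc
      · simpa using hp
    refine (Finset.sum_le_card_nsmul _ _ _ h2).trans ?_
    simp only [Finset.card_univ, Fintype.card_fin, nsmul_eq_mul]
    exact mul_le_mul_of_nonneg_right (by exact_mod_cast le_maxActions k j) hp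
  refine (Finset.sum_le_card_nsmul _ _ _ h1).trans ?_
  simp [mul_assoc]

end ProductDistributions

/-! ### Iterated elimination and its robustness to rare bad actions. -/

section Elimination

variable {N : ℕ} {k : Fin N → ℕ} {u : Fin N → Profile k → ℝ} {Δ : ℝ}

theorem mem_elim_succ {l : ℕ} {i : Fin N} {a : Fin (k i)} :
    a ∈ elim u Δ (l + 1) i ↔ ∃ x ∈ stdSimplex ℝ (Fin (k i)),
      ∀ y : Profile k, (∀ j, j ≠ i → y j ∉ elim u Δ l j) →
        u i (Function.update y i a) ≤ (∑ c, x c * u i (Function.update y i c)) - Δ := Iff.rfl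

theorem elim_subset_succ (l : ℕ) (i : Fin N) : elim u Δ l i ⊆ elim u Δ (l + 1) i := by
  induction l generalizing i with
  | zero => intro a ha; exact absurd ha (Set.notMem_empty a)
  | succ l ih =>
    rintro a ⟨x, hx, h⟩
    exact ⟨x, hx, fun y hy => h y fun j hj hmem => hy j hj (ih j hmem)⟩

/-- The eliminated sets grow, so every round that changes them eliminates at least one further
action of some player. -/
theorem le_sum_ncard_elim (l : ℕ) (h : ∀ m < l, elim u Δ (m + 1) ≠ elim u Δ m) :
    l ≤ ∑ i, (elim u Δ l i).ncard := by
  induction l with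
  | zero => simp
  | succ l ih =>
    have hlt : ∑ i, (elim u Δ l i).ncard < ∑ i, (elim u Δ (l + 1) i).ncard := by
      have hne := h l (Nat.lt_succ_self l)
      obtain ⟨i, hi⟩ := Function.ne_iff.1 hne
      refine Finset.sum_lt_sum (fun j _ => Set.ncard_le_ncard (elim_subset_succ l j)
        (Set.toFinite _)) ⟨i, Finset.mem_univ i, Set.ncard_lt_ncard
          (lt_of_le_of_ne (elim_subset_succ l i) (Ne.symm hi)) (Set.toFinite _)⟩
    have := ih fun m hm => h m (Nat.lt_succ_of_lt hm)
    omega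

theorem sum_ncard_elim_le (l : ℕ) : ∑ i, (elim u Δ l i).ncard ≤ N * maxActions k := by
  have h : ∀ i ∈ (Finset.univ : Finset (Fin N)), (elim u Δ l i).ncard ≤ maxActions k := by
    intro i _
    refine le_trans ?_ (le_maxActions k i)
    have := Set.ncard_le_ncard (Set.subset_univ (elim u Δ l i)) (Set.toFinite _)
    simpa [Set.ncard_univ] using this
  simpa using Finset.sum_le_card_nsmul _ _ _ h

/-- Needed because `elimLength` is an infimum: it is attained only if the set is nonempty. -/
theorem exists_elim_succ_eq : ∃ l, elim u Δ (l + 1) = elim u Δ l := by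
  by_contra! h
  have h1 := le_sum_ncard_elim (u := u) (Δ := Δ) (N * maxActions k + 1) fun m _ => h m
  have h2 := sum_ncard_elim_le (u := u) (Δ := Δ) (N * maxActions k + 1)
  omega

theorem elim_elimLength_succ :
    elim u Δ (elimLength u Δ + 1) = elim u Δ (elimLength u Δ) :=
  Nat.sInf_mem (s := {l | elim u Δ (l + 1) = elim u Δ l}) exists_elim_succ_eq

/-- Keeps the logarithm of `L N A / δ` within a constant multiple of `logFactor`. -/
theorem elimLength_le : elimLength u Δ ≤ N * maxActions k :=
  (le_sum_ncard_elim _ fun _ hm => Nat.notMem_of_lt_sInf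
    (s := {l | elim u Δ (l + 1) = elim u Δ l}) hm).trans (sum_ncard_elim_le _)

/-- A dominated action stays dominated in expectation against opponents who rarely play
eliminated actions. -/
theorem oppExp_le_of_dominated {θ : Weights k} (hθ : ∀ i, θ i ∈ stdSimplex ℝ (Fin (k i)))
    (hu : ∀ i x, u i x ∈ Set.Icc (0 : ℝ) 1) (hΔ : 0 ≤ Δ) {p : ℝ} (hp : 0 ≤ p)
    (bad : (j : Fin N) → Set (Fin (k j))) (hbad : ∀ j, ∀ c ∈ bad j, θ j c ≤ p)
    (i : Fin N) (a : Fin (k i)) (x : Fin (k i) → ℝ) (hx : x ∈ stdSimplex ℝ (Fin (k i)))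
    (hdom : ∀ y : Profile k, (∀ j, j ≠ i → y j ∉ bad j) →
        u i (Function.update y i a) ≤ (∑ c, x c * u i (Function.update y i c)) - Δ) :
    oppExp (u i) θ i a ≤
      (∑ c, x c * oppExp (u i) θ i c) - Δ + (1 + Δ) * (N * maxActions k * p) := by
  classical
  set θ' := Function.update θ i (Pi.single a 1) with hθ'
  have hs := update_single_mem_stdSimplex hθ i a
  -- Player `i`'s own coordinate is exempt: under `θ'` it is always `a`, which may itself be bad.
  let bad' : (j : Fin N) → Set (Fin (k j)) := fun j => if j = i then ∅ else bad j
  -- On a bad profile, `0 ≤ u i ≤ 1` alone shows that adding `1 + Δ` restores the inequality.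
  have hpt : ∀ y : Profile k, u i (Function.update y i a) ≤
      (∑ c, x c * u i (Function.update y i c)) - Δ +
        (1 + Δ) * (if ∃ j, y j ∈ bad' j then 1 else 0) := by
    intro y
    split_ifs with hy
    · have h1 : 0 ≤ ∑ c, x c * u i (Function.update y i c) :=
        Finset.sum_nonneg fun c _ => mul_nonneg (hx.1 c) (hu i _).1
      have h2 := (hu i (Function.update y i a)).2
      linarith
    · have := hdom y fun j hj hmem => hy ⟨j, by simpa [bad', hj] using hmem⟩
      simpa using this
  have hexp : ∀ c, oppExp (u i) θ i c = ∑ y, (∏ j, θ' j (y j)) * u i (Function.update y i c) := by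
    intro c
    rw [← oppExp_update (u i) θ i a c, oppExp_eq_sum_prod]
  have hone : ∑ y : Profile k, ∏ j, θ' j (y j) = 1 := sum_prod_eq_one θ' fun j => (hs j).2
  have hunion := (sum_prod_mul_exists_le hs bad').trans
    (sum_bad_mass_le hp bad' (fun j c hc => by
      by_cases hj : j = i
      · simp [bad', hj] at hc
      · rw [Function.update_of_ne hj]
        exact hbad j c (by simpa [bad', hj] using hc)))
  rw [hexp a]
  calc _ ≤ ∑ y, (∏ j, θ' j (y j)) * ((∑ c, x c * u i (Function.update y i c)) - Δ +
        (1 + Δ) * (if ∃ j, y j ∈ bad' j then 1 else 0)) :=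
        Finset.sum_le_sum fun y _ => mul_le_mul_of_nonneg_left (hpt y)
          (prod_nonneg_of_simplex hs y)
    _ = (∑ c, x c * oppExp (u i) θ i c) - Δ + (1 + Δ) *
        ∑ y : Profile k, (∏ j, θ' j (y j)) * (if ∃ j, y j ∈ bad' j then 1 else 0) := by
        have e1 : ∑ c, x c * oppExp (u i) θ i c =
            ∑ y, (∏ j, θ' j (y j)) * ∑ c, x c * u i (Function.update y i c) := by
          simp only [hexp, Finset.mul_sum]
          rw [Finset.sum_comm]
          exact Finset.sum_congr rfl fun y _ => Finset.sum_congr rfl fun c _ => by ring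
        have e2 : Δ = ∑ y : Profile k, (∏ j, θ' j (y j)) * Δ := by
          rw [← Finset.sum_mul, hone, one_mul]
        rw [e1]
        conv_rhs => rw [e2]
        rw [Finset.mul_sum, ← Finset.sum_sub_distrib, ← Finset.sum_add_distrib]
        conv_rhs => rw [← e2]
        exact Finset.sum_congr rfl fun y _ => by ring
    _ ≤ _ := by
        have : 0 ≤ 1 + Δ := by linarith
        gcongr

end Elimination

/-! ### The cost of clipping. -/

section Clipping

variable {N : ℕ} {k : Fin N → ℕ}

/-- `x` with the weights at most `p` replaced by `0`. -/
noncomputable def keep {n : ℕ} (p : ℝ) (x : Fin n → ℝ) (a : Fin n) : ℝ :=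
  if x a ≤ p then 0 else x a

theorem clip_eq_keep_div {n : ℕ} (p : ℝ) (x : Fin n → ℝ) (a : Fin n) :
    clip p x a = keep p x a / ∑ c, keep p x c := by
  unfold clip keep
  split_ifs <;> simp

theorem keep_nonneg {n : ℕ} {p : ℝ} {x : Fin n → ℝ} (hx : ∀ a, 0 ≤ x a) (a : Fin n) :
    0 ≤ keep p x a := by
  unfold keep
  split_ifs
  exacts [le_rfl, hx a]

theorem sum_keep_pos {n : ℕ} {p : ℝ} {x : Fin n → ℝ} (hx : x ∈ stdSimplex ℝ (Fin n))
    (hp : n * p < 1) : 0 < ∑ c, keep p x c := by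
  -- The maximum with 0 allows for a negative `p`.
  have h : ∀ c ∈ (Finset.univ : Finset (Fin n)), x c ≤ keep p x c + max p 0 := by
    intro c _
    unfold keep
    split_ifs with hc
    · rw [zero_add]; exact hc.trans (le_max_left _ _)
    · linarith [le_max_right p 0]
  have h1 := Finset.sum_le_sum h
  rw [hx.2, Finset.sum_add_distrib, Finset.sum_const] at h1
  simp only [Finset.card_univ, Fintype.card_fin, nsmul_eq_mul] at h1
  rcases max_cases p 0 with h2 | h2 <;> rw [h2.1] at h1 <;> linarith

theorem clip_mem_stdSimplex {n : ℕ} {p : ℝ} {x : Fin n → ℝ} (hx : x ∈ stdSimplex ℝ (Fin n))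
    (hp : n * p < 1) : clip p x ∈ stdSimplex ℝ (Fin n) := by
  have hpos := sum_keep_pos hx hp
  refine ⟨fun a => ?_, ?_⟩
  · rw [clip_eq_keep_div]
    exact div_nonneg (keep_nonneg hx.1 a) hpos.le
  · simp only [clip_eq_keep_div, ← Finset.sum_div]
    exact div_self hpos.ne'

theorem lt_of_clip_ne_zero {n : ℕ} {p : ℝ} {x : Fin n → ℝ} {a : Fin n} (h : clip p x a ≠ 0) :
    p < x a := by
  by_contra! hle
  exact h (by simp [clip, hle])

/-- Clipping every player's strategy changes expectations of `[-1,1]`-valued functions by at most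
twice the mass that is removed. -/
theorem sum_prod_clip_mul_le {θ : Weights k} (hθ : ∀ i, θ i ∈ stdSimplex ℝ (Fin (k i)))
    {p : ℝ} (hp : 0 ≤ p) (hp1 : N * maxActions k * p < 1) (f : Profile k → ℝ)
    (hf : ∀ x, |f x| ≤ 1) :
    ∑ x : Profile k, (∏ i, clip p (θ i) (x i)) * f x ≤
      (∑ x : Profile k, (∏ i, θ i (x i)) * f x) + 2 * (N * maxActions k * p) := by
  classical
  set q : Profile k → ℝ := fun x => ∏ i, keep p (θ i) (x i) with hq
  set Z : ℝ := ∑ x, q x with hZ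
  have hZprod : Z = ∏ i, ∑ c, keep p (θ i) c := by
    have := Finset.prod_univ_sum (fun i : Fin N => (Finset.univ : Finset (Fin (k i))))
      (fun i c => keep p (θ i) c)
    rw [Fintype.piFinset_univ] at this
    exact this.symm
  have hq0 : ∀ x, 0 ≤ q x := fun x => Finset.prod_nonneg fun i _ => keep_nonneg (hθ i).1 _
  have hqle : ∀ x, q x ≤ ∏ i, θ i (x i) := fun x =>
    Finset.prod_le_prod (fun i _ => keep_nonneg (hθ i).1 _) fun i _ => by
      unfold keep
      split_ifs
      exacts [(hθ i).1 _, le_rfl]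
  have hone : ∑ x : Profile k, ∏ i, θ i (x i) = 1 := sum_prod_eq_one θ fun i => (hθ i).2
  have hZ1 : Z ≤ 1 := hone ▸ Finset.sum_le_sum fun x _ => hqle x
  let bad : (j : Fin N) → Set (Fin (k j)) := fun j => {c | θ j c ≤ p}
  have hdiff : ∀ x ∈ (Finset.univ : Finset (Profile k)), ∏ i, θ i (x i) ≤
      q x + (∏ i, θ i (x i)) * (if ∃ j, x j ∈ bad j then 1 else 0) := by
    intro x _
    split_ifs with h
    · linarith [hq0 x]
    · have : q x = ∏ i, θ i (x i) := Finset.prod_congr rfl fun i _ => by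
        have : ¬ θ i (x i) ≤ p := fun hle => h ⟨i, hle⟩
        simp [keep, this]
      linarith
  have hZlow : 1 - N * maxActions k * p ≤ Z := by
    have h1 := Finset.sum_le_sum hdiff
    rw [hone, Finset.sum_add_distrib] at h1
    have h2 := (sum_prod_mul_exists_le hθ bad).trans (sum_bad_mass_le hp bad fun j c hc => hc)
    linarith
  have hZ0 : 0 < Z := by linarith
  -- The player-wise normalizers multiply to `Z`, so clipping every player conditions the product
  -- distribution on the kept actions.
  have hclip : ∀ x : Profile k, ∏ i, clip p (θ i) (x i) = q x / Z := by
    intro x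
    simp only [clip_eq_keep_div, Finset.prod_div_distrib]
    rw [hZprod]
  have hdivle : ∀ x, q x ≤ q x / Z := fun x => by
    rw [le_div_iff₀ hZ0]
    nlinarith [hq0 x]
  -- Since `|f| ≤ 1`, renormalizing costs at most `q / Z - q` and removal at most the original
  -- weight minus `q`. Each of these sums to `1 - Z`.
  have hpt : ∀ x ∈ (Finset.univ : Finset (Profile k)), (∏ i, clip p (θ i) (x i)) * f x ≤
      (∏ i, θ i (x i)) * f x + ((q x / Z - q x) + ((∏ i, θ i (x i)) - q x)) := by
    intro x _
    rw [hclip]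
    have h1 := abs_le.1 (hf x)
    have h2 := hdivle x
    have h3 := hqle x
    nlinarith [mul_nonneg (sub_nonneg.2 h2) (sub_nonneg.2 h1.2),
      mul_nonneg (sub_nonneg.2 h3) (neg_le_iff_add_nonneg.1 h1.1)]
  refine (Finset.sum_le_sum hpt).trans ?_
  rw [Finset.sum_add_distrib, Finset.sum_add_distrib, Finset.sum_sub_distrib,
    Finset.sum_sub_distrib, hone, ← Finset.sum_div, ← hZ, div_self hZ0.ne']
  linarith

end Clipping

/-! ### The exponential supermartingale. -/

section ExponentialMartingale

/-- Hoeffding's lemma for a Bernoulli variable. -/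
theorem one_add_mul_exp_sub_one_le {q : ℝ} (hq : q ∈ Set.Icc (0 : ℝ) 1) (t : ℝ) :
    1 + q * (Real.exp t - 1) ≤ Real.exp (t * q + t ^ 2 / 8) := by
  -- For the two-point law with mean `q` the moment generating function is explicit, and Hoeffding's
  -- lemma on `[0,1]` gives the exponent `t ^ 2 / 8`.
  let ν : Measure ℝ := ENNReal.ofReal q • Measure.dirac 1 + ENNReal.ofReal (1 - q) • Measure.dirac 0
  have hq0 := hq.1
  have hq1 : 0 ≤ 1 - q := sub_nonneg.2 hq.2
  have hν : IsProbabilityMeasure ν := ⟨by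
    simp only [ν, Measure.add_apply, Measure.smul_apply, measure_univ, smul_eq_mul, mul_one]
    rw [← ENNReal.ofReal_add hq0 hq1]
    simp⟩
  have hint : ∀ g : ℝ → ℝ, ∫ x, g x ∂ν = q * g 1 + (1 - q) * g 0 := by
    intro g
    have h1 : ∀ (c r : ℝ), Integrable g (ENNReal.ofReal r • Measure.dirac c) := fun c r =>
      (integrable_dirac (by simp)).smul_measure ENNReal.ofReal_ne_top
    rw [integral_add_measure (h1 _ _) (h1 _ _), integral_smul_measure, integral_smul_measure,
      integral_dirac, integral_dirac, ENNReal.toReal_ofReal hq0, ENNReal.toReal_ofReal hq1]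
    simp
  have hmem : ∀ᵐ x ∂ν, (fun x : ℝ => x) x ∈ Set.Icc (0 : ℝ) 1 := by
    rw [ae_add_measure_iff]
    constructor <;> refine Measure.ae_smul_measure ?_ _ <;> simp [ae_dirac_eq]
  have h := (ProbabilityTheory.hasSubgaussianMGF_of_mem_Icc (μ := ν) (X := fun x => x)
    aemeasurable_id hmem).mgf_le t
  have hmean : ∫ x, x ∂ν = q := by rw [hint]; simp
  rw [ProbabilityTheory.mgf, hint, hmean] at h
  have e1 : Real.exp (t * (1 - q)) = Real.exp t * Real.exp (-(t * q)) := by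
    rw [← Real.exp_add]; ring_nf
  have e2 : Real.exp (t * (0 - q)) = Real.exp (-(t * q)) := by ring_nf
  rw [e1, e2] at h
  have e3 : Real.exp (t * q + t ^ 2 / 8) = Real.exp (t * q) * Real.exp (t ^ 2 / 8) := Real.exp_add _ _
  have e4 : Real.exp (t * q) * Real.exp (-(t * q)) = 1 := by rw [← Real.exp_add]; simp
  have h' := mul_le_mul_of_nonneg_left h (Real.exp_pos (t * q)).le
  rw [e3]
  refine le_trans (le_of_eq ?_) (h'.trans (le_of_eq ?_))
  · linear_combination (-(q * Real.exp t) - (1 - q)) * e4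
  · congr 2
    norm_num
    ring

/-- The bound is affine in `x`, so after conditioning only the mean of the observation enters. -/
theorem exp_mul_le_chord {x : ℝ} (hx : x ∈ Set.Icc (0 : ℝ) 1) (t : ℝ) :
    Real.exp (t * x) ≤ 1 + x * (Real.exp t - 1) := by
  have := convexOn_exp.2 (Set.mem_univ 0) (Set.mem_univ t) (sub_nonneg.2 hx.2) hx.1 (by ring)
  simp only [smul_eq_mul, mul_zero, zero_add, Real.exp_zero, mul_one] at this
  rw [mul_comm]
  linarith

variable {Ω ι : Type*} {mΩ : MeasurableSpace Ω} [LinearOrder ι]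

/-- The exponential supermartingale of predictably weighted `[0,1]`-valued observations. Where the
weight vanishes, nothing is assumed about the mean. -/
theorem integral_exp_sum_le_one (μ : Measure Ω) [IsProbabilityMeasure μ] (ℱ : Filtration ι mΩ)
    (f l q : ι → Ω → ℝ) (B : ℝ) (S : Finset ι)
    (hfm : ∀ s, Measurable (f s))
    (hf : ∀ s s', s < s' → Measurable[ℱ s'] (f s))
    (hf01 : ∀ s ω, f s ω ∈ Set.Icc (0 : ℝ) 1)
    (hq : ∀ s ∈ S, Measurable[ℱ s] (q s)) (hq01 : ∀ s ∈ S, ∀ ω, q s ω ∈ Set.Icc (0 : ℝ) 1)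
    (hl : ∀ s ∈ S, Measurable[ℱ s] (l s)) (hlB : ∀ s ∈ S, ∀ ω, |l s ω| ≤ B)
    (hmean : ∀ s ∈ S, ∀ H : Ω → ℝ, Measurable[ℱ s] H → (∃ C, ∀ ω, |H ω| ≤ C) →
      (∀ ω, l s ω = 0 → H ω = 0) → ∫ ω, H ω * f s ω ∂μ = ∫ ω, H ω * q s ω ∂μ) :
    Integrable (fun ω => Real.exp (∑ s ∈ S, (l s ω * (f s ω - q s ω) - l s ω ^ 2 / 8))) μ ∧
    ∫ ω, Real.exp (∑ s ∈ S, (l s ω * (f s ω - q s ω) - l s ω ^ 2 / 8)) ∂μ ≤ 1 := by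
  have hbd : ∀ s ∈ S, ∀ ω, l s ω * (f s ω - q s ω) - l s ω ^ 2 / 8 ≤ B := by
    intro s hs ω
    have h1 : |f s ω - q s ω| ≤ 1 := by
      have := hf01 s ω; have := hq01 s hs ω
      rw [abs_le]; constructor <;> linarith [(hf01 s ω).1, (hf01 s ω).2, (hq01 s hs ω).1, (hq01 s hs ω).2]
    have h2 : l s ω * (f s ω - q s ω) ≤ B * 1 := by
      refine (le_abs_self _).trans ?_
      rw [abs_mul]
      exact mul_le_mul (hlB s hs ω) h1 (abs_nonneg _) ((abs_nonneg _).trans (hlB s hs ω))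
    nlinarith [sq_nonneg (l s ω)]
  have hint : ∀ g : Ω → ℝ, Measurable g → (∃ C, ∀ ω, |g ω| ≤ C) → Integrable g μ :=
    fun g hg ⟨C, hC⟩ => Integrable.of_bound hg.aestronglyMeasurable C (ae_of_all _ hC)
  have hmeasS : ∀ S' ⊆ S, ∀ 𝒢 : MeasurableSpace Ω, (∀ s ∈ S', ℱ s ≤ 𝒢) →
      (∀ s ∈ S', Measurable[𝒢] (f s)) →
      Measurable[𝒢] (fun ω => Real.exp (∑ s ∈ S', (l s ω * (f s ω - q s ω) - l s ω ^ 2 / 8))) := by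
    intro S' hS' 𝒢 h𝒢 hf𝒢
    refine Real.measurable_exp.comp (Finset.measurable_sum S' fun s hs => ?_)
    have hl' := (hl s (hS' hs)).mono (h𝒢 s hs) le_rfl
    have hq' := (hq s (hS' hs)).mono (h𝒢 s hs) le_rfl
    exact (hl'.mul ((hf𝒢 s hs).sub hq')).sub ((hl'.pow_const 2).div_const 8)
  have hbdS : ∀ S' ⊆ S, ∀ ω, |Real.exp (∑ s ∈ S', (l s ω * (f s ω - q s ω) - l s ω ^ 2 / 8))| ≤
      Real.exp (S'.card • B) := by
    intro S' hS' ω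
    rw [abs_of_pos (Real.exp_pos _), Real.exp_le_exp]
    exact Finset.sum_le_card_nsmul _ _ _ fun s hs => hbd s (hS' hs) ω
  have hI : ∀ S' ⊆ S,
      Integrable (fun ω => Real.exp (∑ s ∈ S', (l s ω * (f s ω - q s ω) - l s ω ^ 2 / 8))) μ :=
    fun S' hS' => hint _ (hmeasS S' hS' mΩ (fun s _ => ℱ.le s) fun s _ => hfm s) ⟨_, hbdS S' hS'⟩
  refine ⟨hI S subset_rfl, ?_⟩
  suffices h : ∀ S' ⊆ S,
      ∫ ω, Real.exp (∑ s ∈ S', (l s ω * (f s ω - q s ω) - l s ω ^ 2 / 8)) ∂μ ≤ 1 from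
    h S subset_rfl
  intro S'
  induction S' using Finset.induction_on_max with
  | empty => intro _; simp
  -- The latest observation is peeled off; all factors with earlier labels are measurable in `ℱ a`.
  | insert a S' hmax ih =>
    intro hS'
    have haS : a ∈ S := hS' (Finset.mem_insert_self a S')
    have hsub : S' ⊆ S := (Finset.subset_insert a S').trans hS'
    have hnot : a ∉ S' := fun h => lt_irrefl _ (hmax a h)
    set G : Ω → ℝ := fun ω => Real.exp (∑ s ∈ S', (l s ω * (f s ω - q s ω) - l s ω ^ 2 / 8))
      with hG
    have hGm : Measurable[ℱ a] G := hmeasS S' hsub (ℱ a) (fun s hs => ℱ.mono (hmax s hs).le)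
      fun s hs => hf s a (hmax s hs)
    set K : Ω → ℝ := fun ω => G ω * Real.exp (-(l a ω * q a ω) - l a ω ^ 2 / 8) with hK
    have hla := hl a haS
    have hqa := hq a haS
    have hKm : Measurable[ℱ a] K := hGm.mul
      (Real.measurable_exp.comp ((hla.mul hqa).neg.sub ((hla.pow_const 2).div_const 8)))
    have hKb : ∀ ω, |K ω| ≤ Real.exp (S'.card • B) * Real.exp B := by
      intro ω
      rw [hK, abs_mul, abs_of_pos (Real.exp_pos (-(l a ω * q a ω) - l a ω ^ 2 / 8))]
      refine mul_le_mul (hbdS S' hsub ω) (Real.exp_le_exp.2 ?_) (Real.exp_pos _).le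
        (Real.exp_pos _).le
      have h1 := hlB a haS ω
      have h2 := hq01 a haS ω
      have h3 : -(l a ω * q a ω) ≤ B * 1 := by
        refine (neg_le_abs _).trans ?_
        rw [abs_mul, abs_of_nonneg h2.1]
        exact mul_le_mul h1 h2.2 h2.1 ((abs_nonneg _).trans h1)
      nlinarith [sq_nonneg (l a ω)]
    -- The coefficient of `f a` after the chord bound. It vanishes wherever `l a` does, so `hmean`
    -- applies although nothing is known about plays that do not happen.
    set H : Ω → ℝ := fun ω => K ω * (Real.exp (l a ω) - 1) with hH
    have hHm : Measurable[ℱ a] H := hKm.mul ((Real.measurable_exp.comp hla).sub_const 1)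
    have hHb : ∀ ω, |H ω| ≤ Real.exp (S'.card • B) * Real.exp B * (Real.exp B + 1) := by
      intro ω
      rw [hH, abs_mul]
      refine mul_le_mul (hKb ω) ?_ (abs_nonneg _) (by positivity)
      have h1 := (abs_le.1 (hlB a haS ω)).2
      have h2 := Real.exp_le_exp.2 h1
      have h3 := Real.exp_pos (l a ω)
      rw [abs_le]
      constructor <;> linarith
    have hmul : ∀ g : Ω → ℝ, Measurable g → (∀ ω, g ω ∈ Set.Icc (0 : ℝ) 1) →
        Integrable (fun ω => H ω * g ω) μ := fun g hg hg01 =>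
      hint _ ((hHm.mono (ℱ.le a) le_rfl).mul hg) ⟨_, fun ω => by
        rw [abs_mul, abs_of_nonneg (hg01 ω).1]
        exact (mul_le_of_le_one_right (abs_nonneg _) (hg01 ω).2).trans (hHb ω)⟩
    have hKint : Integrable K μ := hint _ (hKm.mono (ℱ.le a) le_rfl) ⟨_, hKb⟩
    have hHf := hmul (f a) (hfm a) (hf01 a)
    have hHq := hmul (q a) (hqa.mono (ℱ.le a) le_rfl) (hq01 a haS)
    calc ∫ ω, Real.exp (∑ s ∈ insert a S', (l s ω * (f s ω - q s ω) - l s ω ^ 2 / 8)) ∂μ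
        ≤ ∫ ω, (K ω + H ω * f a ω) ∂μ := by
          refine integral_mono (hI _ hS') (hKint.add hHf) fun ω => ?_
          dsimp only
          rw [Finset.sum_insert hnot]
          have e : Real.exp (l a ω * (f a ω - q a ω) - l a ω ^ 2 / 8 +
              ∑ s ∈ S', (l s ω * (f s ω - q s ω) - l s ω ^ 2 / 8)) =
              K ω * Real.exp (l a ω * f a ω) := by
            rw [hK, hG]
            dsimp only
            rw [← Real.exp_add, ← Real.exp_add]
            congr 1; ring
          rw [e]
          have hK0 : 0 ≤ K ω := mul_nonneg (Real.exp_pos _).le (Real.exp_pos _).le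
          have := mul_le_mul_of_nonneg_left (exp_mul_le_chord (hf01 a ω) (l a ω)) hK0
          refine this.trans (le_of_eq ?_)
          rw [hH]; ring
      _ = ∫ ω, (K ω + H ω * q a ω) ∂μ := by
          rw [integral_add hKint hHf, integral_add hKint hHq,
            hmean a haS H hHm ⟨_, hHb⟩ (fun ω h0 => by rw [hH]; simp [h0])]
      _ ≤ ∫ ω, G ω ∂μ := by
          refine integral_mono (hKint.add hHq) (hI S' hsub) fun ω => ?_
          dsimp only
          have h1 := one_add_mul_exp_sub_one_le (hq01 a haS ω) (l a ω)
          have hK0 : 0 ≤ K ω := mul_nonneg (Real.exp_pos _).le (Real.exp_pos _).le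
          have h2 := mul_le_mul_of_nonneg_left h1 hK0
          have e : K ω * Real.exp (l a ω * q a ω + l a ω ^ 2 / 8) = G ω := by
            rw [hK]
            dsimp only
            rw [mul_assoc, ← Real.exp_add]
            ring_nf
            simp
          rw [e] at h2
          refine le_trans (le_of_eq ?_) h2
          rw [hH]; ring
      _ ≤ 1 := ih hsub

theorem measureReal_ge_le_exp_neg {μ : Measure Ω} [IsProbabilityMeasure μ] {Y : Ω → ℝ}
    (hY : Integrable (fun ω => Real.exp (Y ω)) μ) (h1 : ∫ ω, Real.exp (Y ω) ∂μ ≤ 1) (x : ℝ) :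
    μ.real {ω | x ≤ Y ω} ≤ Real.exp (-x) := by
  have h := mul_meas_ge_le_integral_of_nonneg (ae_of_all μ fun ω => (Real.exp_pos (Y ω)).le) hY
    (Real.exp x)
  simp only [Real.exp_le_exp] at h
  rw [Real.exp_neg, ← one_div, le_div_iff₀ (Real.exp_pos x), mul_comm]
  exact h.trans h1

theorem integral_mul_eq_integral_mul_condExp {m m₀ : MeasurableSpace Ω}
    {μ : Measure Ω} [IsProbabilityMeasure μ] (hm : m ≤ m₀) {H g : Ω → ℝ} (hH : Measurable[m] H)
    {C : ℝ} (hC : ∀ ω, |H ω| ≤ C) (hg : Integrable g μ) :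
    ∫ ω, H ω * g ω ∂μ = ∫ ω, H ω * (μ[g | m]) ω ∂μ := by
  have h := condExp_stronglyMeasurable_mul_of_bound (μ := μ) hm hH.stronglyMeasurable hg C
    (ae_of_all _ hC)
  rw [← integral_condExp hm (f := fun ω => H ω * g ω)]
  exact integral_congr_ae h

end ExponentialMartingale

/-! ### Concentration of bandit averages. -/

section Feedback

variable {N : ℕ} {k : Fin N → ℕ} {Ω : Type*} [mΩ : MeasurableSpace Ω]

theorem slot_lt_slot {r i a m r' i' a' m' : ℕ} : slot r i a m < slot r' i' a' m' ↔
    r < r' ∨ r = r' ∧ (i < i' ∨ i = i' ∧ (a < a' ∨ a = a' ∧ m < m')) := by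
  simp [slot, Prod.Lex.toLex_lt_toLex]

theorem slot_zero_le (r i a m : ℕ) : slot r 0 0 0 ≤ slot r i a m := by
  rw [← not_lt, slot_lt_slot]
  omega

namespace Interaction.IsBandit

variable {I : Interaction k Ω} {u : Fin N → Profile k → ℝ} {μ : Measure Ω} {R : ℕ}

theorem measurable_act (hI : I.IsBandit u μ R) (r i a m : ℕ) :
    Measurable (I.act (slot r i a m)) :=
  (hI.act_meas _ (slot (r + 1) i a m) (slot_lt_slot.2 (by omega))).mono (I.hist.le _) le_rfl

theorem measurable_fb (hI : I.IsBandit u μ R) (r i a m : ℕ) (j : Fin N) :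
    Measurable (fun ω => I.fb (slot r i a m) ω j) :=
  (measurable_pi_apply j).comp
    ((hI.fb_meas _ (slot (r + 1) i a m) (slot_lt_slot.2 (by omega))).mono (I.hist.le _) le_rfl)

theorem measurable_oppExp (hI : I.IsBandit u μ R) {r : ℕ} (hr : r < R) (f : Profile k → ℝ)
    (i : Fin N) (a : Fin (k i)) :
    Measurable[I.hist (slot r 0 0 0)] (fun ω => oppExp f (I.strat r ω) i a) := by
  refine Finset.measurable_sum _ fun x _ => Measurable.mul_const (Measurable.const_mul ?_ _) _
  exact Finset.measurable_prod _ fun j _ => hI.strat_meas r hr j (x j)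

/-- Among the plays that happen, the mean feedback given the past is the expected utility. -/
theorem integral_mul_fb [IsProbabilityMeasure μ] (hI : I.IsBandit u μ R) {r : ℕ} (hr : r < R)
    (i : Fin N) (a : Fin (k i)) (m : ℕ) (j : Fin N) (H : Ω → ℝ)
    (hH : Measurable[I.hist (slot r i a m)] H) {C : ℝ} (hC : ∀ ω, |H ω| ≤ C)
    (hH0 : ∀ ω, ¬ m < I.batch r ω i → H ω = 0) :
    ∫ ω, H ω * I.fb (slot r i a m) ω j ∂μ =
      ∫ ω, H ω * oppExp (u j) (I.strat r ω) i a ∂μ := by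
  set s := slot r i a m with hs
  have hact := hI.measurable_act r i a m
  have hfbint : Integrable (fun ω => I.fb s ω j) μ :=
    Integrable.of_bound (hI.measurable_fb r i a m j).aestronglyMeasurable 1
      (ae_of_all _ fun ω => by
        rw [Real.norm_eq_abs, abs_of_nonneg (hI.fb_mem s ω j).1]
        exact (hI.fb_mem s ω j).2)
  have hHm : Measurable H := hH.mono (I.hist.le s) le_rfl
  set ind : Profile k → Ω → ℝ := fun x => (I.act s ⁻¹' {x}).indicator fun _ => (1 : ℝ) with hind
  have hindint : ∀ x, Integrable (ind x) μ := fun x =>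
    (integrable_const (1 : ℝ)).indicator (hact (measurableSet_singleton x))
  have hlaw : ∀ x : Profile k, (fun ω => H ω * (μ[ind x | I.hist s]) ω) =ᵐ[μ] fun ω => H ω *
      ((if x i = a then 1 else 0) * ∏ l ∈ Finset.univ.erase i, I.strat r ω l (x l)) := by
    intro x
    filter_upwards [hI.act_law r hr i a m x] with ω hω
    by_cases h : m < I.batch r ω i
    · rw [← hω h]
    · rw [hH0 ω h, zero_mul, zero_mul]
  have hlawint : ∀ x : Profile k, Integrable (fun ω => H ω *
      ((if x i = a then 1 else 0) * ∏ l ∈ Finset.univ.erase i, I.strat r ω l (x l))) μ := fun x =>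
    (integrable_condExp.bdd_mul hHm.aestronglyMeasurable (ae_of_all _ hC)).congr (hlaw x)
  -- Conditioning is done twice: on the past together with the realized joint action, which turns
  -- feedback into utility, and then on the past alone, which turns each joint action into its
  -- product probability.
  calc ∫ ω, H ω * I.fb s ω j ∂μ = ∫ ω, H ω * u j (I.act s ω) ∂μ := by
        rw [integral_mul_eq_integral_mul_condExp (sup_le (I.hist.le s) hact.comap_le)
          (hH.mono le_sup_left le_rfl) hC hfbint]
        refine integral_congr_ae ?_
        filter_upwards [hI.fb_mean r hr i a m j] with ω hω
        by_cases h : m < I.batch r ω i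
        · rw [← hω h]
        · rw [hH0 ω h, zero_mul, zero_mul]
    _ = ∫ ω, ∑ x, u j x * (H ω * ind x ω) ∂μ := by
        refine integral_congr_ae (ae_of_all _ fun ω => ?_)
        dsimp only
        rw [Finset.sum_eq_single (I.act s ω)]
        · simp [hind, mul_comm]
        · intro x _ hx
          simp [hind, Ne.symm hx]
        · simp
    _ = ∑ x, u j x * ∫ ω, H ω * ind x ω ∂μ := by
        rw [integral_finsetSum]
        · exact Finset.sum_congr rfl fun x _ => integral_const_mul _ _
        · intro x _
          exact ((hindint x).bdd_mul hHm.aestronglyMeasurable (ae_of_all _ hC)).const_mul _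
    _ = ∑ x, u j x * ∫ ω, H ω * ((if x i = a then 1 else 0) *
          ∏ l ∈ Finset.univ.erase i, I.strat r ω l (x l)) ∂μ := by
        refine Finset.sum_congr rfl fun x _ => ?_
        rw [integral_mul_eq_integral_mul_condExp (I.hist.le s) hH hC (hindint x),
          integral_congr_ae (hlaw x)]
    _ = ∫ ω, H ω * oppExp (u j) (I.strat r ω) i a ∂μ := by
        simp only [← integral_const_mul]
        rw [← integral_finsetSum _ fun x _ => (hlawint x).const_mul _]
        refine integral_congr_ae (ae_of_all _ fun ω => ?_)
        dsimp only
        rw [oppExp, Finset.mul_sum]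
        exact Finset.sum_congr rfl fun x _ => by ring

/-- The exponential supermartingale of the deviations of player `i`'s average payoffs from the
expected utilities, with predictable weights `w`. -/
theorem integral_exp_avg_sub_le_one [IsProbabilityMeasure μ] (hI : I.IsBandit u μ R)
    (hu : ∀ i x, u i x ∈ Set.Icc (0 : ℝ) 1) (i : Fin N) (s : Finset ℕ) (hs : ∀ r ∈ s, r < R)
    (hstrat : ∀ r ∈ s, ∀ ω j, I.strat r ω j ∈ stdSimplex ℝ (Fin (k j)))
    {K : ℕ} (hpos : ∀ r ∈ s, ∀ ω, 0 < I.batch r ω i) (hK : ∀ r ∈ s, ∀ ω, I.batch r ω i ≤ K)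
    (w : ℕ → Ω → Fin (k i) → ℝ) {B : ℝ}
    (hw : ∀ r ∈ s, ∀ c, Measurable[I.hist (slot r 0 0 0)] fun ω => w r ω c)
    (hwB : ∀ r ∈ s, ∀ ω c, |w r ω c| ≤ B) :
    Integrable (fun ω => Real.exp (∑ r ∈ s, ∑ c,
      (w r ω c * (I.avg r ω i c - oppExp (u i) (I.strat r ω) i c) -
        w r ω c ^ 2 / (8 * I.batch r ω i)))) μ ∧
    ∫ ω, Real.exp (∑ r ∈ s, ∑ c,
      (w r ω c * (I.avg r ω i c - oppExp (u i) (I.strat r ω) i c) -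
        w r ω c ^ 2 / (8 * I.batch r ω i))) ∂μ ≤ 1 := by
  -- Only player `i`'s exploratory plays matter; they are indexed by round, action and repetition,
  -- and `g` embeds this order into the global order of labels.
  let ι : Type := ℕ ×ₗ (Fin (k i) ×ₗ ℕ)
  let e : ℕ × Fin (k i) × ℕ ↪ ι :=
    ⟨fun x => toLex (x.1, toLex x.2), fun x y h =>
      have h' : (x.1, toLex x.2) = (y.1, toLex y.2) := h
      Prod.ext (Prod.mk.inj h').1 (Prod.mk.inj h').2⟩
  let R' : ι → ℕ := fun t => (ofLex t).1
  let A' : ι → Fin (k i) := fun t => (ofLex (ofLex t).2).1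
  let M' : ι → ℕ := fun t => (ofLex (ofLex t).2).2
  let g : ι → Slot := fun t => slot (R' t) i (A' t) (M' t)
  have hg : StrictMono g := by
    intro t t' h
    rw [slot_lt_slot]
    rw [Prod.Lex.lt_iff, Prod.Lex.lt_iff] at h
    rcases h with h | ⟨h1, h2 | ⟨h2, h3⟩⟩
    · exact Or.inl h
    · exact Or.inr ⟨h1, Or.inr ⟨rfl, Or.inl h2⟩⟩
    · exact Or.inr ⟨h1, Or.inr ⟨rfl, Or.inr ⟨congrArg Fin.val h2, h3⟩⟩⟩
  let ℱ : Filtration ι mΩ :=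
    ⟨fun t => I.hist (g t), fun t t' h => I.hist.mono (hg.monotone h), fun t => I.hist.le _⟩
  let S : Finset ι := (s ×ˢ Finset.univ ×ˢ Finset.range K).map e
  let f : ι → Ω → ℝ := fun t ω => I.fb (g t) ω i
  let q : ι → Ω → ℝ := fun t ω => oppExp (u i) (I.strat (R' t) ω) i (A' t)
  -- The weight of an average is split evenly over its plays, and labels beyond the batch get 0. The
  -- squares of the shares add up to `w ^ 2 / batch`, hence the gain from large batches.
  let l : ι → Ω → ℝ := fun t ω =>
    if M' t < I.batch (R' t) ω i then w (R' t) ω (A' t) / I.batch (R' t) ω i else 0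
  have hS : ∀ t ∈ S, R' t ∈ s := by
    intro t ht
    obtain ⟨x, hx, rfl⟩ := Finset.mem_map.1 ht
    exact (Finset.mem_product.1 hx).1
  have hle : ∀ t, I.hist (slot (R' t) 0 0 0) ≤ ℱ t := fun t => I.hist.mono (slot_zero_le _ _ _ _)
  have hsum : ∀ ω, ∑ t ∈ S, (l t ω * (f t ω - q t ω) - l t ω ^ 2 / 8) = ∑ r ∈ s, ∑ c,
      (w r ω c * (I.avg r ω i c - oppExp (u i) (I.strat r ω) i c) -
        w r ω c ^ 2 / (8 * I.batch r ω i)) := by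
    intro ω
    simp only [S, Finset.sum_map]
    rw [Finset.sum_product]
    refine Finset.sum_congr rfl fun r hr => ?_
    rw [Finset.sum_product]
    refine Finset.sum_congr rfl fun c _ => ?_
    set b := I.batch r ω i with hb
    have hb0 : (b : ℝ) ≠ 0 := by
      have := hpos r hr ω
      exact_mod_cast this.ne'
    have hsub : Finset.range b ⊆ Finset.range K := Finset.range_subset_range.2 (hK r hr ω)
    have hl : ∀ m, l (e (r, c, m)) ω = if m < b then w r ω c / b else 0 := fun m => rfl
    have h1 : ∑ m ∈ Finset.range K, (l (e (r, c, m)) ω * (f (e (r, c, m)) ω - q (e (r, c, m)) ω) -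
        l (e (r, c, m)) ω ^ 2 / 8) = ∑ m ∈ Finset.range b, (w r ω c / b *
          (I.fb (slot r i c m) ω i - oppExp (u i) (I.strat r ω) i c) - (w r ω c / b) ^ 2 / 8) := by
      rw [← Finset.sum_subset hsub]
      · refine Finset.sum_congr rfl fun m hm => ?_
        rw [hl, if_pos (Finset.mem_range.1 hm)]
        rfl
      · intro m _ hm
        rw [hl, if_neg fun h => hm (Finset.mem_range.2 h)]
        simp
    rw [h1, Finset.sum_sub_distrib, ← Finset.mul_sum, Finset.sum_sub_distrib]
    simp only [Finset.sum_const, Finset.card_range, nsmul_eq_mul, Interaction.avg, ← hb]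
    field_simp
  have hlm : ∀ t ∈ S, Measurable[ℱ t] (l t) := by
    intro t ht
    refine Measurable.mono ?_ (hle t) le_rfl
    have hb := hI.batch_meas (R' t) (hs _ (hS t ht)) i
    refine Measurable.ite ?_ ?_ measurable_const
    · exact hb (measurableSet_Ioi (a := M' t))
    · exact (hw _ (hS t ht) (A' t)).div (measurable_from_top.comp hb)
  have hlB : ∀ t ∈ S, ∀ ω, |l t ω| ≤ B := by
    intro t ht ω
    have hB0 := hwB _ (hS t ht) ω (A' t)
    simp only [l]
    split_ifs with h
    · rw [abs_div, Nat.abs_cast]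
      have h1 : (1 : ℝ) ≤ I.batch (R' t) ω i := by exact_mod_cast hpos _ (hS t ht) ω
      exact (div_le_self (abs_nonneg _) h1).trans hB0
    · rw [abs_zero]
      exact (abs_nonneg _).trans hB0
  have := integral_exp_sum_le_one μ ℱ f l q B S
    (fun t => hI.measurable_fb _ _ _ _ i)
    (fun t t' h => (measurable_pi_apply i).comp (hI.fb_meas _ _ (hg h)))
    (fun t ω => hI.fb_mem _ ω i)
    (fun t ht => (hI.measurable_oppExp (hs _ (hS t ht)) (u i) i (A' t)).mono (hle t) le_rfl)
    (fun t ht ω => oppExp_mem_Icc (hstrat _ (hS t ht) ω) i _ (hu i)) hlm hlB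
    (fun t ht H hH hC hH0 => by
      obtain ⟨C, hC⟩ := hC
      refine hI.integral_mul_fb (hs _ (hS t ht)) i (A' t) (M' t) i H hH hC fun ω hω => hH0 ω ?_
      simp [l, hω])
  simpa only [hsum] using this

end Interaction.IsBandit

end Feedback

/-! ### Deterministic regret bounds. -/

section Hedge

variable {n : ℕ}

/-- The log-sum-exp potential of exponential weights with learning rate `h`. -/
noncomputable def hedgePotential (h : ℝ) (U : Fin n → ℝ) : ℝ :=
  Real.log (∑ c, (1 / n : ℝ) * Real.exp (h * U c)) / h

theorem sum_exp_pos (hn : 0 < n) (U : Fin n → ℝ) : 0 < ∑ c, Real.exp (U c) :=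
  Finset.sum_pos (fun _ _ => Real.exp_pos _) ⟨⟨0, hn⟩, Finset.mem_univ _⟩

theorem softmax_pos (hn : 0 < n) (h : ℝ) (U : Fin n → ℝ) (a : Fin n) : 0 < softmax h U a :=
  div_pos (Real.exp_pos _) (sum_exp_pos hn fun c => h * U c)

theorem sum_softmax (hn : 0 < n) (h : ℝ) (U : Fin n → ℝ) : ∑ a, softmax h U a = 1 := by
  simp only [softmax, ← Finset.sum_div]
  exact div_self (sum_exp_pos hn fun c => h * U c).ne'

theorem potential_arg_pos (hn : 0 < n) (h : ℝ) (U : Fin n → ℝ) :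
    0 < ∑ c, (1 / n : ℝ) * Real.exp (h * U c) := by
  rw [← Finset.mul_sum]
  have : (0 : ℝ) < n := by exact_mod_cast hn
  exact mul_pos (by positivity) (sum_exp_pos hn _)

/-- The power mean inequality with exponent `h' / h`. Lowering the rate thus never raises the
potential, which is how decreasing rates are handled. -/
theorem hedgePotential_mono_rate (hn : 0 < n) {h h' : ℝ} (hh : 0 < h) (hle : h ≤ h')
    (U : Fin n → ℝ) : hedgePotential h U ≤ hedgePotential h' U := by
  have hn' : (0 : ℝ) < n := by exact_mod_cast hn
  have hh' : 0 < h' := hh.trans_le hle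
  have hpow := Real.rpow_arith_mean_le_arith_mean_rpow Finset.univ (fun _ : Fin n => (1 / n : ℝ))
    (fun c => Real.exp (h * U c)) (fun _ _ => by positivity) (by simp [hn'.ne'])
    (fun _ _ => (Real.exp_pos _).le) ((one_le_div hh).2 hle)
  simp only [← Real.exp_mul] at hpow
  have e : ∀ c, h * U c * (h' / h) = h' * U c := fun c => by field_simp
  simp only [e] at hpow
  have hlog := Real.log_le_log (Real.rpow_pos_of_pos (potential_arg_pos hn h U) _) hpow
  rw [Real.log_rpow (potential_arg_pos hn h U)] at hlog
  unfold hedgePotential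
  rw [div_le_div_iff₀ hh hh']
  rw [div_mul_eq_mul_div, div_le_iff₀ hh] at hlog
  linarith

/-- One term of the sum of exponentials already gives this; the uniform prior `1 / n` costs `log n`,
paid once and at the final rate. -/
theorem le_hedgePotential_add (hn : 0 < n) {h : ℝ} (hh : 0 < h) (U : Fin n → ℝ) (c : Fin n) :
    U c ≤ hedgePotential h U + Real.log n / h := by
  have hn' : (0 : ℝ) < n := by exact_mod_cast hn
  unfold hedgePotential
  rw [← add_div, le_div_iff₀ hh, ← Real.log_mul (potential_arg_pos hn h U).ne' hn'.ne',
    ← Finset.mul_sum]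
  have e : 1 / (n : ℝ) * (∑ c, Real.exp (h * U c)) * n = ∑ c, Real.exp (h * U c) := by field_simp
  rw [e, Real.le_log_iff_exp_le (sum_exp_pos hn fun c => h * U c), mul_comm]
  exact Finset.single_le_sum (f := fun c => Real.exp (h * U c)) (fun _ _ => (Real.exp_pos _).le)
    (Finset.mem_univ c)

theorem hedgePotential_le (hn : 0 < n) {h : ℝ} (hh : 0 < h) {U : Fin n → ℝ} {w : ℝ}
    (hU : ∀ c, U c ≤ w) : hedgePotential h U ≤ w := by
  have hn' : (0 : ℝ) < n := by exact_mod_cast hn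
  unfold hedgePotential
  rw [div_le_iff₀ hh, Real.log_le_iff_le_exp (potential_arg_pos hn h U)]
  calc _ ≤ ∑ _c : Fin n, (1 / n : ℝ) * Real.exp (w * h) := by
        refine Finset.sum_le_sum fun c _ => mul_le_mul_of_nonneg_left ?_ (by positivity)
        rw [Real.exp_le_exp, mul_comm]
        exact mul_le_mul_of_nonneg_right (hU c) hh.le
    _ = _ := by simp; field_simp

/-- The increment is `log Q / h`, with `Q` the mean of `exp (h g)` under the softmax. The trivial
bound `w` serves large `h * w`, the second-order expansion of `exp` serves `h * w ≤ 1`. -/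
theorem hedgePotential_add_le (hn : 0 < n) {h : ℝ} (hh : 0 < h) (U g : Fin n → ℝ) {w : ℝ}
    (hg0 : ∀ c, 0 ≤ g c) (hgw : ∀ c, g c ≤ w) :
    hedgePotential h (fun c => U c + g c) ≤
      hedgePotential h U + (∑ a, softmax h U a * g a + min w (h * w ^ 2)) := by
  set s := softmax h U with hs
  have hs0 : ∀ a, 0 ≤ s a := fun a => (softmax_pos hn h U a).le
  have hs1 : ∑ a, s a = 1 := sum_softmax hn h U
  have hw0 : 0 ≤ w := (hg0 ⟨0, hn⟩).trans (hgw ⟨0, hn⟩)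
  have hn' : (0 : ℝ) < n := by exact_mod_cast hn
  set Q : ℝ := ∑ a, s a * Real.exp (h * g a) with hQ
  have hratio : ∑ c, (1 / n : ℝ) * Real.exp (h * (U c + g c)) =
      (∑ c, (1 / n : ℝ) * Real.exp (h * U c)) * Q := by
    rw [← Finset.mul_sum, ← Finset.mul_sum, mul_assoc]
    congr 1
    rw [hQ, Finset.mul_sum]
    refine Finset.sum_congr rfl fun c _ => ?_
    rw [hs, softmax, mul_add, Real.exp_add]
    have := (sum_exp_pos hn fun c => h * U c).ne'
    field_simp
  have hQpos : 0 < Q := Finset.sum_pos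
    (fun a _ => mul_pos (softmax_pos hn h U a) (Real.exp_pos _)) ⟨⟨0, hn⟩, Finset.mem_univ _⟩
  have hsg : 0 ≤ ∑ a, s a * g a := Finset.sum_nonneg fun a _ => mul_nonneg (hs0 a) (hg0 a)
  have hA : Real.log Q ≤ h * w := by
    rw [Real.log_le_iff_le_exp hQpos]
    calc Q ≤ ∑ a, s a * Real.exp (h * w) := Finset.sum_le_sum fun a _ =>
          mul_le_mul_of_nonneg_left (Real.exp_le_exp.2 (mul_le_mul_of_nonneg_left (hgw a) hh.le))
            (hs0 a)
      _ = Real.exp (h * w) := by rw [← Finset.sum_mul, hs1, one_mul]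
  have hB : h * w ≤ 1 → Real.log Q ≤ h * (∑ a, s a * g a + h * w ^ 2) := by
    intro h1
    have hQle : Q ≤ 1 + h * (∑ a, s a * g a) + (h * w) ^ 2 := by
      calc Q ≤ ∑ a, (s a + h * (s a * g a) + s a * (h * w) ^ 2) := by
            refine Finset.sum_le_sum fun a _ => ?_
            have hx0 : 0 ≤ h * g a := mul_nonneg hh.le (hg0 a)
            have hxw : h * g a ≤ h * w := mul_le_mul_of_nonneg_left (hgw a) hh.le
            have := (abs_le.1 (Real.abs_exp_sub_one_sub_id_le
              (x := h * g a) (by rw [abs_of_nonneg hx0]; linarith))).2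
            have hsq : (h * g a) ^ 2 ≤ (h * w) ^ 2 := by gcongr
            have h2 : Real.exp (h * g a) ≤ 1 + h * g a + (h * w) ^ 2 := by linarith
            refine (mul_le_mul_of_nonneg_left h2 (hs0 a)).trans (le_of_eq (by ring))
        _ = _ := by
            rw [Finset.sum_add_distrib, Finset.sum_add_distrib, ← Finset.mul_sum,
              ← Finset.sum_mul, hs1, one_mul]
    have := Real.log_le_sub_one_of_pos hQpos
    nlinarith
  have hlogQ : Real.log Q / h ≤ ∑ a, s a * g a + min w (h * w ^ 2) := by
    rw [div_le_iff₀ hh]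
    rcases le_total w (h * w ^ 2) with hc | hc
    · rw [min_eq_left hc]
      nlinarith
    · rw [min_eq_right hc]
      by_cases h1 : h * w ≤ 1
      · linarith [hB h1]
      · push Not at h1
        nlinarith
  unfold hedgePotential at hlogQ ⊢
  rw [hratio, Real.log_mul (potential_arg_pos hn h U).ne' hQpos.ne', add_div]
  linarith

/-- Regret of exponential weights with non-increasing learning rates. -/
theorem hedge_regret (hn : 0 < n) (g : ℕ → Fin n → ℝ) (w h : ℕ → ℝ) (m : ℕ)
    (hh : ∀ t, 0 < h t) (hanti : ∀ t < m, h (t + 1) ≤ h t)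
    (hg0 : ∀ t ≤ m, ∀ c, 0 ≤ g t c) (hgw : ∀ t ≤ m, ∀ c, g t c ≤ w t) (c : Fin n) :
    ∑ τ ∈ Finset.range (m + 1), g τ c ≤ w 0 + Real.log n / h m +
      ∑ t ∈ Finset.range m,
        (∑ a, softmax (h t) (fun c => ∑ τ ∈ Finset.range (t + 1), g τ c) a * g (t + 1) a +
          min (w (t + 1)) (h t * w (t + 1) ^ 2)) := by
  have key : ∀ j ≤ m, hedgePotential (h j) (fun c => ∑ τ ∈ Finset.range (j + 1), g τ c) ≤ w 0 +
      ∑ t ∈ Finset.range j,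
        (∑ a, softmax (h t) (fun c => ∑ τ ∈ Finset.range (t + 1), g τ c) a * g (t + 1) a +
          min (w (t + 1)) (h t * w (t + 1) ^ 2)) := by
    intro j
    induction j with
    | zero =>
      intro _
      simpa using hedgePotential_le hn (hh 0) (hgw 0 (Nat.zero_le _))
    | succ j ih =>
      intro hj
      rw [Finset.sum_range_succ]
      have h1 := hedgePotential_mono_rate hn (hh (j + 1)) (hanti j (by omega))
        (fun c => ∑ τ ∈ Finset.range (j + 1 + 1), g τ c)
      have h2 := hedgePotential_add_le hn (hh j) (fun c => ∑ τ ∈ Finset.range (j + 1), g τ c)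
        (g (j + 1)) (hg0 _ hj) (hgw _ hj)
      simp only [Finset.sum_range_succ _ (j + 1)] at h1 ⊢
      linarith [ih (by omega)]
  have h1 := le_hedgePotential_add hn (hh m) (fun c => ∑ τ ∈ Finset.range (m + 1), g τ c) c
  linarith [key m le_rfl]

/-- This is `1 - 1 / x ≤ log x` at `x = (S + w) / S`; it makes sums of weight over cumulative weight
telescope. -/
theorem div_add_le_log_sub_log {S w : ℝ} (hS : 0 < S) (hw : 0 ≤ w) :
    w / (S + w) ≤ Real.log (S + w) - Real.log S := by
  have hSw : 0 < S + w := by linarith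
  have := Real.one_sub_inv_le_log_of_pos (div_pos hSw hS)
  rw [Real.log_div hSw.ne' hS.ne', inv_div] at this
  refine le_trans (le_of_eq ?_) this
  field_simp
  ring

/-- If `w ≤ S`, then `S + w ≤ 2 * S` controls the quadratic term of rate `B / S`. Otherwise `w` is
at least half of `S + w`, and the trivial bound `w ≤ 1 ≤ B` suffices. -/
theorem min_rate_le {S w B e : ℝ} (hS : 0 < S) (hw0 : 0 ≤ w) (hw1 : w ≤ 1) (hB : 1 ≤ B)
    (he : 0 ≤ e) :
    min w (max (B / S) e * w ^ 2) ≤ e * w ^ 2 + 2 * B * (Real.log (S + w) - Real.log S) := by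
  have hlog := div_add_le_log_sub_log hS hw0
  have hSw : 0 < S + w := by linarith
  have hB0 : 0 < B := by linarith
  have h1 : 2 * B * (w / (S + w)) ≤ 2 * B * (Real.log (S + w) - Real.log S) :=
    mul_le_mul_of_nonneg_left hlog (by linarith)
  have h2 : 0 ≤ e * w ^ 2 := by positivity
  rcases le_total w S with hc | hc
  · refine (min_le_right _ _).trans ?_
    have h3 : max (B / S) e ≤ B / S + e := max_le (by linarith) (by
      have : 0 < B / S := by positivity
      linarith)
    have h4 : B / S * w ^ 2 ≤ 2 * B * (w / (S + w)) := by
      rw [div_mul_eq_mul_div, mul_div_assoc', div_le_div_iff₀ hS hSw]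
      have : w * (S + w) ≤ 2 * S := by nlinarith
      nlinarith [mul_le_mul_of_nonneg_left this (mul_nonneg hB0.le hw0)]
    nlinarith [mul_le_mul_of_nonneg_right h3 (sq_nonneg w)]
  · refine (min_le_left _ _).trans ?_
    have h4 : 1 ≤ 2 * (w / (S + w)) := by
      rw [mul_div_assoc', le_div_iff₀ hSw]
      linarith
    nlinarith

theorem sum_sqrt_div_le {E : ℝ} (hE : 0 ≤ E) (m : ℕ) :
    ∑ t ∈ Finset.range m, √(E / (t + 1 : ℕ)) ≤ 2 * √(E * m) := by
  have key : ∑ t ∈ Finset.range m, 1 / √((t + 1 : ℕ) : ℝ) ≤ 2 * √m := by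
    induction m with
    | zero => simp
    | succ m ih =>
      rw [Finset.sum_range_succ]
      have h0 : 0 < √((m + 1 : ℕ) : ℝ) := Real.sqrt_pos.2 (by positivity)
      have h1 : √((m + 1 : ℕ) : ℝ) ^ 2 = m + 1 := by
        rw [Real.sq_sqrt (by positivity)]; push_cast; ring
      have h2 : √(m : ℝ) ^ 2 = m := Real.sq_sqrt (by positivity)
      have h3 : 1 / √((m + 1 : ℕ) : ℝ) ≤ 2 * √((m + 1 : ℕ) : ℝ) - 2 * √m := by
        rw [div_le_iff₀ h0]
        nlinarith [sq_nonneg (√((m + 1 : ℕ) : ℝ) - √m)]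
      linarith
  have e : ∀ t ∈ Finset.range m, √(E / (t + 1 : ℕ)) = √E * (1 / √((t + 1 : ℕ) : ℝ)) := by
    intro t _
    rw [Real.sqrt_div hE, mul_one_div]
  rw [Finset.sum_congr rfl e, ← Finset.mul_sum, Real.sqrt_mul hE]
  nlinarith [mul_le_mul_of_nonneg_left key (Real.sqrt_nonneg E)]

/-- Swap regret of the fixed point of `n` copies of exponential weights, where copy `b` is run on
the utilities scaled by `θ t b` with the adaptive learning rate
`max (B / ∑_{τ ≤ t} θ τ b) √(E / (t + 1))`. -/
theorem swap_regret (hn : 0 < n) (θ v : ℕ → Fin n → ℝ) (m : ℕ) {p B E : ℝ} (hp : 0 < p)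
    (hB : 1 ≤ B) (hE : 0 ≤ E) (hnE : n * Real.log n ≤ E)
    (hθ : ∀ t ≤ m, θ t ∈ stdSimplex ℝ (Fin n)) (hθ0 : ∀ b, p ≤ θ 0 b)
    (hv : ∀ t ≤ m, ∀ c, v t c ∈ Set.Icc (0 : ℝ) 1)
    (hfix : ∀ t < m, ∀ a, θ (t + 1) a = ∑ b, softmax
      (max (B / ∑ τ ∈ Finset.range (t + 1), θ τ b) √(E / (t + 1 : ℕ)))
      (fun c => ∑ τ ∈ Finset.range (t + 1), v τ c * θ τ b) a * θ (t + 1) b)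
    (φ : Fin n → Fin n) :
    ∑ t ∈ Finset.range (m + 1), ∑ b, θ t b * (v t (φ b) - v t b) ≤
      1 + 3 * √(E * (m + 1 : ℕ)) + 2 * n * B * Real.log ((m + 1 : ℕ) / p) := by
  have hθ1 : ∀ t ≤ m, ∀ b, θ t b ≤ 1 := fun t ht b => by
    rw [← (hθ t ht).2]
    exact Finset.single_le_sum (fun c _ => (hθ t ht).1 c) (Finset.mem_univ b)
  set S : ℕ → Fin n → ℝ := fun t b => ∑ τ ∈ Finset.range (t + 1), θ τ b with hS
  have hSp : ∀ t ≤ m, ∀ b, p ≤ S t b := by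
    intro t ht b
    refine (hθ0 b).trans (Finset.single_le_sum (f := fun τ => θ τ b) (fun τ hτ => ?_)
      (Finset.mem_range.2 (Nat.succ_pos t)))
    exact (hθ τ (by have := Finset.mem_range.1 hτ; omega)).1 b
  have hSsucc : ∀ t b, S (t + 1) b = S t b + θ (t + 1) b := fun t b =>
    Finset.sum_range_succ _ _
  have hSm : ∀ b, S m b ≤ (m + 1 : ℕ) := by
    intro b
    have : ∀ τ ∈ Finset.range (m + 1), θ τ b ≤ 1 := fun τ hτ =>
      hθ1 τ (by have := Finset.mem_range.1 hτ; omega) b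
    simpa using Finset.sum_le_card_nsmul _ _ _ this
  -- learning rates, extended past the horizon so that they stay positive
  set h : Fin n → ℕ → ℝ := fun b t => max (B / S (min t m) b) √(E / (t + 1 : ℕ)) with hh
  have hhpos : ∀ b t, 0 < h b t := fun b t => lt_max_of_lt_left
    (div_pos (by linarith) (hp.trans_le (hSp _ (min_le_right _ _) b)))
  have hheq : ∀ b, ∀ t ≤ m, h b t = max (B / S t b) √(E / (t + 1 : ℕ)) := fun b t ht => by
    simp only [hh, min_eq_left ht]
  have hanti : ∀ b, ∀ t < m, h b (t + 1) ≤ h b t := by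
    intro b t ht
    rw [hheq b t ht.le, hheq b (t + 1) ht]
    refine max_le_max ?_ (Real.sqrt_le_sqrt ?_)
    · refine div_le_div_of_nonneg_left (by linarith) (hp.trans_le (hSp t ht.le b)) ?_
      rw [hSsucc]
      linarith [(hθ (t + 1) ht).1 b]
    · refine div_le_div_of_nonneg_left hE (by positivity) ?_
      push_cast; linarith
  -- Expert `b` is compared with the single action `φ b`; adding these regrets over `b` yields the
  -- swap regret for `φ`.
  have hreg : ∀ b, ∑ τ ∈ Finset.range (m + 1), v τ (φ b) * θ τ b ≤ θ 0 b + Real.log n / h b m +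
      ∑ t ∈ Finset.range m, ((∑ a, softmax (max (B / S t b) √(E / (t + 1 : ℕ)))
        (fun c => ∑ τ ∈ Finset.range (t + 1), v τ c * θ τ b) a * (v (t + 1) a * θ (t + 1) b)) +
        (√(E / (t + 1 : ℕ)) * θ (t + 1) b + 2 * B * (Real.log (S (t + 1) b) - Real.log (S t b)))) := by
    intro b
    refine (hedge_regret hn (fun t c => v t c * θ t b) (fun t => θ t b) (h b) m (hhpos b) (hanti b)
      (fun t ht c => mul_nonneg (hv t ht c).1 ((hθ t ht).1 b))
      (fun t ht c => mul_le_of_le_one_left ((hθ t ht).1 b) (hv t ht c).2) (φ b)).trans ?_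
    refine add_le_add_right (Finset.sum_le_sum fun t ht => ?_) _
    have ht' := Finset.mem_range.1 ht
    rw [hheq b t ht'.le]
    refine add_le_add_right ?_ _
    have hw0 := (hθ (t + 1) ht').1 b
    have hw1 := hθ1 (t + 1) ht' b
    refine (min_rate_le (hp.trans_le (hSp t ht'.le b)) hw0 hw1 hB (Real.sqrt_nonneg _)).trans ?_
    rw [hSsucc]
    refine add_le_add_left (mul_le_mul_of_nonneg_left ?_ (Real.sqrt_nonneg _)) _
    nlinarith
  have hsum := Finset.sum_le_sum fun b (_ : b ∈ Finset.univ) => hreg b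
  simp only [Finset.sum_add_distrib] at hsum
  have hone : ∑ b, θ 0 b = 1 := (hθ 0 (Nat.zero_le m)).2
  -- The square root part of the final rate suffices, as `n * log n ≤ E`. For `E = 0` that part
  -- vanishes, but then `log n = 0`.
  have hlogterm : ∑ b, Real.log n / h b m ≤ √(E * (m + 1 : ℕ)) := by
    have hn1 : 0 ≤ Real.log n := Real.log_natCast_nonneg n
    rcases hE.eq_or_lt with h0 | hEpos
    · have : Real.log n = 0 := by
        have hnpos : (0 : ℝ) < n := by exact_mod_cast hn
        have h1 : (n : ℝ) * Real.log n ≤ 0 := by linarith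
        nlinarith
      simp [this]
    · have hm0 : (0 : ℝ) < (m + 1 : ℕ) := by positivity
      have hq : 0 < √(E / (m + 1 : ℕ)) := Real.sqrt_pos.2 (by positivity)
      have hb : ∀ b ∈ (Finset.univ : Finset (Fin n)),
          Real.log n / h b m ≤ Real.log n / √(E / (m + 1 : ℕ)) := fun b _ =>
        div_le_div_of_nonneg_left hn1 hq ((le_max_right _ _).trans (hheq b m le_rfl).ge)
      refine (Finset.sum_le_card_nsmul _ _ _ hb).trans ?_
      simp only [Finset.card_univ, Fintype.card_fin, nsmul_eq_mul]
      rw [mul_div_assoc', div_le_iff₀ hq, ← Real.sqrt_mul (by positivity)]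
      have : E * (m + 1 : ℕ) * (E / (m + 1 : ℕ)) = E ^ 2 := by field_simp
      rw [this, Real.sqrt_sq hE]
      exact hnE
  -- The fixed point at work: the experts' payoffs, weighted by `θ (t + 1) b`, add up to the
  -- player's own payoff.
  have hmain : ∑ b, ∑ t ∈ Finset.range m, (∑ a, softmax (max (B / S t b) √(E / (t + 1 : ℕ)))
        (fun c => ∑ τ ∈ Finset.range (t + 1), v τ c * θ τ b) a * (v (t + 1) a * θ (t + 1) b)) =
      ∑ t ∈ Finset.range m, ∑ a, θ (t + 1) a * v (t + 1) a := by
    rw [Finset.sum_comm]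
    refine Finset.sum_congr rfl fun t ht => ?_
    rw [Finset.sum_comm]
    refine Finset.sum_congr rfl fun a _ => ?_
    rw [hfix t (Finset.mem_range.1 ht) a, Finset.sum_mul]
    exact Finset.sum_congr rfl fun b _ => by ring
  have hsqrt : ∑ b, ∑ t ∈ Finset.range m, √(E / (t + 1 : ℕ)) * θ (t + 1) b ≤
      2 * √(E * (m + 1 : ℕ)) := by
    rw [Finset.sum_comm]
    have : ∑ t ∈ Finset.range m, ∑ b, √(E / (t + 1 : ℕ)) * θ (t + 1) b =
        ∑ t ∈ Finset.range m, √(E / (t + 1 : ℕ)) := by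
      refine Finset.sum_congr rfl fun t ht => ?_
      rw [← Finset.mul_sum, (hθ (t + 1) (Finset.mem_range.1 ht)).2, mul_one]
    rw [this]
    refine (sum_sqrt_div_le hE m).trans ?_
    have : √(E * m) ≤ √(E * (m + 1 : ℕ)) := by
      refine Real.sqrt_le_sqrt (mul_le_mul_of_nonneg_left ?_ hE)
      push_cast; linarith
    linarith
  -- The cumulative weight starts at no less than `p` and ends at no more than `m + 1`.
  have htel : ∑ b, ∑ t ∈ Finset.range m, 2 * B * (Real.log (S (t + 1) b) - Real.log (S t b)) ≤
      2 * n * B * Real.log ((m + 1 : ℕ) / p) := by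
    have hb : ∀ b ∈ (Finset.univ : Finset (Fin n)),
        ∑ t ∈ Finset.range m, 2 * B * (Real.log (S (t + 1) b) - Real.log (S t b)) ≤
          2 * B * Real.log ((m + 1 : ℕ) / p) := by
      intro b _
      rw [← Finset.mul_sum, Finset.sum_range_sub (fun t => Real.log (S t b)),
        Real.log_div (by positivity) hp.ne']
      have h1 := Real.log_le_log (hp.trans_le (hSp m le_rfl b)) (hSm b)
      have h2 := Real.log_le_log hp (hSp 0 (Nat.zero_le m) b)
      exact mul_le_mul_of_nonneg_left (by linarith) (by linarith)
    refine (Finset.sum_le_card_nsmul _ _ _ hb).trans (le_of_eq ?_)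
    simp only [Finset.card_univ, Fintype.card_fin, nsmul_eq_mul]
    ring
  have hfirst : 0 ≤ ∑ a, θ 0 a * v 0 a := Finset.sum_nonneg fun a _ =>
    mul_nonneg ((hθ 0 (Nat.zero_le m)).1 a) (hv 0 (Nat.zero_le m) a).1
  have hlhs : ∑ t ∈ Finset.range (m + 1), ∑ b, θ t b * (v t (φ b) - v t b) =
      (∑ b, ∑ τ ∈ Finset.range (m + 1), v τ (φ b) * θ τ b) -
        (∑ t ∈ Finset.range m, ∑ a, θ (t + 1) a * v (t + 1) a + ∑ a, θ 0 a * v 0 a) := by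
    rw [← Finset.sum_range_succ' (fun t => ∑ a, θ t a * v t a) m, Finset.sum_comm (s := Finset.univ),
      ← Finset.sum_sub_distrib]
    refine Finset.sum_congr rfl fun t _ => ?_
    rw [← Finset.sum_sub_distrib]
    exact Finset.sum_congr rfl fun b _ => by ring
  rw [hlhs]
  linarith

end Hedge

/-! ### Parameter estimates: every logarithm is a multiple of `logFactor`. -/

/-- The standing assumptions on the parameters. -/
structure Admissible {N : ℕ} (k : Fin N → ℕ) (ε Δ δ : ℝ) : Prop where
  N_pos : 0 < N
  k_pos : ∀ i, 0 < k i
  ε_pos : 0 < ε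
  ε_le : ε ≤ 1
  Δ_pos : 0 < Δ
  Δ_le : Δ ≤ 1
  δ_pos : 0 < δ
  δ_lt : δ < 1

namespace Admissible

variable {N : ℕ} {k : Fin N → ℕ} {ε Δ δ : ℝ}

theorem one_le_N (h : Admissible k ε Δ δ) : (1 : ℝ) ≤ N := by exact_mod_cast h.N_pos

theorem one_le_A (h : Admissible k ε Δ δ) : (1 : ℝ) ≤ maxActions k := by
  exact_mod_cast (h.k_pos ⟨0, h.N_pos⟩).trans_le (le_maxActions k _)

theorem min_pos (h : Admissible k ε Δ δ) : 0 < min ε Δ := lt_min h.ε_pos h.Δ_pos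

theorem thr_pos (h : Admissible k ε Δ δ) : 0 < thr k ε Δ := by
  have := h.one_le_N; have := h.one_le_A
  exact div_pos h.min_pos (by positivity)

/-- The defining property of the threshold: even if every action of every player carries weight `p`,
the total is an eighth of `min ε Δ`. -/
theorem mass_eq (h : Admissible k ε Δ δ) : N * maxActions k * thr k ε Δ = min ε Δ / 8 := by
  have := h.one_le_N; have := h.one_le_A
  unfold thr
  field_simp

theorem thr_le (h : Admissible k ε Δ δ) : thr k ε Δ ≤ 1 / 8 := by
  have h1 := h.mass_eq
  have h2 : min ε Δ ≤ 1 := (min_le_left _ _).trans h.ε_le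
  have h3 : (1 : ℝ) ≤ N * maxActions k := one_le_mul_of_one_le_of_one_le h.one_le_N h.one_le_A
  nlinarith [h.thr_pos]

theorem card_mul_thr_le (h : Admissible k ε Δ δ) (i : Fin N) : k i * thr k ε Δ ≤ 1 / 8 := by
  have h1 := h.mass_eq
  have h2 : min ε Δ ≤ 1 := (min_le_left _ _).trans h.ε_le
  have h3 : (k i : ℝ) ≤ N * maxActions k := by
    have : (k i : ℝ) ≤ maxActions k := by exact_mod_cast le_maxActions k i
    nlinarith [h.one_le_N, h.one_le_A]
  nlinarith [mul_le_mul_of_nonneg_right h3 h.thr_pos.le]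

theorem one_le_ratio (h : Admissible k ε Δ δ) : 1 ≤ N * maxActions k / (ε * Δ * δ) := by
  have := h.ε_pos; have := h.Δ_pos; have := h.δ_pos
  rw [one_le_div (by positivity)]
  have h3 : (1 : ℝ) ≤ N * maxActions k := one_le_mul_of_one_le_of_one_le h.one_le_N h.one_le_A
  have h1 : ε * Δ ≤ 1 := mul_le_one₀ h.ε_le h.Δ_pos.le h.Δ_le
  have h2 : ε * Δ * δ ≤ 1 := mul_le_one₀ h1 h.δ_pos.le h.δ_lt.le
  linarith

theorem one_le_logFactor (h : Admissible k ε Δ δ) : 1 ≤ logFactor k ε Δ δ := by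
  unfold logFactor
  linarith [Real.log_nonneg h.one_le_ratio]

theorem mul_le_min (h : Admissible k ε Δ δ) : ε * Δ ≤ min ε Δ :=
  le_min (mul_le_of_le_one_right h.ε_pos.le h.Δ_le) (mul_le_of_le_one_left h.Δ_pos.le h.ε_le)

/-- A quantity that is at most `C X ^ m`, where `logFactor = 1 + log X`, has logarithm at most
`log C + m (logFactor - 1)`. -/
theorem log_le (h : Admissible k ε Δ δ) {y C : ℝ} {m : ℕ} (hy : 0 < y) (hC : 0 < C)
    (hle : y ≤ C * (N * maxActions k / (ε * Δ * δ)) ^ m) :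
    Real.log y ≤ Real.log C + m * (logFactor k ε Δ δ - 1) := by
  have hX := h.one_le_ratio
  refine (Real.log_le_log hy hle).trans (le_of_eq ?_)
  rw [Real.log_mul hC.ne' (by positivity), Real.log_pow, logFactor]
  ring

theorem log_inv_thr_le (h : Admissible k ε Δ δ) :
    Real.log (1 / thr k ε Δ) ≤ 3 * logFactor k ε Δ δ := by
  have := h.one_le_N; have := h.one_le_A; have := h.ε_pos; have := h.Δ_pos; have := h.δ_pos
  have h8 : Real.log 8 ≤ 3 := by
    rw [show (8 : ℝ) = 2 ^ 3 by norm_num, Real.log_pow]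
    have := Real.log_two_lt_d9
    push_cast; linarith
  have hle : 1 / thr k ε Δ ≤ 8 * (N * maxActions k / (ε * Δ * δ)) ^ 1 := by
    rw [pow_one, thr, one_div_div, mul_comm (8 : ℝ) (maxActions k : ℝ), mul_assoc,
      mul_div_assoc']
    have hm : ε * Δ * δ ≤ min ε Δ :=
      (mul_le_of_le_one_right (by positivity) h.δ_lt.le).trans h.mul_le_min
    calc _ = 8 * (N * maxActions k) / min ε Δ := by ring
      _ ≤ _ := div_le_div_of_nonneg_left (by positivity) (by positivity) hm
  have := h.log_le (one_div_pos.2 h.thr_pos) (by norm_num) hle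
  have := h.one_le_logFactor
  push_cast at *
  linarith

theorem log_inv_thr_ge (h : Admissible k ε Δ δ) : 1 / 2 ≤ Real.log (1 / thr k ε Δ) := by
  have h1 : (2 : ℝ) ≤ 1 / thr k ε Δ := by
    rw [le_div_iff₀ h.thr_pos]
    linarith [h.thr_le]
  have := Real.log_le_log (by norm_num) h1
  linarith [Real.log_two_gt_d9]

theorem log_A_le (h : Admissible k ε Δ δ) : Real.log (maxActions k) ≤ logFactor k ε Δ δ := by
  have := h.one_le_N; have := h.one_le_A; have := h.ε_pos; have := h.Δ_pos; have := h.δ_pos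
  have hle : (maxActions k : ℝ) ≤ 1 * (N * maxActions k / (ε * Δ * δ)) ^ 1 := by
    rw [pow_one, one_mul, le_div_iff₀ (by positivity)]
    have : ε * Δ * δ ≤ 1 := mul_le_one₀ (mul_le_one₀ h.ε_le h.Δ_pos.le h.Δ_le) h.δ_pos.le h.δ_lt.le
    nlinarith
  have := h.log_le (by linarith) one_pos hle
  simp at this
  linarith

theorem log_N_div_le (h : Admissible k ε Δ δ) :
    Real.log (N * maxActions k / δ) ≤ logFactor k ε Δ δ := by
  have := h.one_le_N; have := h.one_le_A; have := h.ε_pos; have := h.Δ_pos; have := h.δ_pos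
  have hle : N * maxActions k / δ ≤ 1 * (N * maxActions k / (ε * Δ * δ)) ^ 1 := by
    rw [pow_one, one_mul]
    refine div_le_div_of_nonneg_left (by positivity) (by positivity) ?_
    exact mul_le_of_le_one_left h.δ_pos.le (mul_le_one₀ h.ε_le h.Δ_pos.le h.Δ_le)
  have := h.log_le (by positivity) one_pos hle
  simp at this
  linarith

theorem sum_div_sq_le (h : Admissible k ε Δ δ) :
    (maxActions k : ℝ) / ε ^ 2 + maxActions k / Δ ^ 2 ≤ 2 * (maxActions k / min ε Δ ^ 2) := by
  have := h.one_le_A; have := h.min_pos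
  have h1 : (maxActions k : ℝ) / ε ^ 2 ≤ maxActions k / min ε Δ ^ 2 :=
    div_le_div_of_nonneg_left (by positivity) (by positivity)
      (pow_le_pow_left₀ h.min_pos.le (min_le_left _ _) 2)
  have h2 : (maxActions k : ℝ) / Δ ^ 2 ≤ maxActions k / min ε Δ ^ 2 :=
    div_le_div_of_nonneg_left (by positivity) (by positivity)
      (pow_le_pow_left₀ h.min_pos.le (min_le_right _ _) 2)
  linarith

theorem two_le_sum_div_sq (h : Admissible k ε Δ δ) :
    2 ≤ (maxActions k : ℝ) / ε ^ 2 + maxActions k / Δ ^ 2 := by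
  have := h.one_le_A
  have h1 : 1 ≤ (maxActions k : ℝ) / ε ^ 2 := by
    have := h.ε_pos
    rw [one_le_div (by positivity)]
    nlinarith [h.ε_le]
  have h2 : 1 ≤ (maxActions k : ℝ) / Δ ^ 2 := by
    have := h.Δ_pos
    rw [one_le_div (by positivity)]
    nlinarith [h.Δ_le]
  linarith

/-- The number of rounds with the constants used below. -/
theorem rounds_ge (_ : Admissible k ε Δ δ) :
    4096 * ((maxActions k : ℝ) / ε ^ 2 + maxActions k / Δ ^ 2) * logFactor k ε Δ δ ^ 2 ≤
      ceRounds 4096 2 k ε Δ δ := Nat.le_ceil _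

theorem rounds_le (h : Admissible k ε Δ δ) :
    (ceRounds 4096 2 k ε Δ δ : ℝ) ≤
      16384 * (maxActions k / min ε Δ ^ 2) * logFactor k ε Δ δ ^ 2 := by
  have h1 := h.sum_div_sq_le
  have h2 := h.two_le_sum_div_sq
  have hL : 1 ≤ logFactor k ε Δ δ ^ 2 := one_le_pow₀ h.one_le_logFactor
  have h3 : 1 ≤ 4096 * ((maxActions k : ℝ) / ε ^ 2 + maxActions k / Δ ^ 2) *
      logFactor k ε Δ δ ^ 2 := by nlinarith
  have h4 := Nat.ceil_lt_add_one (zero_le_one.trans h3)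
  have h5 : (ceRounds 4096 2 k ε Δ δ : ℝ) ≤
      8192 * ((maxActions k : ℝ) / ε ^ 2 + maxActions k / Δ ^ 2) * logFactor k ε Δ δ ^ 2 := by
    unfold ceRounds
    linarith
  nlinarith

/-- The number of rounds contains `logFactor ^ 2` itself; its logarithm is absorbed through `log Λ ≤
Λ - 1`. -/
theorem log_rounds_le (h : Admissible k ε Δ δ) :
    Real.log (ceRounds 4096 2 k ε Δ δ) ≤ 10 * logFactor k ε Δ δ := by
  have := h.one_le_N; have := h.one_le_A; have := h.ε_pos; have := h.Δ_pos; have := h.δ_pos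
  have hL := h.one_le_logFactor
  have hTpos : (0 : ℝ) < ceRounds 4096 2 k ε Δ δ :=
    lt_of_lt_of_le (by have := h.two_le_sum_div_sq; positivity) h.rounds_ge
  have hm := h.min_pos
  have hle : (ceRounds 4096 2 k ε Δ δ : ℝ) ≤
      (16384 * logFactor k ε Δ δ ^ 2) * (N * maxActions k / (ε * Δ * δ)) ^ 2 := by
    refine h.rounds_le.trans ?_
    have h1 : (maxActions k : ℝ) / min ε Δ ^ 2 ≤ (N * maxActions k / (ε * Δ * δ)) ^ 2 := by
      rw [div_pow]
      refine div_le_div₀ (by positivity) ?_ (by positivity) ?_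
      · have : (maxActions k : ℝ) ≤ N * maxActions k := by nlinarith
        nlinarith
      · refine pow_le_pow_left₀ (by positivity) ?_ 2
        exact (mul_le_of_le_one_right (by positivity) h.δ_lt.le).trans h.mul_le_min
    nlinarith [mul_le_mul_of_nonneg_left h1 (sq_nonneg (logFactor k ε Δ δ))]
  have h2 := h.log_le hTpos (by positivity) hle
  have hLpos : 0 < logFactor k ε Δ δ := by linarith
  rw [Real.log_mul (by norm_num) (by positivity), Real.log_pow,
    show (16384 : ℝ) = 2 ^ 14 by norm_num, Real.log_pow] at h2
  have h3 := Real.log_two_lt_d9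
  have h4 := Real.log_le_sub_one_of_pos hLpos
  push_cast at h2
  linarith

theorem rounds_pos (h : Admissible k ε Δ δ) : 0 < ceRounds 4096 2 k ε Δ δ := by
  have := h.one_le_logFactor
  have : (0 : ℝ) < ceRounds 4096 2 k ε Δ δ :=
    lt_of_lt_of_le (by have := h.two_le_sum_div_sq; positivity) h.rounds_ge
  exact_mod_cast this

theorem log_rounds_div_thr_le (h : Admissible k ε Δ δ) :
    Real.log (ceRounds 4096 2 k ε Δ δ / thr k ε Δ) ≤ 13 * logFactor k ε Δ δ := by
  have hT : (0 : ℝ) < ceRounds 4096 2 k ε Δ δ := by exact_mod_cast h.rounds_pos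
  rw [div_eq_mul_one_div, Real.log_mul hT.ne' (one_div_pos.2 h.thr_pos).ne']
  linarith [h.log_rounds_le, h.log_inv_thr_le]

theorem one_lt_batch_arg (h : Admissible k ε Δ δ) {T : ℕ} (hT : 0 < T) :
    1 < maxActions k * N * T / δ := by
  rw [one_lt_div h.δ_pos]
  have h1 : (1 : ℝ) ≤ maxActions k * N := one_le_mul_of_one_le_of_one_le h.one_le_A h.one_le_N
  have h2 : (1 : ℝ) ≤ maxActions k * N * T :=
    one_le_mul_of_one_le_of_one_le h1 (by exact_mod_cast hT)
  linarith [h.δ_lt]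

theorem log_batch_le (h : Admissible k ε Δ δ) :
    Real.log (maxActions k * N * ceRounds 4096 2 k ε Δ δ / δ) ≤ 11 * logFactor k ε Δ δ := by
  have := h.one_le_N; have := h.one_le_A; have := h.δ_pos
  have hT : (0 : ℝ) < ceRounds 4096 2 k ε Δ δ := by exact_mod_cast h.rounds_pos
  have e : (maxActions k : ℝ) * N * ceRounds 4096 2 k ε Δ δ / δ =
      (N * maxActions k / δ) * ceRounds 4096 2 k ε Δ δ := by ring
  rw [e, Real.log_mul (by positivity) hT.ne']
  linarith [h.log_rounds_le, h.log_N_div_le]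

end Admissible

/-! ### Sizes of the adaptive minibatches. -/

section Batches

variable {N : ℕ} {k : Fin N → ℕ} {ε Δ δ : ℝ} {T : ℕ}

theorem cumWeight_pos {θ : ℕ → Weights k} {t : ℕ} {i : Fin N} {a : Fin (k i)}
    (hpos : ∀ τ ≤ t, 0 < θ τ i a) : 0 < cumWeight θ t i a :=
  Finset.sum_pos (fun τ hτ => hpos τ (Nat.lt_succ_iff.1 (Finset.mem_range.1 hτ)))
    ⟨0, Finset.mem_range.2 (Nat.succ_pos t)⟩

theorem le_cumWeight {θ : ℕ → Weights k} {t : ℕ} {i : Fin N} {a : Fin (k i)}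
    (hpos : ∀ τ ≤ t, 0 < θ τ i a) {τ : ℕ} (hτ : τ ≤ t) : θ τ i a ≤ cumWeight θ t i a :=
  Finset.single_le_sum (f := fun τ => θ τ i a)
    (fun τ hτ => (hpos τ (Nat.lt_succ_iff.1 (Finset.mem_range.1 hτ))).le)
    (Finset.mem_range.2 (Nat.lt_succ_iff.2 hτ))

theorem le_ceBatch (θ : ℕ → Weights k) (t : ℕ) (i : Fin N) (a : Fin (k i)) :
    64 * Real.log (maxActions k * N * T / δ) * θ t i a / (Δ ^ 2 * cumWeight θ t i a) ≤
      ceBatch Δ δ T θ t i :=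
  (le_ciSup (f := fun a => 64 * Real.log (maxActions k * N * T / δ) * θ t i a /
    (Δ ^ 2 * cumWeight θ t i a)) (Set.finite_range _).bddAbove a).trans (Nat.le_ceil _)

theorem ceBatch_pos (h : Admissible k ε Δ δ) (hT : 0 < T) {θ : ℕ → Weights k} {t : ℕ} {i : Fin N}
    (hpos : ∀ τ ≤ t, ∀ a, 0 < θ τ i a) : 0 < ceBatch Δ δ T θ t i := by
  have hl := Real.log_pos (h.one_lt_batch_arg hT)
  let a : Fin (k i) := ⟨0, h.k_pos i⟩
  have h1 : 0 < 64 * Real.log (maxActions k * N * T / δ) * θ t i a /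
      (Δ ^ 2 * cumWeight θ t i a) := by
    have := cumWeight_pos (fun τ hτ => hpos τ hτ a)
    have := hpos t le_rfl a
    have := h.Δ_pos
    positivity
  exact_mod_cast h1.trans_le (le_ceBatch θ t i a)

/-- The maximum over actions is replaced by the sum, because only the sum over rounds for a fixed
action telescopes. This costs a factor `A` in the total. -/
theorem ceBatch_le (h : Admissible k ε Δ δ) (hT : 0 < T) {θ : ℕ → Weights k} {t : ℕ} {i : Fin N}
    (hpos : ∀ τ ≤ t, ∀ a, 0 < θ τ i a) :
    (ceBatch Δ δ T θ t i : ℝ) ≤ 1 + 64 * Real.log (maxActions k * N * T / δ) / Δ ^ 2 *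
      ∑ a, θ t i a / cumWeight θ t i a := by
  have hl := Real.log_pos (h.one_lt_batch_arg hT)
  have hΔ := h.Δ_pos
  have hS : ∀ a, 0 < cumWeight θ t i a := fun a => cumWeight_pos fun τ hτ => hpos τ hτ a
  have : Nonempty (Fin (k i)) := ⟨⟨0, h.k_pos i⟩⟩
  have hsup : (⨆ a : Fin (k i), 64 * Real.log (maxActions k * N * T / δ) * θ t i a /
      (Δ ^ 2 * cumWeight θ t i a)) ≤ 64 * Real.log (maxActions k * N * T / δ) / Δ ^ 2 *
      ∑ a, θ t i a / cumWeight θ t i a := by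
    refine ciSup_le fun a => ?_
    rw [mul_div_mul_comm]
    refine mul_le_mul_of_nonneg_left ?_ (by positivity)
    exact Finset.single_le_sum (f := fun a => θ t i a / cumWeight θ t i a)
      (fun a _ => div_nonneg (hpos t le_rfl a).le (hS a).le) (Finset.mem_univ a)
  have hnn : 0 ≤ ⨆ a : Fin (k i), 64 * Real.log (maxActions k * N * T / δ) * θ t i a /
      (Δ ^ 2 * cumWeight θ t i a) := Real.iSup_nonneg fun a => by
    have := hS a
    have := hpos t le_rfl a
    positivity
  have := Nat.ceil_lt_add_one hnn
  unfold ceBatch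
  linarith

/-- The first quotient is 1; each later one is at most an increment of the logarithm of the
cumulative weight, which starts at no less than `p`. -/
theorem sum_div_cumWeight_le {θ : ℕ → Weights k} {i : Fin N} {a : Fin (k i)} {p : ℝ} (hp : 0 < p)
    (h0 : p ≤ θ 0 i a) (m : ℕ) (hpos : ∀ τ ≤ m, 0 < θ τ i a) :
    ∑ t ∈ Finset.range (m + 1), θ t i a / cumWeight θ t i a ≤
      1 + Real.log (cumWeight θ m i a / p) := by
  induction m with
  | zero =>
    have h1 : cumWeight θ 0 i a = θ 0 i a := by simp [cumWeight]
    simp only [zero_add, Finset.sum_range_one, h1]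
    rw [div_self (hpos 0 le_rfl).ne']
    have := Real.log_nonneg ((one_le_div hp).2 h0)
    linarith
  | succ m ih =>
    have hS : 0 < cumWeight θ m i a := cumWeight_pos fun τ hτ => hpos τ (by omega)
    have hsucc : cumWeight θ (m + 1) i a = cumWeight θ m i a + θ (m + 1) i a :=
      Finset.sum_range_succ _ _
    have hw := hpos (m + 1) le_rfl
    rw [Finset.sum_range_succ, hsucc]
    have h1 := div_add_le_log_sub_log hS hw.le
    have h2 := ih fun τ hτ => hpos τ (by omega)
    rw [Real.log_div hS.ne' hp.ne'] at h2
    rw [Real.log_div (by positivity) hp.ne']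
    linarith

/-- The total number of repetitions of adaptive Hedge, per player and action. -/
theorem sum_ceBatch_le (h : Admissible k ε Δ δ) (hT : 0 < T) {θ : ℕ → Weights k} {i : Fin N}
    {p : ℝ} (hp : 0 < p) (h0 : ∀ a, p ≤ θ 0 i a) (hpos : ∀ τ < T, ∀ a, 0 < θ τ i a)
    (hle : ∀ τ < T, ∀ a, θ τ i a ≤ 1) :
    ∑ t ∈ Finset.range T, (ceBatch Δ δ T θ t i : ℝ) ≤ T +
      64 * Real.log (maxActions k * N * T / δ) / Δ ^ 2 *
        (maxActions k * (1 + Real.log (T / p))) := by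
  have hl := Real.log_pos (h.one_lt_batch_arg hT)
  have hΔ := h.Δ_pos
  have hT' : (0 : ℝ) < T := by exact_mod_cast hT
  refine (Finset.sum_le_sum fun t ht => ceBatch_le h hT fun τ hτ =>
    hpos τ (by have := Finset.mem_range.1 ht; omega)).trans ?_
  rw [Finset.sum_add_distrib, ← Finset.mul_sum, Finset.sum_comm]
  simp only [Finset.sum_const, Finset.card_range, nsmul_eq_mul, mul_one]
  refine add_le_add_right (mul_le_mul_of_nonneg_left ?_ (by positivity)) _
  obtain ⟨m, rfl⟩ : ∃ m, T = m + 1 := ⟨T - 1, by omega⟩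
  have hp1 : p ≤ 1 := (h0 ⟨0, h.k_pos i⟩).trans (hle 0 hT _)
  have ha : ∀ a ∈ (Finset.univ : Finset (Fin (k i))),
      ∑ t ∈ Finset.range (m + 1), θ t i a / cumWeight θ t i a ≤
        1 + Real.log ((m + 1 : ℕ) / p) := by
    intro a _
    refine (sum_div_cumWeight_le hp (h0 a) m fun τ hτ => hpos τ (by omega) a).trans ?_
    have hS : 0 < cumWeight θ m i a := cumWeight_pos fun τ hτ => hpos τ (by omega) a
    have hS1 : cumWeight θ m i a ≤ (m + 1 : ℕ) := by
      have : ∀ τ ∈ Finset.range (m + 1), θ τ i a ≤ 1 := fun τ hτ => hle τ (Finset.mem_range.1 hτ) a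
      simpa [cumWeight] using Finset.sum_le_card_nsmul _ _ _ this
    have := Real.log_le_log (by positivity) (div_le_div_of_nonneg_right hS1 hp.le)
    linarith
  refine (Finset.sum_le_card_nsmul _ _ _ ha).trans ?_
  simp only [Finset.card_univ, Fintype.card_fin, nsmul_eq_mul]
  refine mul_le_mul_of_nonneg_right (by exact_mod_cast le_maxActions k i) ?_
  have : 0 ≤ Real.log ((m + 1 : ℕ) / p) := Real.log_nonneg (by
    rw [one_le_div hp]
    push_cast
    have : (0 : ℝ) ≤ m := by positivity
    linarith)
  linarith

end Batches

/-! ### Invariants of a run and its number of samples. -/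

namespace IsAdaptiveHedgeRun

variable {N : ℕ} {k : Fin N → ℕ} {Ω : Type*} [MeasurableSpace Ω] {u : Fin N → Profile k → ℝ}
  {ε Δ δ : ℝ} {T : ℕ} {I : Interaction k Ω} {br : ℕ → Ω → Profile k}

theorem thr_le_init (hrun : IsAdaptiveHedgeRun u ε Δ δ T I br) (h : Admissible k ε Δ δ)
    (ω : Ω) (i : Fin N) (a : Fin (k i)) : thr k ε Δ ≤ I.strat (elimLength u Δ) ω i a := by
  rw [hrun.init]
  have := h.card_mul_thr_le i
  split_ifs <;> linarith

theorem ce_strat_mem (hrun : IsAdaptiveHedgeRun u ε Δ δ T I br) (h : Admissible k ε Δ δ)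
    {t : ℕ} (ht : t < T) (ω : Ω) (i : Fin N) :
    I.strat (elimLength u Δ + t) ω i ∈ stdSimplex ℝ (Fin (k i)) := by
  cases t with
  | zero =>
    refine ⟨fun a => h.thr_pos.le.trans (hrun.thr_le_init h ω i a), ?_⟩
    simp only [add_zero, hrun.init, Finset.sum_add_distrib, ← Finset.mul_sum]
    simp
  | succ t => exact hrun.ce_simplex t ht ω i

theorem strat_mem (hrun : IsAdaptiveHedgeRun u ε Δ δ T I br) (h : Admissible k ε Δ δ)
    {r : ℕ} (hr : r < elimLength u Δ + T) (ω : Ω) (i : Fin N) :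
    I.strat r ω i ∈ stdSimplex ℝ (Fin (k i)) := by
  rcases lt_or_ge r (elimLength u Δ) with hlt | hge
  · rw [hrun.ibr_strat r hlt]
    exact single_mem_stdSimplex ℝ _
  · obtain ⟨t, rfl⟩ := Nat.exists_eq_add_of_le hge
    exact hrun.ce_strat_mem h (by omega) ω i

/-- A softmax is strictly positive, hence so is any mixture of them. This keeps cumulative weights
and batch sizes away from 0. -/
theorem ce_strat_pos (hrun : IsAdaptiveHedgeRun u ε Δ δ T I br) (h : Admissible k ε Δ δ)
    {t : ℕ} (ht : t < T) (ω : Ω) (i : Fin N) (a : Fin (k i)) :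
    0 < I.strat (elimLength u Δ + t) ω i a := by
  cases t with
  | zero => exact h.thr_pos.trans_le (hrun.thr_le_init h ω i a)
  | succ t =>
    have hs := hrun.ce_simplex t ht ω i
    have hne : ∃ b ∈ Finset.univ, 0 < I.strat (elimLength u Δ + (t + 1)) ω i b := by
      refine Finset.exists_lt_of_sum_lt (f := fun _ => (0 : ℝ)) ?_
      rw [hs.2]; simp
    obtain ⟨b, -, hb⟩ := hne
    rw [hrun.ce_fixed t ht ω i a]
    exact Finset.sum_pos' (fun b _ => mul_nonneg (softmax_pos (h.k_pos i) _ _ a).le (hs.1 b))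
      ⟨b, Finset.mem_univ b, mul_pos (softmax_pos (h.k_pos i) _ _ a) hb⟩

theorem ce_strat_le_one (hrun : IsAdaptiveHedgeRun u ε Δ δ T I br) (h : Admissible k ε Δ δ)
    {t : ℕ} (ht : t < T) (ω : Ω) (i : Fin N) (a : Fin (k i)) :
    I.strat (elimLength u Δ + t) ω i a ≤ 1 := by
  have hs := hrun.ce_strat_mem h ht ω i
  rw [← hs.2]
  exact Finset.single_le_sum (fun c _ => hs.1 c) (Finset.mem_univ a)

theorem ce_batch_pos (hrun : IsAdaptiveHedgeRun u ε Δ δ T I br) (h : Admissible k ε Δ δ)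
    {t : ℕ} (ht : t < T) (ω : Ω) (i : Fin N) : 0 < I.batch (elimLength u Δ + t) ω i := by
  rw [hrun.ce_batch t ht]
  exact ceBatch_pos h (by omega) fun τ hτ a => hrun.ce_strat_pos h (by omega) ω i a

/-- For `L = 0` the argument would be 0 and the batch 0, but then the best response phase has no
rounds. -/
theorem one_lt_ibr_arg (h : Admissible k ε Δ δ) (hL : 0 < elimLength u Δ) :
    1 < elimLength u Δ * N * maxActions k / δ := by
  rw [one_lt_div h.δ_pos]
  have h1 : (1 : ℝ) ≤ elimLength u Δ * N :=
    one_le_mul_of_one_le_of_one_le (by exact_mod_cast hL) h.one_le_N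
  have h2 : (1 : ℝ) ≤ elimLength u Δ * N * maxActions k :=
    one_le_mul_of_one_le_of_one_le h1 h.one_le_A
  linarith [h.δ_lt]

theorem ibrBatch_pos (h : Admissible k ε Δ δ) (hL : 0 < elimLength u Δ) :
    0 < ibrBatch u Δ δ := by
  have := Real.log_pos (one_lt_ibr_arg (u := u) h hL)
  have := h.Δ_pos
  exact Nat.ceil_pos.2 (by positivity)

theorem ibrBatch_le (h : Admissible k ε Δ δ) (hL : 0 < elimLength u Δ) :
    (ibrBatch u Δ δ : ℝ) ≤ 129 * logFactor k ε Δ δ / Δ ^ 2 := by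
  have hΔ := h.Δ_pos; have := h.one_le_N; have := h.one_le_A; have := h.ε_pos; have := h.δ_pos
  have hlog := Real.log_pos (one_lt_ibr_arg (u := u) h hL)
  have hL' : (0 : ℝ) < elimLength u Δ := by exact_mod_cast hL
  have hle : (elimLength u Δ : ℝ) * N * maxActions k / δ ≤
      1 * (N * maxActions k / (ε * Δ * δ)) ^ 2 := by
    have h1 : (elimLength u Δ : ℝ) ≤ N * maxActions k := by exact_mod_cast elimLength_le
    have h2 : (elimLength u Δ : ℝ) * N * maxActions k ≤ (N * maxActions k) ^ 2 := by
      rw [sq, mul_assoc]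
      exact mul_le_mul_of_nonneg_right h1 (by positivity)
    rw [one_mul, div_pow]
    refine div_le_div₀ (by positivity) h2 (by positivity) ?_
    have h3 : ε * Δ ≤ 1 := mul_le_one₀ h.ε_le h.Δ_pos.le h.Δ_le
    have h4 : ε * Δ * δ ≤ δ := mul_le_of_le_one_left h.δ_pos.le h3
    have h5 : δ ^ 2 ≤ δ := by nlinarith [h.δ_lt]
    exact (pow_le_pow_left₀ (by positivity) h4 2).trans h5
  have h1 := h.log_le (by positivity) one_pos hle
  rw [Real.log_one] at h1
  push_cast at h1
  have h2 := Nat.ceil_lt_add_one (R := ℝ)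
    (a := 64 * Real.log (elimLength u Δ * N * maxActions k / δ) / Δ ^ 2) (by positivity)
  have hsq : Δ ^ 2 ≤ 1 := pow_le_one₀ hΔ.le h.Δ_le
  have hΛ := h.one_le_logFactor
  unfold ibrBatch
  refine h2.le.trans ?_
  rw [← sub_nonneg]
  have e : 129 * logFactor k ε Δ δ / Δ ^ 2 -
      (64 * Real.log (elimLength u Δ * N * maxActions k / δ) / Δ ^ 2 + 1) =
      (129 * logFactor k ε Δ δ - 64 * Real.log (elimLength u Δ * N * maxActions k / δ) - Δ ^ 2) /
        Δ ^ 2 := by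
    field_simp
    ring
  rw [e]
  exact div_nonneg (by linarith) (by positivity)

/-- The bound on the number of samples. -/
theorem samples_le (h : Admissible k ε Δ δ)
    (hrun : IsAdaptiveHedgeRun u ε Δ δ (ceRounds 4096 2 k ε Δ δ) I br) (ω : Ω) :
    (I.samples (elimLength u Δ + ceRounds 4096 2 k ε Δ δ) ω : ℝ) ≤
      30000 * (elimLength u Δ * N * maxActions k / Δ ^ 2 +
        N * maxActions k ^ 2 / min (ε ^ 2) (Δ ^ 2)) * logFactor k ε Δ δ ^ 2 := by
  set T := ceRounds 4096 2 k ε Δ δ with hTdef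
  set L := elimLength u Δ with hLdef
  set Λ := logFactor k ε Δ δ with hΛdef
  set A : ℝ := (maxActions k : ℝ) with hA
  have hΛ : 1 ≤ Λ := h.one_le_logFactor
  have hA1 : 1 ≤ A := h.one_le_A
  have hΔ := h.Δ_pos
  have hm := h.min_pos
  have hmin : min (ε ^ 2) (Δ ^ 2) = min ε Δ ^ 2 := by
    rcases le_total ε Δ with hc | hc
    · rw [min_eq_left hc, min_eq_left (pow_le_pow_left₀ h.ε_pos.le hc 2)]
    · rw [min_eq_right hc, min_eq_right (pow_le_pow_left₀ h.Δ_pos.le hc 2)]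
  have hkA : ∀ i, (k i : ℝ) ≤ A := fun i => by rw [hA]; exact_mod_cast le_maxActions k i
  have hN1 := h.one_le_N
  have hphase1 : ∑ r ∈ Finset.range L, ∑ i, (k i : ℝ) * I.batch r ω i ≤
      129 * (L * N * A / Δ ^ 2) * Λ := by
    have : ∀ r ∈ Finset.range L, ∑ i, (k i : ℝ) * I.batch r ω i ≤
        N * (A * (129 * Λ / Δ ^ 2)) := by
      intro r hr
      have hr' := Finset.mem_range.1 hr
      have hi : ∀ i ∈ (Finset.univ : Finset (Fin N)), (k i : ℝ) * I.batch r ω i ≤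
          A * (129 * Λ / Δ ^ 2) := by
        intro i _
        rw [hrun.ibr_batch r hr']
        exact mul_le_mul (hkA i) (ibrBatch_le h (by omega)) (by positivity) (by positivity)
      simpa using Finset.sum_le_card_nsmul _ _ _ hi
    refine (Finset.sum_le_card_nsmul _ _ _ this).trans (le_of_eq ?_)
    simp only [Finset.card_range, nsmul_eq_mul]
    ring
  have hphase2 : ∑ t ∈ Finset.range T, ∑ i, (k i : ℝ) * I.batch (L + t) ω i ≤
      26240 * (N * A ^ 2 / min ε Δ ^ 2) * Λ ^ 2 := by
    rw [Finset.sum_comm]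
    have hi : ∀ i ∈ (Finset.univ : Finset (Fin N)),
        ∑ t ∈ Finset.range T, (k i : ℝ) * I.batch (L + t) ω i ≤
          A * (26240 * (A / min ε Δ ^ 2) * Λ ^ 2) := by
      intro i _
      rw [← Finset.mul_sum]
      have hT0 : 0 < T := h.rounds_pos
      have hb : ∑ t ∈ Finset.range T, (I.batch (L + t) ω i : ℝ) ≤
          T + 64 * Real.log (maxActions k * N * T / δ) / Δ ^ 2 *
            (maxActions k * (1 + Real.log (T / thr k ε Δ))) := by
        refine le_trans (le_of_eq ?_) (sum_ceBatch_le h hT0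
          (θ := fun τ => I.strat (L + τ) ω) (i := i) h.thr_pos
          (fun a => hrun.thr_le_init h ω i a) (fun τ hτ a => hrun.ce_strat_pos h hτ ω i a)
          (fun τ hτ a => hrun.ce_strat_le_one h hτ ω i a))
        exact Finset.sum_congr rfl fun t ht => by rw [hrun.ce_batch t (Finset.mem_range.1 ht)]
      have hlog0 := Real.log_pos (h.one_lt_batch_arg hT0)
      -- Here 64 · 11 · 14 = 9856; together with at most 16384 from `rounds_le` this makes 26240.
      have h1 : 64 * Real.log (maxActions k * N * T / δ) / Δ ^ 2 *
          (maxActions k * (1 + Real.log (T / thr k ε Δ))) ≤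
          64 * (11 * Λ) / min ε Δ ^ 2 * (A * (14 * Λ)) := by
        refine mul_le_mul ?_ ?_ ?_ (by positivity)
        · refine div_le_div₀ (by positivity) ?_ (by positivity)
            (pow_le_pow_left₀ hm.le (min_le_right _ _) 2)
          linarith [h.log_batch_le]
        · refine mul_le_mul_of_nonneg_left ?_ (by positivity)
          linarith [h.log_rounds_div_thr_le]
        · have : 0 ≤ Real.log (T / thr k ε Δ) := Real.log_nonneg (by
            rw [one_le_div h.thr_pos]
            have : (1 : ℝ) ≤ T := by exact_mod_cast hT0
            linarith [h.thr_le])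
          positivity
      have h2 := h.rounds_le
      have h3 : 64 * (11 * Λ) / min ε Δ ^ 2 * (A * (14 * Λ)) =
          9856 * (A / min ε Δ ^ 2) * Λ ^ 2 := by ring
      refine mul_le_mul (hkA i) ?_ (Finset.sum_nonneg fun _ _ => by positivity) (by positivity)
      refine hb.trans ?_
      rw [h3] at h1
      linarith
    refine (Finset.sum_le_card_nsmul _ _ _ hi).trans (le_of_eq ?_)
    simp only [Finset.card_univ, Fintype.card_fin, nsmul_eq_mul]
    ring
  have hsplit : (I.samples (L + T) ω : ℝ) = ∑ r ∈ Finset.range L, ∑ i, (k i : ℝ) * I.batch r ω i +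
      ∑ t ∈ Finset.range T, ∑ i, (k i : ℝ) * I.batch (L + t) ω i := by
    unfold Interaction.samples
    rw [Finset.sum_range_add]
    push_cast
    rfl
  rw [hsplit, hmin]
  have hx : 0 ≤ L * N * A / Δ ^ 2 := by positivity
  have hy : 0 ≤ N * A ^ 2 / min ε Δ ^ 2 := by positivity
  have hΛ2 : Λ ≤ Λ ^ 2 := by nlinarith
  have hx' : 129 * (L * N * A / Δ ^ 2) * Λ ≤ 30000 * (L * N * A / Δ ^ 2) * Λ ^ 2 := by
    have := mul_le_mul_of_nonneg_left hΛ2 hx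
    nlinarith [mul_nonneg hx (sq_nonneg Λ)]
  have hy' : 0 ≤ N * A ^ 2 / min ε Δ ^ 2 * Λ ^ 2 := by positivity
  nlinarith

end IsAdaptiveHedgeRun

/-! ### Differences of distributions, and normalization by a random weight. -/

section Simplex

variable {n : ℕ}

theorem le_one_of_mem_stdSimplex {x : Fin n → ℝ} (hx : x ∈ stdSimplex ℝ (Fin n)) (a : Fin n) :
    x a ≤ 1 := by
  rw [← hx.2]
  exact Finset.single_le_sum (fun c _ => hx.1 c) (Finset.mem_univ a)

/-- The bound does not depend on `n`, which keeps the variance of every comparison free of the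
number of actions. -/
theorem sum_sq_sub_le_two {x y : Fin n → ℝ} (hx : x ∈ stdSimplex ℝ (Fin n))
    (hy : y ∈ stdSimplex ℝ (Fin n)) : ∑ c, (x c - y c) ^ 2 ≤ 2 := by
  calc ∑ c, (x c - y c) ^ 2 ≤ ∑ c, (x c + y c) := Finset.sum_le_sum fun c _ => by
        have := hx.1 c; have := hy.1 c
        have := le_one_of_mem_stdSimplex hx c; have := le_one_of_mem_stdSimplex hy c
        nlinarith [mul_nonneg (hx.1 c) (hy.1 c)]
    _ = 2 := by rw [Finset.sum_add_distrib, hx.2, hy.2]; norm_num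

theorem abs_sub_le_one {x y : Fin n → ℝ} (hx : x ∈ stdSimplex ℝ (Fin n))
    (hy : y ∈ stdSimplex ℝ (Fin n)) (c : Fin n) : |x c - y c| ≤ 1 := by
  have := hx.1 c; have := hy.1 c
  have := le_one_of_mem_stdSimplex hx c; have := le_one_of_mem_stdSimplex hy c
  rw [abs_le]; constructor <;> linarith

/-- The image of a distribution under a map. -/
def pushforward (φ : Fin n → Fin n) (x : Fin n → ℝ) (c : Fin n) : ℝ :=
  ∑ b, if φ b = c then x b else 0

theorem sum_pushforward_mul (φ : Fin n → Fin n) (x g : Fin n → ℝ) :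
    ∑ c, pushforward φ x c * g c = ∑ b, x b * g (φ b) := by
  simp only [pushforward, Finset.sum_mul, ite_mul, zero_mul]
  rw [Finset.sum_comm]
  simp

theorem pushforward_mem_stdSimplex (φ : Fin n → Fin n) {x : Fin n → ℝ}
    (hx : x ∈ stdSimplex ℝ (Fin n)) : pushforward φ x ∈ stdSimplex ℝ (Fin n) := by
  refine ⟨fun c => Finset.sum_nonneg fun b _ => ?_, ?_⟩
  · split_ifs
    exacts [hx.1 b, le_rfl]
  · have := sum_pushforward_mul φ x (fun _ => 1)
    simpa [hx.2] using this

end Simplex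

/-- From exponential bounds on a geometric grid of slopes to a bound relative to `S`. -/
theorem le_of_grid_bound {Z Q S Δ l p : ℝ} {T n : ℕ} (hΔ : 0 < Δ) (hl : 0 < l) (hp : 0 < p)
    (hS : p ≤ S) (hST : S ≤ T) (hn : (T : ℝ) / p < 4 ^ (n - 1))
    (hQ : Q ≤ S ^ 2 * Δ ^ 2 / (256 * l))
    (hgrid : ∀ j < n, 12 * l * 4 ^ j / (Δ * T) * Z - (12 * l * 4 ^ j / (Δ * T)) ^ 2 * Q < 2 * l) :
    Z ≤ Δ / 4 * S := by
  have hS0 : 0 < S := hp.trans_le hS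
  have hT0 : (0 : ℝ) < T := hS0.trans_le hST
  -- The power of 4 next above `T / S` selects a slope within a factor 4 of `12 * l / (Δ * S)`; `y`
  -- is that factor.
  obtain ⟨m, hm1, hm2⟩ := exists_nat_pow_near ((one_le_div hS0).2 hST) (by norm_num : (1 : ℝ) < 4)
  have hmn : m + 1 < n := by
    have h1 : (4 : ℝ) ^ m < 4 ^ (n - 1) :=
      (hm1.trans (div_le_div_of_nonneg_left hT0.le hp hS)).trans_lt hn
    have := (pow_lt_pow_iff_right₀ (by norm_num : (1 : ℝ) < 4)).1 h1
    omega
  set y : ℝ := 4 ^ (m + 1) * S / T with hy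
  have hy1 : 1 ≤ y := by
    rw [hy, le_div_iff₀ hT0, one_mul]
    exact ((div_lt_iff₀ hS0).1 hm2).le
  have hy4 : y ≤ 4 := by
    rw [hy, div_le_iff₀ hT0, pow_succ]
    have := (le_div_iff₀ hS0).1 hm1
    linarith
  have hg := hgrid (m + 1) hmn
  have hlam : 12 * l * 4 ^ (m + 1) / (Δ * T) = 12 * l * y / (Δ * S) := by
    rw [hy]; field_simp
  rw [hlam] at hg
  have hQ' : (12 * l * y / (Δ * S)) ^ 2 * Q ≤ 9 / 16 * l * y ^ 2 := by
    refine (mul_le_mul_of_nonneg_left hQ (sq_nonneg _)).trans (le_of_eq ?_)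
    field_simp
    norm_num
  by_contra! hcon
  have h1 : 3 * l * y < 12 * l * y / (Δ * S) * Z := by
    rw [div_mul_eq_mul_div, lt_div_iff₀ (by positivity)]
    have : 0 < 12 * l * y := by positivity
    nlinarith
  -- This fails throughout `[1, 4]`: `3 y - 2 - 9 y² / 16` is concave and positive at both ends,
  -- with values 7/16 and 1.
  have h2 : 3 * l * y < 2 * l + 9 / 16 * l * y ^ 2 := by linarith
  have h3 : 3 * y < 2 + 9 / 16 * y ^ 2 := by
    by_contra! h
    nlinarith [mul_le_mul_of_nonneg_left h hl.le]
  nlinarith [mul_nonneg (sub_nonneg.2 hy1) (sub_nonneg.2 hy4)]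

/-! ### Tail bounds for the comparisons made by the algorithm. -/

section Concentration

variable {N : ℕ} {k : Fin N → ℕ} {Ω : Type*} [mΩ : MeasurableSpace Ω] {u : Fin N → Profile k → ℝ}
  {ε Δ δ : ℝ} {T : ℕ} {I : Interaction k Ω} {br : ℕ → Ω → Profile k} {μ : Measure Ω}

/-- The deviation of player `i`'s average payoff from its conditional expectation. -/
noncomputable def noise (I : Interaction k Ω) (u : Fin N → Profile k → ℝ) (r : ℕ) (ω : Ω)
    (i : Fin N) (c : Fin (k i)) : ℝ :=
  I.avg r ω i c - oppExp (u i) (I.strat r ω) i c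

/-- With slope `2 * Δ * M` the exponent is at least `2 Δ² M - Δ² M = Δ² M`, which the batch size
makes at least `64 * l`. -/
theorem ibr_tail [IsProbabilityMeasure μ] (h : Admissible k ε Δ δ)
    (hu : ∀ i x, u i x ∈ Set.Icc (0 : ℝ) 1)
    (hI : I.IsBandit u μ (elimLength u Δ + T)) (hrun : IsAdaptiveHedgeRun u ε Δ δ T I br)
    {r : ℕ} (hr : r < elimLength u Δ) (i : Fin N) {x y : Fin (k i) → ℝ}
    (hx : x ∈ stdSimplex ℝ (Fin (k i))) (hy : y ∈ stdSimplex ℝ (Fin (k i))) :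
    μ.real {ω | Δ ≤ ∑ c, (x c - y c) * noise I u r ω i c} ≤
      δ / (elimLength u Δ * N * maxActions k) := by
  have hΔ := h.Δ_pos
  have hM := IsAdaptiveHedgeRun.ibrBatch_pos (u := u) h (by omega)
  have hl := IsAdaptiveHedgeRun.one_lt_ibr_arg (u := u) h (by omega)
  set M := ibrBatch u Δ δ with hMdef
  have hM' : (0 : ℝ) < M := by exact_mod_cast hM
  set l := Real.log (elimLength u Δ * N * maxActions k / δ) with hldef
  have hlpos : 0 < l := Real.log_pos hl
  have hbatch : ∀ ω, I.batch r ω i = M := fun ω => hrun.ibr_batch r hr ω i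
  have hexp := hI.integral_exp_avg_sub_le_one hu i {r} (by simp; omega)
    (fun r' hr' ω j => hrun.strat_mem h (by rw [Finset.mem_singleton.1 hr']; omega) ω j) (K := M)
    (fun r' hr' ω => by rw [Finset.mem_singleton.1 hr', hbatch]; exact hM)
    (fun r' hr' ω => by rw [Finset.mem_singleton.1 hr', hbatch])
    (fun _ _ c => 2 * Δ * M * (x c - y c)) (B := 2 * Δ * M) (fun _ _ _ => measurable_const)
    (fun _ _ _ c => by
      rw [abs_mul, abs_of_pos (by positivity : 0 < 2 * Δ * (M : ℝ))]
      exact mul_le_of_le_one_right (by positivity) (abs_sub_le_one hx hy c))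
  refine (measureReal_mono ?_).trans ((measureReal_ge_le_exp_neg hexp.1 hexp.2 l).trans
    (le_of_eq ?_))
  · intro ω hω
    simp only [Set.mem_ofPred_eq, Finset.sum_singleton] at hω ⊢
    rw [Finset.sum_sub_distrib, hbatch]
    have e1 : ∑ c, 2 * Δ * M * (x c - y c) * (I.avg r ω i c - oppExp (u i) (I.strat r ω) i c) =
        2 * Δ * M * ∑ c, (x c - y c) * noise I u r ω i c := by
      rw [Finset.mul_sum]
      exact Finset.sum_congr rfl fun c _ => by unfold noise; ring
    have e2 : ∑ c, (2 * Δ * M * (x c - y c)) ^ 2 / (8 * (M : ℝ)) =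
        Δ ^ 2 * M / 2 * ∑ c, (x c - y c) ^ 2 := by
      rw [Finset.mul_sum]
      exact Finset.sum_congr rfl fun c _ => by field_simp; ring
    rw [e1, e2]
    have h1 := mul_le_mul_of_nonneg_left hω (by positivity : 0 ≤ 2 * Δ * (M : ℝ))
    have h2 := mul_le_mul_of_nonneg_left (sum_sq_sub_le_two hx hy)
      (by positivity : 0 ≤ Δ ^ 2 * (M : ℝ) / 2)
    have h3 : 64 * l / Δ ^ 2 ≤ M := Nat.le_ceil _
    rw [div_le_iff₀ (by positivity)] at h3
    nlinarith
  · rw [hldef, Real.exp_neg, Real.exp_log (by linarith), inv_div]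

theorem ce_tail [IsProbabilityMeasure μ] (h : Admissible k ε Δ δ)
    (hu : ∀ i x, u i x ∈ Set.Icc (0 : ℝ) 1)
    (hI : I.IsBandit u μ (elimLength u Δ + T)) (hrun : IsAdaptiveHedgeRun u ε Δ δ T I br)
    {n : ℕ} (hn : n ≤ T) (i : Fin N) (w : ℕ → Ω → Fin (k i) → ℝ) {B : ℝ}
    (hw : ∀ r < elimLength u Δ + T, ∀ c, Measurable[I.hist (slot r 0 0 0)] fun ω => w r ω c)
    (hwB : ∀ t < T, ∀ ω c, |w (elimLength u Δ + t) ω c| ≤ B) (y : ℝ) :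
    μ.real {ω | y ≤ ∑ t ∈ Finset.range n, ∑ c,
      (w (elimLength u Δ + t) ω c * noise I u (elimLength u Δ + t) ω i c -
        w (elimLength u Δ + t) ω c ^ 2 / (8 * I.batch (elimLength u Δ + t) ω i))} ≤
      Real.exp (-y) := by
  set L := elimLength u Δ with hL
  have hmem : ∀ r ∈ (Finset.range n).map (addLeftEmbedding L), ∃ t < T, r = L + t := by
    intro r hr
    obtain ⟨t, ht, rfl⟩ := Finset.mem_map.1 hr
    exact ⟨t, (Finset.mem_range.1 ht).trans_le hn, rfl⟩
  have hexp := hI.integral_exp_avg_sub_le_one hu i ((Finset.range n).map (addLeftEmbedding L))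
    (fun r hr => by obtain ⟨t, ht, rfl⟩ := hmem r hr; omega)
    (fun r hr ω j => by
      obtain ⟨t, ht, rfl⟩ := hmem r hr
      exact hrun.ce_strat_mem h ht ω j)
    -- A deterministic cap on the batch, from weight over cumulative weight being at most 1. It only
    -- makes the set of possible plays finite.
    (K := ⌈1 + 64 * Real.log (maxActions k * N * T / δ) / Δ ^ 2 * k i⌉₊)
    (fun r hr ω => by
      obtain ⟨t, ht, rfl⟩ := hmem r hr
      exact hrun.ce_batch_pos h ht ω i)
    (fun r hr ω => by
      obtain ⟨t, ht, rfl⟩ := hmem r hr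
      have hpos : ∀ τ ≤ t, ∀ a, 0 < I.strat (L + τ) ω i a := fun τ hτ a =>
        hrun.ce_strat_pos h (by omega) ω i a
      have hlog := Real.log_pos (h.one_lt_batch_arg (T := T) (by omega))
      have hΔ := h.Δ_pos
      rw [hrun.ce_batch t ht, ← @Nat.cast_le ℝ]
      refine (ceBatch_le h (by omega) (θ := fun τ => I.strat (L + τ) ω) hpos).trans
        (le_trans ?_ (Nat.le_ceil _))
      refine add_le_add_right (mul_le_mul_of_nonneg_left ?_ (by positivity)) _
      have ha : ∀ a ∈ (Finset.univ : Finset (Fin (k i))), I.strat (L + t) ω i a /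
          cumWeight (fun τ => I.strat (L + τ) ω) t i a ≤ 1 := fun a _ => by
        rw [div_le_one (cumWeight_pos fun τ hτ => hpos τ hτ a)]
        exact le_cumWeight (θ := fun τ => I.strat (L + τ) ω) (fun τ hτ => hpos τ hτ a) le_rfl
      simpa using Finset.sum_le_card_nsmul _ _ _ ha)
    w (B := B)
    (fun r hr c => by
      obtain ⟨t, ht, rfl⟩ := hmem r hr
      exact hw _ (by omega) c)
    (fun r hr ω c => by
      obtain ⟨t, ht, rfl⟩ := hmem r hr
      exact hwB t ht ω c)
  simpa [noise] using measureReal_ge_le_exp_neg hexp.1 hexp.2 y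

/-- The weight is predictable because `θ τ b` is fixed when round `τ` begins. The batch size is kept
in the variance term, since the adaptive choice of it is exploited later. -/
theorem ce_expert_tail [IsProbabilityMeasure μ] (h : Admissible k ε Δ δ)
    (hu : ∀ i x, u i x ∈ Set.Icc (0 : ℝ) 1)
    (hI : I.IsBandit u μ (elimLength u Δ + T)) (hrun : IsAdaptiveHedgeRun u ε Δ δ T I br)
    {t : ℕ} (ht : t < T) (i : Fin N) (b : Fin (k i)) {x y : Fin (k i) → ℝ}
    (hx : x ∈ stdSimplex ℝ (Fin (k i))) (hy : y ∈ stdSimplex ℝ (Fin (k i))) {s : ℝ} (hs : 0 ≤ s)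
    (z : ℝ) :
    μ.real {ω | z ≤ s * (∑ τ ∈ Finset.range (t + 1), I.strat (elimLength u Δ + τ) ω i b *
        ∑ c, (x c - y c) * noise I u (elimLength u Δ + τ) ω i c) -
      s ^ 2 * (∑ τ ∈ Finset.range (t + 1), I.strat (elimLength u Δ + τ) ω i b ^ 2 /
        (4 * I.batch (elimLength u Δ + τ) ω i))} ≤ Real.exp (-z) := by
  refine (measureReal_mono ?_).trans (ce_tail h hu hI hrun (n := t + 1) ht i
    (fun r ω c => s * I.strat r ω i b * (x c - y c)) (B := s) ?_ ?_ z)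
  · intro ω hω
    rw [Set.mem_ofPred_eq] at hω ⊢
    refine le_trans hω ?_
    rw [Finset.mul_sum, Finset.mul_sum, ← Finset.sum_sub_distrib]
    refine Finset.sum_le_sum fun τ hτ => ?_
    have hb : (0 : ℝ) < I.batch (elimLength u Δ + τ) ω i := by
      exact_mod_cast hrun.ce_batch_pos h (by have := Finset.mem_range.1 hτ; omega) ω i
    rw [Finset.sum_sub_distrib]
    set q := I.strat (elimLength u Δ + τ) ω i b
    set M : ℝ := (I.batch (elimLength u Δ + τ) ω i : ℝ)
    have e1 : ∑ c, s * q * (x c - y c) * noise I u (elimLength u Δ + τ) ω i c =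
        s * (q * ∑ c, (x c - y c) * noise I u (elimLength u Δ + τ) ω i c) := by
      rw [Finset.mul_sum, Finset.mul_sum]
      exact Finset.sum_congr rfl fun c _ => by ring
    have e2 : ∑ c, (s * q * (x c - y c)) ^ 2 / (8 * M) =
        s ^ 2 * (q ^ 2 / (8 * M)) * ∑ c, (x c - y c) ^ 2 := by
      rw [Finset.mul_sum]
      exact Finset.sum_congr rfl fun c _ => by ring
    rw [e1, e2]
    have := mul_le_mul_of_nonneg_left (sum_sq_sub_le_two hx hy)
      (by positivity : 0 ≤ s ^ 2 * (q ^ 2 / (8 * M)))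
    have e3 : s ^ 2 * (q ^ 2 / (8 * M)) * 2 = s ^ 2 * (q ^ 2 / (4 * M)) := by
      field_simp; ring
    linarith
  · intro r hr c
    exact ((hI.strat_meas r hr i b).const_mul s).mul_const _
  · intro t' ht' ω c
    have h0 := (hrun.ce_strat_pos h ht' ω i b).le
    have h1 := hrun.ce_strat_le_one h ht' ω i b
    rw [abs_mul, abs_mul, abs_of_nonneg hs, abs_of_nonneg h0]
    have := abs_sub_le_one hx hy c
    have h2 : s * I.strat (elimLength u Δ + t') ω i b ≤ s := mul_le_of_le_one_right hs h1
    exact (mul_le_of_le_one_right (by positivity) this).trans h2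

/-- Here a batch size of at least 1 is enough: averaging over `T` rounds supplies the accuracy. -/
theorem ce_swap_tail [IsProbabilityMeasure μ] (h : Admissible k ε Δ δ)
    (hu : ∀ i x, u i x ∈ Set.Icc (0 : ℝ) 1)
    (hI : I.IsBandit u μ (elimLength u Δ + T)) (hrun : IsAdaptiveHedgeRun u ε Δ δ T I br)
    (i : Fin N) (φ : Fin (k i) → Fin (k i)) {s : ℝ} (hs : 0 ≤ s) (z : ℝ) :
    μ.real {ω | z ≤ s * (∑ t ∈ Finset.range T, ∑ c, (I.strat (elimLength u Δ + t) ω i c -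
        pushforward φ (I.strat (elimLength u Δ + t) ω i) c) *
          noise I u (elimLength u Δ + t) ω i c) - s ^ 2 * (T / 4)} ≤ Real.exp (-z) := by
  refine (measureReal_mono ?_).trans (ce_tail h hu hI hrun (n := T) le_rfl i
    (fun r ω c => s * (I.strat r ω i c - pushforward φ (I.strat r ω i) c)) (B := s) ?_ ?_ z)
  · intro ω hω
    rw [Set.mem_ofPred_eq] at hω ⊢
    refine le_trans hω ?_
    have e : s ^ 2 * ((T : ℝ) / 4) = ∑ t ∈ Finset.range T, s ^ 2 / 4 := by
      simp; ring
    rw [e, Finset.mul_sum, ← Finset.sum_sub_distrib]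
    refine Finset.sum_le_sum fun t ht => ?_
    have ht' := Finset.mem_range.1 ht
    have hb : (1 : ℝ) ≤ I.batch (elimLength u Δ + t) ω i := by
      exact_mod_cast hrun.ce_batch_pos h ht' ω i
    have hθ := hrun.ce_strat_mem h ht' ω i
    rw [Finset.sum_sub_distrib]
    set q := I.strat (elimLength u Δ + t) ω i
    set M : ℝ := (I.batch (elimLength u Δ + t) ω i : ℝ)
    have hM : 0 < M := by linarith
    have e1 : ∑ c, s * (q c - pushforward φ q c) * noise I u (elimLength u Δ + t) ω i c =
        s * ∑ c, (q c - pushforward φ q c) * noise I u (elimLength u Δ + t) ω i c := by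
      rw [Finset.mul_sum]
      exact Finset.sum_congr rfl fun c _ => by ring
    have e2 : ∑ c, (s * (q c - pushforward φ q c)) ^ 2 / (8 * M) =
        s ^ 2 / (8 * M) * ∑ c, (q c - pushforward φ q c) ^ 2 := by
      rw [Finset.mul_sum]
      exact Finset.sum_congr rfl fun c _ => by ring
    rw [e1, e2]
    have h1 := mul_le_mul_of_nonneg_left
      (sum_sq_sub_le_two hθ (pushforward_mem_stdSimplex φ hθ))
      (by positivity : 0 ≤ s ^ 2 / (8 * M))
    have h2 : s ^ 2 / (8 * M) * 2 ≤ s ^ 2 / 4 := by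
      rw [div_mul_eq_mul_div, div_le_div_iff₀ (by positivity) (by norm_num)]
      nlinarith [mul_le_mul_of_nonneg_left hb (sq_nonneg s)]
    linarith
  · intro r hr c
    refine Measurable.const_mul ((hI.strat_meas r hr i c).sub ?_) s
    refine Finset.measurable_sum _ fun b _ => ?_
    split_ifs
    exacts [hI.strat_meas r hr i b, measurable_const]
  · intro t' ht' ω c
    have hθ := hrun.ce_strat_mem h ht' ω i
    rw [abs_mul, abs_of_nonneg hs]
    exact mul_le_of_le_one_right hs (abs_sub_le_one hθ (pushforward_mem_stdSimplex φ hθ) c)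

end Concentration

/-- Some pure action does at least as well as the mixture `x`; its term in the denominator already
exceeds that of `a` by the factor `1 / p`. -/
theorem softmax_le_of_gap {n : ℕ} {η p : ℝ} (hη : 0 ≤ η) (hp : 0 < p) {U x : Fin n → ℝ}
    (hx : x ∈ stdSimplex ℝ (Fin n)) {a : Fin n}
    (hgap : Real.log (1 / p) ≤ η * ((∑ c, x c * U c) - U a)) : softmax η U a ≤ p := by
  obtain ⟨c, hc⟩ : ∃ c, ∑ c, x c * U c ≤ U c := by
    by_contra! hcon
    have hpos : ∃ b ∈ Finset.univ, 0 < x b := by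
      refine Finset.exists_lt_of_sum_lt (f := fun _ => (0 : ℝ)) ?_
      rw [hx.2]; simp
    obtain ⟨b, -, hb⟩ := hpos
    have hlt : ∑ c, x c * U c < ∑ c, x c * ∑ d, x d * U d :=
      Finset.sum_lt_sum (fun c _ => mul_le_mul_of_nonneg_left (hcon c).le (hx.1 c))
        ⟨b, Finset.mem_univ b, mul_lt_mul_of_pos_left (hcon b) hb⟩
    rw [← Finset.sum_mul, hx.2, one_mul] at hlt
    exact lt_irrefl _ hlt
  have hsum : 0 < ∑ c, Real.exp (η * U c) := sum_exp_pos a.pos fun c => η * U c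
  rw [softmax, div_le_iff₀ hsum]
  have h1 : Real.exp (η * U c) ≤ ∑ c, Real.exp (η * U c) :=
    Finset.single_le_sum (f := fun c => Real.exp (η * U c)) (fun _ _ => (Real.exp_pos _).le)
      (Finset.mem_univ c)
  have h2 : Real.exp (η * U a) ≤ p * Real.exp (η * U c) := by
    rw [← Real.exp_log hp, ← Real.exp_add, Real.exp_le_exp]
    rw [one_div, Real.log_inv] at hgap
    nlinarith [mul_le_mul_of_nonneg_left hc hη]
  exact h2.trans (mul_le_mul_of_nonneg_left h1 hp.le)

/-! ### Deterministic consequences of accurate estimates. -/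

section GoodEvent

variable {N : ℕ} {k : Fin N → ℕ} {Ω : Type*} [mΩ : MeasurableSpace Ω] {u : Fin N → Profile k → ℝ}
  {ε Δ δ : ℝ} {T : ℕ} {I : Interaction k Ω} {br : ℕ → Ω → Profile k} {μ : Measure Ω}

theorem sum_single_sub_mul {n : ℕ} (a : Fin n) (x g : Fin n → ℝ) :
    ∑ c, ((Pi.single a 1 : Fin n → ℝ) c - x c) * g c = g a - ∑ c, x c * g c := by
  simp [sub_mul, Finset.sum_sub_distrib, Pi.single_apply]

/-- If the payoff estimates are accurate, iterated best response leaves the eliminated actions. -/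
theorem br_notMem_elim (h : Admissible k ε Δ δ) (hu : ∀ i x, u i x ∈ Set.Icc (0 : ℝ) 1)
    (hrun : IsAdaptiveHedgeRun u ε Δ δ T I br) (ω : Ω)
    (x : ℕ → (i : Fin N) → Fin (k i) → Fin (k i) → ℝ)
    (hx : ∀ l i a, x l i a ∈ stdSimplex ℝ (Fin (k i)))
    (hdom : ∀ l i a, a ∈ elim u Δ (l + 1) i → ∀ y : Profile k,
      (∀ j, j ≠ i → y j ∉ elim u Δ l j) → u i (Function.update y i a) ≤
        (∑ c, x l i a c * u i (Function.update y i c)) - Δ)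
    (hgood : ∀ r < elimLength u Δ, ∀ i a,
      ∑ c, ((Pi.single a 1 : Fin (k i) → ℝ) c - x r i a c) * noise I u r ω i c < Δ) :
    ∀ r ≤ elimLength u Δ, ∀ i, br r ω i ∉ elim u Δ r i := by
  intro r
  induction r with
  | zero => intro _ i; exact Set.notMem_empty _
  | succ r ih =>
    intro hr i hmem
    have hbr := ih (by omega)
    set a := br (r + 1) ω i with ha
    have hstrat : ∀ j, I.strat r ω j ∈ stdSimplex ℝ (Fin (k j)) := fun j =>
      hrun.strat_mem h (by omega) ω j
    -- The opponents play point masses outside the eliminated sets, so the bad mass is exactly 0 and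
    -- the full gap `Δ` survives.
    have h1 := oppExp_le_of_dominated hstrat hu h.Δ_pos.le (p := 0) le_rfl
      (fun j => elim u Δ r j) (fun j c hc => by
        rw [hrun.ibr_strat r (by omega) ω j, Pi.single_eq_of_ne]
        rintro rfl
        exact hbr j hc) i a (x r i a) (hx r i a) (hdom r i a hmem)
    have h2 := hgood r (by omega) i a
    rw [sum_single_sub_mul] at h2
    simp only [noise, mul_sub, Finset.sum_sub_distrib] at h2
    have h3 : ∑ c, x r i a c * I.avg r ω i c ≤ I.avg r ω i a := by
      calc _ ≤ ∑ c, x r i a c * I.avg r ω i a := Finset.sum_le_sum fun c _ =>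
            mul_le_mul_of_nonneg_left (hrun.ibr_best r (by omega) ω i c) ((hx r i a).1 c)
        _ = _ := by rw [← Finset.sum_mul, (hx r i a).2, one_mul]
    simp only [mul_zero, add_zero] at h1
    linarith

/-- If the payoff estimates are accurate, adaptive Hedge keeps the eliminated actions below the
threshold. -/
theorem ce_strat_le_thr (h : Admissible k ε Δ δ) (hu : ∀ i x, u i x ∈ Set.Icc (0 : ℝ) 1)
    (hrun : IsAdaptiveHedgeRun u ε Δ δ T I br) (ω : Ω)
    (x : (i : Fin N) → Fin (k i) → Fin (k i) → ℝ)
    (hx : ∀ i a, x i a ∈ stdSimplex ℝ (Fin (k i)))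
    (hdom : ∀ i a, a ∈ elim u Δ (elimLength u Δ) i → ∀ y : Profile k,
      (∀ j, j ≠ i → y j ∉ elim u Δ (elimLength u Δ) j) → u i (Function.update y i a) ≤
        (∑ c, x i a c * u i (Function.update y i c)) - Δ)
    (hbr : ∀ i, br (elimLength u Δ) ω i ∉ elim u Δ (elimLength u Δ) i)
    (hgood : ∀ t < T, ∀ i b a, ∑ τ ∈ Finset.range (t + 1), I.strat (elimLength u Δ + τ) ω i b *
      ∑ c, ((Pi.single a 1 : Fin (k i) → ℝ) c - x i a c) *
        noise I u (elimLength u Δ + τ) ω i c ≤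
      Δ / 4 * cumWeight (fun τ => I.strat (elimLength u Δ + τ) ω) t i b) :
    ∀ t < T, ∀ i, ∀ a ∈ elim u Δ (elimLength u Δ) i,
      I.strat (elimLength u Δ + t) ω i a ≤ thr k ε Δ := by
  set L := elimLength u Δ with hL
  set θ : ℕ → Weights k := fun τ => I.strat (L + τ) ω with hθ
  have hΔ := h.Δ_pos
  intro t
  induction t using Nat.strong_induction_on with
  | _ t ih =>
    intro ht i a ha
    cases t with
    | zero =>
      rw [add_zero, hrun.init, if_neg]
      · simp
      · rintro rfl
        exact hbr i ha
    | succ t =>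
      have hs := hrun.ce_simplex t ht ω i
      have hexpert : ∀ b, softmax (ceRate ε Δ θ t i b) (fun c => ∑ τ ∈ Finset.range (t + 1),
          I.avg (L + τ) ω i c * θ τ i b) a ≤ thr k ε Δ := by
        intro b
        have hSpos : 0 < cumWeight θ t i b :=
          cumWeight_pos fun τ hτ => hrun.ce_strat_pos h (by omega) ω i b
        have hrate : 2 * Real.log (1 / thr k ε Δ) / (Δ * cumWeight θ t i b) ≤ ceRate ε Δ θ t i b :=
          le_max_left _ _
        have hlog := h.log_inv_thr_ge
        have hrate0 : 0 ≤ ceRate ε Δ θ t i b := le_trans (by positivity) hrate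
        refine softmax_le_of_gap hrate0 h.thr_pos (hx i a) ?_
        -- By induction the opponents' bad mass was at most `min ε Δ / 8` in all earlier rounds,
        -- leaving an expected gap of `3 / 4 * Δ` per unit weight; the noise takes at most another
        -- `Δ / 4`.
        have hgap : Δ / 2 * cumWeight θ t i b ≤
            (∑ c, x i a c * ∑ τ ∈ Finset.range (t + 1), I.avg (L + τ) ω i c * θ τ i b) -
              ∑ τ ∈ Finset.range (t + 1), I.avg (L + τ) ω i a * θ τ i b := by
          have e1 : (∑ c, x i a c * ∑ τ ∈ Finset.range (t + 1), I.avg (L + τ) ω i c * θ τ i b) -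
              ∑ τ ∈ Finset.range (t + 1), I.avg (L + τ) ω i a * θ τ i b =
              ∑ τ ∈ Finset.range (t + 1), θ τ i b *
                ((∑ c, x i a c * I.avg (L + τ) ω i c) - I.avg (L + τ) ω i a) := by
            simp only [Finset.mul_sum, mul_sub, Finset.sum_sub_distrib]
            rw [Finset.sum_comm]
            congr 1
            · exact Finset.sum_congr rfl fun τ _ => Finset.sum_congr rfl fun c _ => by ring
            · exact Finset.sum_congr rfl fun τ _ => by ring
          have e2 : ∀ τ ∈ Finset.range (t + 1), θ τ i b * (3 / 4 * Δ) -
              θ τ i b * ∑ c, ((Pi.single a 1 : Fin (k i) → ℝ) c - x i a c) *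
                noise I u (L + τ) ω i c ≤
              θ τ i b * ((∑ c, x i a c * I.avg (L + τ) ω i c) - I.avg (L + τ) ω i a) := by
            intro τ hτ
            have hτ' := Finset.mem_range.1 hτ
            rw [← mul_sub]
            refine mul_le_mul_of_nonneg_left ?_ (hrun.ce_strat_pos h (by omega) ω i b).le
            have hstrat : ∀ j, θ τ j ∈ stdSimplex ℝ (Fin (k j)) := fun j =>
              hrun.ce_strat_mem h (by omega) ω j
            have h1 := oppExp_le_of_dominated hstrat hu hΔ.le h.thr_pos.le
              (fun j => elim u Δ L j) (fun j c hc => ih τ hτ' (by omega) j c hc) i a (x i a)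
              (hx i a) (hdom i a ha)
            rw [h.mass_eq] at h1
            rw [sum_single_sub_mul]
            simp only [noise, mul_sub, Finset.sum_sub_distrib]
            have h2 : (1 + Δ) * (min ε Δ / 8) ≤ Δ / 4 := by
              have := min_le_right ε Δ
              have := h.min_pos
              nlinarith [h.Δ_le]
            simp only [hθ] at h1
            linarith
          have e3 := Finset.sum_le_sum e2
          rw [Finset.sum_sub_distrib, ← Finset.sum_mul] at e3
          have e4 := hgood t (by omega) i b a
          rw [e1]
          have e5 : ∑ τ ∈ Finset.range (t + 1), θ τ i b = cumWeight θ t i b := rfl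
          rw [e5] at e3
          linarith
        calc Real.log (1 / thr k ε Δ)
            = 2 * Real.log (1 / thr k ε Δ) / (Δ * cumWeight θ t i b) *
                (Δ / 2 * cumWeight θ t i b) := by field_simp
          _ ≤ _ := mul_le_mul hrate hgap (by positivity) hrate0
      rw [hrun.ce_fixed t ht ω i a]
      calc _ ≤ ∑ b, thr k ε Δ * I.strat (L + (t + 1)) ω i b :=
            Finset.sum_le_sum fun b _ => mul_le_mul_of_nonneg_right (hexpert b) (hs.1 b)
        _ = thr k ε Δ := by rw [← Finset.mul_sum, hs.2, mul_one]

theorem avg_mem_Icc (hI : I.IsBandit u μ (elimLength u Δ + T)) (r : ℕ) (ω : Ω) (i : Fin N)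
    (c : Fin (k i)) : I.avg r ω i c ∈ Set.Icc (0 : ℝ) 1 := by
  unfold Interaction.avg
  refine ⟨div_nonneg (Finset.sum_nonneg fun m _ => (hI.fb_mem _ ω i).1) (by positivity),
    div_le_one_of_le₀ ?_ (by positivity)⟩
  have : ∀ m ∈ Finset.range (I.batch r ω i), I.fb (slot r i c m) ω i ≤ 1 := fun m _ =>
    (hI.fb_mem _ ω i).2
  simpa using Finset.sum_le_card_nsmul _ _ _ this

/-- Each of the three terms of `swap_regret` fits into `ε * T / 8`; this is one of the demands on
the constant 4096. -/
theorem regret_budget (h : Admissible k ε Δ δ) :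
    1 + 3 * √(maxActions k * Real.log (maxActions k) * ceRounds 4096 2 k ε Δ δ) +
      2 * maxActions k * (2 * Real.log (1 / thr k ε Δ) / Δ) *
        Real.log (ceRounds 4096 2 k ε Δ δ / thr k ε Δ) ≤
      3 / 8 * ε * ceRounds 4096 2 k ε Δ δ := by
  have hT := h.rounds_ge
  have hT0 : (0 : ℝ) < ceRounds 4096 2 k ε Δ δ := by exact_mod_cast h.rounds_pos
  have hε := h.ε_pos
  have hΔ := h.Δ_pos
  have hΛ := h.one_le_logFactor
  have hA := h.one_le_A
  have hlogA := h.log_A_le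
  have hlogA0 : 0 ≤ Real.log (maxActions k) := Real.log_natCast_nonneg _
  have hp1 := h.log_inv_thr_le
  have hp0 := h.log_inv_thr_ge
  have hq1 := h.log_rounds_div_thr_le
  have hq0 : 0 ≤ Real.log (ceRounds 4096 2 k ε Δ δ / thr k ε Δ) := Real.log_nonneg (by
    rw [one_le_div h.thr_pos]
    have : (1 : ℝ) ≤ ceRounds 4096 2 k ε Δ δ := by exact_mod_cast h.rounds_pos
    linarith [h.thr_le])
  set T : ℝ := (ceRounds 4096 2 k ε Δ δ : ℝ)
  set Λ := logFactor k ε Δ δ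
  set A : ℝ := (maxActions k : ℝ)
  have hΛ2 : Λ ≤ Λ ^ 2 := by nlinarith
  have hε2 : 4096 * (A * Λ ^ 2) ≤ ε ^ 2 * T := by
    have h1 : 4096 * (A / ε ^ 2) * Λ ^ 2 ≤ T := by
      refine le_trans ?_ hT
      have : 0 ≤ A / Δ ^ 2 * Λ ^ 2 := by positivity
      nlinarith
    have := mul_le_mul_of_nonneg_left h1 (sq_nonneg ε)
    refine le_trans (le_of_eq ?_) this
    field_simp
  -- The rates force a cost of order `A / Δ`, hence a need for `A / (ε * Δ)` rounds; the
  -- arithmetic-geometric mean inequality absorbs it in `A / ε ^ 2 + A / Δ ^ 2`.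
  have hεΔ : 8192 * (A * Λ ^ 2 / Δ) ≤ ε * T := by
    have h1 : 2 / (ε * Δ) ≤ 1 / ε ^ 2 + 1 / Δ ^ 2 := by
      have := sq_nonneg (1 / ε - 1 / Δ)
      have e : 2 / (ε * Δ) = 2 * (1 / ε) * (1 / Δ) := by field_simp
      have e1 : 1 / ε ^ 2 = (1 / ε) ^ 2 := by field_simp
      have e2 : 1 / Δ ^ 2 = (1 / Δ) ^ 2 := by field_simp
      rw [e, e1, e2]
      nlinarith
    have h2 : 4096 * (A * (2 / (ε * Δ))) * Λ ^ 2 ≤ T := by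
      refine le_trans ?_ hT
      have e : A / ε ^ 2 + A / Δ ^ 2 = A * (1 / ε ^ 2 + 1 / Δ ^ 2) := by ring
      rw [e]
      gcongr
    have := mul_le_mul_of_nonneg_left h2 hε.le
    refine le_trans (le_of_eq ?_) this
    field_simp
    norm_num
  have hone : 1 ≤ 1 / 8 * ε * T := by
    have : 1 ≤ A * Λ ^ 2 / Δ := by
      rw [one_le_div hΔ]
      nlinarith [h.Δ_le]
    linarith
  have hsqrt : 3 * √(A * Real.log A * T) ≤ 1 / 8 * ε * T := by
    have h1 : √(A * Real.log A * T) ≤ 1 / 24 * ε * T := by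
      rw [Real.sqrt_le_left (by positivity)]
      have h2 : A * Real.log A ≤ A * Λ ^ 2 :=
        mul_le_mul_of_nonneg_left (hlogA.trans hΛ2) (by positivity)
      have h3 : 576 * (A * Real.log A) ≤ ε ^ 2 * T := by nlinarith [sq_nonneg Λ]
      nlinarith [mul_le_mul_of_nonneg_right h3 hT0.le]
    linarith
  have hlast : 2 * A * (2 * Real.log (1 / thr k ε Δ) / Δ) *
      Real.log (T / thr k ε Δ) ≤ 1 / 8 * ε * T := by
    have h1 : 2 * A * (2 * Real.log (1 / thr k ε Δ) / Δ) * Real.log (T / thr k ε Δ) ≤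
        2 * A * (2 * (3 * Λ) / Δ) * (13 * Λ) := by
      gcongr
    have e : 2 * A * (2 * (3 * Λ) / Δ) * (13 * Λ) = 156 * (A * Λ ^ 2 / Δ) := by ring
    have h0 : 0 ≤ A * Λ ^ 2 / Δ := by positivity
    linarith
  linarith

theorem ceOutput_mem_stdSimplex {p : ℝ} (hT : 0 < T) {θ : ℕ → Weights k}
    (hθ : ∀ t < T, ∀ i, θ t i ∈ stdSimplex ℝ (Fin (k i))) (hp : ∀ i, k i * p < 1) :
    ceOutput p T θ ∈ stdSimplex ℝ (Profile k) := by
  have hclip : ∀ t < T, ∀ i, clip p (θ t i) ∈ stdSimplex ℝ (Fin (k i)) := fun t ht i =>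
    clip_mem_stdSimplex (hθ t ht i) (hp i)
  refine ⟨fun x => div_nonneg (Finset.sum_nonneg fun t ht =>
    prod_nonneg_of_simplex (θ := fun i => clip p (θ t i)) (hclip t (Finset.mem_range.1 ht)) x)
    (by positivity), ?_⟩
  have hT' : (T : ℝ) ≠ 0 := by exact_mod_cast hT.ne'
  unfold ceOutput
  rw [← Finset.sum_div, Finset.sum_comm, div_eq_one_iff_eq hT']
  have : ∀ t ∈ Finset.range T, ∑ x : Profile k, ∏ i, clip p (θ t i) (x i) = 1 := fun t ht =>
    sum_prod_eq_one (fun i => clip p (θ t i)) fun i => (hclip t (Finset.mem_range.1 ht) i).2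
  rw [Finset.sum_congr rfl this]
  simp

/-- If the payoff estimates are accurate on average, the output is an `ε`-CE. -/
theorem isApproxCE_ceOutput (h : Admissible k ε Δ δ) (hu : ∀ i x, u i x ∈ Set.Icc (0 : ℝ) 1)
    (hI : I.IsBandit u μ (elimLength u Δ + ceRounds 4096 2 k ε Δ δ))
    (hrun : IsAdaptiveHedgeRun u ε Δ δ (ceRounds 4096 2 k ε Δ δ) I br) (ω : Ω)
    (hgood : ∀ i φ, ∑ t ∈ Finset.range (ceRounds 4096 2 k ε Δ δ), ∑ c,
      (I.strat (elimLength u Δ + t) ω i c -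
        pushforward φ (I.strat (elimLength u Δ + t) ω i) c) *
          noise I u (elimLength u Δ + t) ω i c ≤ ε / 4 * ceRounds 4096 2 k ε Δ δ) :
    IsApproxCE u ε (ceOutput (thr k ε Δ) (ceRounds 4096 2 k ε Δ δ)
      (fun t => I.strat (elimLength u Δ + t) ω)) := by
  have hbudget := regret_budget h
  have hT0 := h.rounds_pos
  set T := ceRounds 4096 2 k ε Δ δ with hTdef
  set L := elimLength u Δ with hL
  set p := thr k ε Δ with hpdef
  have hp := h.thr_pos
  have hT' : (0 : ℝ) < T := by exact_mod_cast hT0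
  set θ : ℕ → Weights k := fun t => I.strat (L + t) ω with hθdef
  have hθ : ∀ t < T, ∀ i, θ t i ∈ stdSimplex ℝ (Fin (k i)) := fun t ht i =>
    hrun.ce_strat_mem h ht ω i
  refine ⟨ceOutput_mem_stdSimplex hT0 hθ fun i => by linarith [h.card_mul_thr_le i], ?_⟩
  intro i φ
  set f : Profile k → ℝ := fun x => u i (Function.update x i (φ (x i))) - u i x with hf
  have hf1 : ∀ x, |f x| ≤ 1 := fun x => by
    have h1 := hu i (Function.update x i (φ (x i)))
    have h2 := hu i x
    rw [abs_le]
    constructor <;> simp only [hf] <;> linarith [h1.1, h1.2, h2.1, h2.2]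
  suffices hmain : ∑ x, ceOutput p T θ x * f x ≤ ε by
    simp only [hf, mul_sub, Finset.sum_sub_distrib] at hmain
    linarith
  have hout : ∑ x, ceOutput p T θ x * f x =
      (∑ t ∈ Finset.range T, ∑ x : Profile k, (∏ j, clip p (θ t j) (x j)) * f x) / T := by
    unfold ceOutput
    rw [Finset.sum_comm, Finset.sum_div]
    refine Finset.sum_congr rfl fun x _ => ?_
    rw [div_mul_eq_mul_div, Finset.sum_mul]
  rw [hout, div_le_iff₀ hT']
  -- Clipping costs twice the mass `min ε Δ / 8`, hence at most `ε / 4`.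
  have hclip : ∀ t ∈ Finset.range T, ∑ x : Profile k, (∏ j, clip p (θ t j) (x j)) * f x ≤
      ∑ c, θ t i c * (oppExp (u i) (θ t) i (φ c) - oppExp (u i) (θ t) i c) + ε / 4 := by
    intro t ht
    have h1 := sum_prod_clip_mul_le (hθ t (Finset.mem_range.1 ht)) hp.le
      (by rw [h.mass_eq]; linarith [min_le_left ε Δ, h.ε_le]) f hf1
    rw [h.mass_eq] at h1
    have h2 : ∑ x : Profile k, (∏ j, θ t j (x j)) * f x =
        ∑ c, θ t i c * (oppExp (u i) (θ t) i (φ c) - oppExp (u i) (θ t) i c) := by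
      simp only [hf, mul_sub, Finset.sum_sub_distrib]
      rw [sum_prod_mul_update, sum_prod_mul_eq_sum_oppExp]
    rw [h2] at h1
    linarith [min_le_left ε Δ]
  have hsum := Finset.sum_le_sum hclip
  rw [Finset.sum_add_distrib] at hsum
  simp only [Finset.sum_const, Finset.card_range, nsmul_eq_mul] at hsum
  -- True swap regret is observed swap regret plus noise. In total: 3/8 for the regret, 1/4 for the
  -- noise and 1/4 for clipping, in units of `ε * T`.
  have hdecomp : ∑ t ∈ Finset.range T, ∑ c, θ t i c *
      (oppExp (u i) (θ t) i (φ c) - oppExp (u i) (θ t) i c) =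
      ∑ t ∈ Finset.range T, ∑ c, θ t i c * (I.avg (L + t) ω i (φ c) - I.avg (L + t) ω i c) +
      ∑ t ∈ Finset.range T, ∑ c, (θ t i c - pushforward φ (θ t i) c) * noise I u (L + t) ω i c := by
    rw [← Finset.sum_add_distrib]
    refine Finset.sum_congr rfl fun t _ => ?_
    simp only [sub_mul, Finset.sum_sub_distrib]
    rw [sum_pushforward_mul, ← Finset.sum_sub_distrib, ← Finset.sum_add_distrib]
    exact Finset.sum_congr rfl fun c _ => by simp only [noise, hθdef]; ring
  have hnoise := hgood i φ
  obtain ⟨m, hm⟩ : ∃ m, T = m + 1 := ⟨T - 1, by omega⟩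
  have hki : 0 < k i := h.k_pos i
  have hkA : (k i : ℝ) ≤ maxActions k := by exact_mod_cast le_maxActions k i
  have hki1 : (1 : ℝ) ≤ k i := by exact_mod_cast hki
  have hlogp := h.log_inv_thr_ge
  have hB1 : 1 ≤ 2 * Real.log (1 / p) / Δ := by
    rw [one_le_div h.Δ_pos]
    linarith [h.Δ_le]
  have hlogk : Real.log (k i) ≤ Real.log (maxActions k) := Real.log_le_log (by linarith) hkA
  have hlogk0 : 0 ≤ Real.log (k i) := Real.log_natCast_nonneg _
  have hreg := swap_regret hki (fun t => θ t i) (fun t c => I.avg (L + t) ω i c) m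
    (p := p) (B := 2 * Real.log (1 / p) / Δ) (E := maxActions k * Real.log (maxActions k)) hp hB1
    (mul_nonneg (by positivity) (hlogk0.trans hlogk))
    (mul_le_mul hkA hlogk hlogk0 (by positivity))
    (fun t ht => hθ t (by omega) i) (fun b => hrun.thr_le_init h ω i b)
    (fun t _ c => avg_mem_Icc hI _ ω i c)
    (fun t ht a => by
      have := hrun.ce_fixed t (by omega) ω i a
      simp only [ceRate, cumWeight, ← div_div] at this
      exact this) φ
  rw [← hm] at hreg
  have hlast : 2 * (k i : ℝ) * (2 * Real.log (1 / p) / Δ) * Real.log (T / p) ≤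
      2 * maxActions k * (2 * Real.log (1 / p) / Δ) * Real.log (T / p) := by
    have : 0 ≤ Real.log (T / p) := Real.log_nonneg (by
      rw [one_le_div hp]
      have : (1 : ℝ) ≤ T := by exact_mod_cast hT0
      linarith [h.thr_le])
    gcongr
  have hεT : 0 ≤ ε * T := mul_nonneg h.ε_pos.le hT'.le
  linarith

end GoodEvent

/-! ### Probabilities of the three bad events. -/

section UnionBound

theorem measureReal_iUnion_le_mul {Ω ι : Type*} [MeasurableSpace Ω] {μ : Measure Ω} [Fintype ι]
    (f : ι → Set Ω) {c C : ℝ} (hc : 0 ≤ c) (hC : Fintype.card ι ≤ C) (hf : ∀ i, μ.real (f i) ≤ c) : μ.real (⋃ i, f i) ≤ C * c := by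
  refine (measureReal_iUnion_fintype_le f).trans ?_
  refine (Finset.sum_le_card_nsmul _ _ _ fun i _ => hf i).trans ?_
  rw [nsmul_eq_mul]
  exact mul_le_mul_of_nonneg_right hC hc

variable {Ω : Type*} [MeasurableSpace Ω] {μ : Measure Ω} [IsProbabilityMeasure μ]
  {N : ℕ} {k : Fin N → ℕ} {u : Fin N → Profile k → ℝ}
  {ε Δ δ : ℝ} {T : ℕ} {I : Interaction k Ω} {br : ℕ → Ω → Profile k}

theorem card_actions_le (k : Fin N → ℕ) (i : Fin N) :
    (Fintype.card (Fin (k i)) : ℝ) ≤ maxActions k := by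
  rw [Fintype.card_fin]
  exact_mod_cast le_maxActions k i

/-- With probability at least `1 - δ` the estimates of iterated best response are accurate. -/
theorem ibr_bad_le (h : Admissible k ε Δ δ) (hu : ∀ i x, u i x ∈ Set.Icc (0 : ℝ) 1)
    (hI : I.IsBandit u μ (elimLength u Δ + T)) (hrun : IsAdaptiveHedgeRun u ε Δ δ T I br)
    (x : ℕ → (i : Fin N) → Fin (k i) → Fin (k i) → ℝ)
    (hx : ∀ l i a, x l i a ∈ stdSimplex ℝ (Fin (k i))) :
    μ.real (⋃ r : Fin (elimLength u Δ), ⋃ i, ⋃ a, {ω | Δ ≤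
      ∑ c, ((Pi.single a 1 : Fin (k i) → ℝ) c - x r i a c) * noise I u r ω i c}) ≤ δ := by
  set L := elimLength u Δ with hL
  have hδ := h.δ_pos
  have hN := h.one_le_N
  have hA := h.one_le_A
  set c : ℝ := δ / (L * N * maxActions k) with hc
  have hc0 : 0 ≤ c := by positivity
  have hbound : μ.real (⋃ r : Fin L, ⋃ i, ⋃ a, {ω | Δ ≤
      ∑ c, ((Pi.single a 1 : Fin (k i) → ℝ) c - x r i a c) * noise I u r ω i c}) ≤
      L * (N * (maxActions k * c)) := by
    refine measureReal_iUnion_le_mul _ (by positivity) (by simp) fun r => ?_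
    refine measureReal_iUnion_le_mul _ (by positivity) (by simp) fun i => ?_
    refine measureReal_iUnion_le_mul _ (by positivity) (card_actions_le k i) fun a => ?_
    exact ibr_tail h hu hI hrun r.2 i (single_mem_stdSimplex ℝ a) (hx r i a)
  refine hbound.trans ?_
  rcases Nat.eq_zero_or_pos L with h0 | hpos
  · rw [h0]; simp [hδ.le]
  · have : (0 : ℝ) < L := by exact_mod_cast hpos
    rw [hc]
    refine le_of_eq ?_
    field_simp

/-- With `n = N * T` slopes the grid reaches cumulative weights as small as `p`: the left side is
below `n ^ 2`, and `n ≤ 2 ^ (n - 1)`. -/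
theorem rounds_div_thr_lt (h : Admissible k ε Δ δ) :
    (ceRounds 4096 2 k ε Δ δ : ℝ) / thr k ε Δ < 4 ^ (N * ceRounds 4096 2 k ε Δ δ - 1) := by
  have hT0 := h.rounds_pos
  have hge := h.rounds_ge
  have hN := h.one_le_N
  have hA := h.one_le_A
  have hm := h.min_pos
  have hΛ := h.one_le_logFactor
  set T := ceRounds 4096 2 k ε Δ δ with hT
  have hT' : (0 : ℝ) < T := by exact_mod_cast hT0
  have h1 : 8 * (maxActions k : ℝ) / min ε Δ < T := by
    have hle : (maxActions k : ℝ) / min ε Δ ≤ maxActions k / ε ^ 2 + maxActions k / Δ ^ 2 := by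
      have hsq : ∀ z : ℝ, 0 < z → z ≤ 1 → (maxActions k : ℝ) / z ≤ maxActions k / z ^ 2 :=
        fun z hz hz1 => div_le_div_of_nonneg_left (by positivity) (by positivity) (by nlinarith)
      have hε := h.ε_pos
      have hΔ := h.Δ_pos
      rcases min_cases ε Δ with ⟨e, -⟩ | ⟨e, -⟩ <;> rw [e]
      · have : 0 ≤ (maxActions k : ℝ) / Δ ^ 2 := by positivity
        linarith [hsq ε hε h.ε_le]
      · have : 0 ≤ (maxActions k : ℝ) / ε ^ 2 := by positivity
        linarith [hsq Δ hΔ h.Δ_le]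
    have hpos : 0 < (maxActions k : ℝ) / min ε Δ := by positivity
    have h2 : 4096 * ((maxActions k : ℝ) / min ε Δ) ≤ T := by
      refine le_trans ?_ hge
      have : 1 ≤ logFactor k ε Δ δ ^ 2 := one_le_pow₀ hΛ
      nlinarith
    have e : 8 * (maxActions k : ℝ) / min ε Δ = 8 * (maxActions k / min ε Δ) := by ring
    rw [e]
    linarith
  have h2 : (T : ℝ) / thr k ε Δ < (N * T : ℕ) ^ 2 := by
    have e : (T : ℝ) / thr k ε Δ = N * T * (8 * (maxActions k : ℝ) / min ε Δ) := by
      unfold thr; field_simp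
    rw [e]
    push_cast
    have hNT : 0 < (N : ℝ) * T := by positivity
    calc (N : ℝ) * T * (8 * (maxActions k : ℝ) / min ε Δ) < N * T * T :=
          mul_lt_mul_of_pos_left h1 hNT
      _ ≤ (N * T) ^ 2 := by
          rw [sq]
          refine mul_le_mul_of_nonneg_left ?_ hNT.le
          nlinarith
  refine h2.trans_le ?_
  set n := N * T with hn
  have hn0 : 0 < n := Nat.mul_pos h.N_pos hT0
  have h3 : n ≤ 2 ^ (n - 1) := by
    have := Nat.lt_two_pow_self (n := n - 1)
    omega
  have h4 : (n : ℝ) ≤ 2 ^ (n - 1) := by exact_mod_cast h3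
  calc (n : ℝ) ^ 2 ≤ (2 ^ (n - 1)) ^ 2 := pow_le_pow_left₀ (by positivity) h4 2
    _ = 4 ^ (n - 1) := by rw [← pow_mul, mul_comm, pow_mul]; norm_num

/-- With probability at least `1 - δ` all experts of adaptive Hedge have accurate estimates,
relative to their cumulative weights. -/
theorem expert_bad_le (h : Admissible k ε Δ δ) (hu : ∀ i x, u i x ∈ Set.Icc (0 : ℝ) 1)
    (hT0 : 0 < T)
    (hI : I.IsBandit u μ (elimLength u Δ + T)) (hrun : IsAdaptiveHedgeRun u ε Δ δ T I br)
    (x : (i : Fin N) → Fin (k i) → Fin (k i) → ℝ)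
    (hx : ∀ i a, x i a ∈ stdSimplex ℝ (Fin (k i))) (s : ℕ → ℝ) (hs : ∀ j, 0 ≤ s j) :
    μ.real (⋃ t : Fin T, ⋃ i, ⋃ b, ⋃ a, ⋃ j : Fin (N * T),
      {ω | 2 * Real.log (maxActions k * N * T / δ) ≤
        s j * (∑ τ ∈ Finset.range (t + 1), I.strat (elimLength u Δ + τ) ω i b *
          ∑ c, ((Pi.single a 1 : Fin (k i) → ℝ) c - x i a c) *
            noise I u (elimLength u Δ + τ) ω i c) -
        s j ^ 2 * (∑ τ ∈ Finset.range (t + 1), I.strat (elimLength u Δ + τ) ω i b ^ 2 /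
          (4 * I.batch (elimLength u Δ + τ) ω i))}) ≤ δ := by
  have hδ := h.δ_pos
  have hN := h.one_le_N
  have hA := h.one_le_A
  have hT : (0 : ℝ) < T := by exact_mod_cast hT0
  set l := Real.log (maxActions k * N * T / δ) with hl
  have hbound : μ.real (⋃ t : Fin T, ⋃ i, ⋃ b, ⋃ a, ⋃ j : Fin (N * T),
      {ω | 2 * l ≤
        s j * (∑ τ ∈ Finset.range (t + 1), I.strat (elimLength u Δ + τ) ω i b *
          ∑ c, ((Pi.single a 1 : Fin (k i) → ℝ) c - x i a c) *
            noise I u (elimLength u Δ + τ) ω i c) -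
        s j ^ 2 * (∑ τ ∈ Finset.range (t + 1), I.strat (elimLength u Δ + τ) ω i b ^ 2 /
          (4 * I.batch (elimLength u Δ + τ) ω i))}) ≤
      T * (N * (maxActions k * (maxActions k * (N * T * Real.exp (-(2 * l)))))) := by
    refine measureReal_iUnion_le_mul _ (by positivity) (by simp) fun t => ?_
    refine measureReal_iUnion_le_mul _ (by positivity) (by simp) fun i => ?_
    refine measureReal_iUnion_le_mul _ (by positivity) (card_actions_le k i) fun b => ?_
    refine measureReal_iUnion_le_mul _ (by positivity) (card_actions_le k i) fun a => ?_
    refine measureReal_iUnion_le_mul _ (by positivity) (by simp) fun j => ?_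
    exact ce_expert_tail h hu hI hrun t.2 i b (single_mem_stdSimplex ℝ a) (hx i a) (hs j) _
  refine hbound.trans ?_
  -- The level `2 * l` pays for the long grid: rounds, players, pairs of actions and slopes number
  -- at most `(A N T) ^ 2`, which cancels and leaves `δ ^ 2`.
  have e : Real.exp (-(2 * l)) = (δ / (maxActions k * N * T)) ^ 2 := by
    rw [show -(2 * l) = -l + -l by ring, Real.exp_add, Real.exp_neg, hl,
      Real.exp_log (by positivity), inv_div, sq]
  rw [e]
  have e2 : (T : ℝ) * (N * (maxActions k * (maxActions k *
      (N * T * (δ / (maxActions k * N * T)) ^ 2)))) = δ ^ 2 := by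
    field_simp
  rw [e2]
  nlinarith [h.δ_lt]

/-- The logarithm of the number of swap functions, over the failure probability. -/
theorem log_swap_le (h : Admissible k ε Δ δ) :
    Real.log (N * (maxActions k : ℝ) ^ maxActions k / δ) ≤
      maxActions k * logFactor k ε Δ δ := by
  have hδ := h.δ_pos
  have hN := h.one_le_N
  have hA := h.one_le_A
  have hA' : 1 ≤ maxActions k := by exact_mod_cast hA
  have h1 : N * (maxActions k : ℝ) ^ maxActions k / δ ≤ (N * maxActions k / δ) ^ maxActions k := by
    have e : N * (maxActions k : ℝ) ^ maxActions k / δ =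
        N / δ * (maxActions k : ℝ) ^ maxActions k := by ring
    have e' : (N * (maxActions k : ℝ) / δ) ^ maxActions k =
        (N / δ) ^ maxActions k * (maxActions k : ℝ) ^ maxActions k := by
      rw [← mul_pow]; ring
    rw [e, e']
    refine mul_le_mul_of_nonneg_right (le_self_pow₀ ?_ (by omega)) (by positivity)
    rw [one_le_div hδ]
    linarith [h.δ_lt]
  refine (Real.log_le_log (by positivity) h1).trans ?_
  rw [Real.log_pow]
  exact mul_le_mul_of_nonneg_left h.log_N_div_le (by positivity)

/-- With probability at least `1 - δ` the swap regrets are estimated accurately. -/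
theorem swap_bad_le (h : Admissible k ε Δ δ) (hu : ∀ i x, u i x ∈ Set.Icc (0 : ℝ) 1)
    (hI : I.IsBandit u μ (elimLength u Δ + T)) (hrun : IsAdaptiveHedgeRun u ε Δ δ T I br)
    {s : ℝ} (hs : 0 ≤ s) :
    μ.real (⋃ i, ⋃ φ : Fin (k i) → Fin (k i),
      {ω | Real.log (N * (maxActions k : ℝ) ^ maxActions k / δ) ≤
        s * (∑ t ∈ Finset.range T, ∑ c, (I.strat (elimLength u Δ + t) ω i c -
          pushforward φ (I.strat (elimLength u Δ + t) ω i) c) *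
            noise I u (elimLength u Δ + t) ω i c) - s ^ 2 * (T / 4)}) ≤ δ := by
  have hδ := h.δ_pos
  have hN := h.one_le_N
  have hA := h.one_le_A
  set z := Real.log (N * (maxActions k : ℝ) ^ maxActions k / δ) with hz
  have hbound : μ.real (⋃ i, ⋃ φ : Fin (k i) → Fin (k i),
      {ω | z ≤ s * (∑ t ∈ Finset.range T, ∑ c, (I.strat (elimLength u Δ + t) ω i c -
          pushforward φ (I.strat (elimLength u Δ + t) ω i) c) *
            noise I u (elimLength u Δ + t) ω i c) - s ^ 2 * (T / 4)}) ≤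
      N * ((maxActions k : ℝ) ^ maxActions k * Real.exp (-z)) := by
    refine measureReal_iUnion_le_mul _ (by positivity) (by simp) fun i => ?_
    refine measureReal_iUnion_le_mul _ (by positivity) ?_ fun φ =>
      ce_swap_tail h hu hI hrun i φ hs z
    have h1 := le_maxActions k i
    have h2 : k i ^ k i ≤ maxActions k ^ maxActions k :=
      (Nat.pow_le_pow_left h1 _).trans (Nat.pow_le_pow_right (by exact_mod_cast hA) h1)
    simp only [Fintype.card_fun, Fintype.card_fin]
    exact_mod_cast h2
  refine hbound.trans (le_of_eq ?_)
  rw [hz, Real.exp_neg, Real.exp_log (by positivity), inv_div]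
  field_simp

/-- The variance proxy of an expert is controlled by its cumulative weight. -/
theorem expert_variance_le (h : Admissible k ε Δ δ)
    (hrun : IsAdaptiveHedgeRun u ε Δ δ T I br) (ω : Ω) {t : ℕ} (ht : t < T) (i : Fin N)
    (b : Fin (k i)) :
    ∑ τ ∈ Finset.range (t + 1), I.strat (elimLength u Δ + τ) ω i b ^ 2 /
        (4 * (I.batch (elimLength u Δ + τ) ω i : ℝ)) ≤
      cumWeight (fun τ => I.strat (elimLength u Δ + τ) ω) t i b ^ 2 * Δ ^ 2 /
        (256 * Real.log (maxActions k * N * T / δ)) := by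
  have hΔ := h.Δ_pos
  have hl := Real.log_pos (h.one_lt_batch_arg (T := T) (by omega))
  set l := Real.log (maxActions k * N * T / δ) with hldef
  set θ : ℕ → Weights k := fun τ => I.strat (elimLength u Δ + τ) ω with hθ
  have hpos : ∀ τ ≤ t, 0 < θ τ i b := fun τ hτ => hrun.ce_strat_pos h (by omega) ω i b
  set S := cumWeight θ t i b with hS
  have hS0 : 0 < S := cumWeight_pos hpos
  -- One factor `θ τ i b` cancels against the batch size, which is at least `64 * l * θ / (Δ ^ 2 *
  -- cumWeight)`. The remaining factors add up to `S`.
  have hterm : ∀ τ ∈ Finset.range (t + 1), θ τ i b ^ 2 /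
      (4 * (I.batch (elimLength u Δ + τ) ω i : ℝ)) ≤ θ τ i b * (S * Δ ^ 2 / (256 * l)) := by
    intro τ hτ
    have hτ' : τ ≤ t := Nat.lt_succ_iff.1 (Finset.mem_range.1 hτ)
    have hb : (0 : ℝ) < I.batch (elimLength u Δ + τ) ω i := by
      exact_mod_cast hrun.ce_batch_pos h (by omega) ω i
    have hSτ : 0 < cumWeight θ τ i b := cumWeight_pos fun τ' h' => hpos τ' (by omega)
    have hSle : cumWeight θ τ i b ≤ S :=
      Finset.sum_le_sum_of_subset_of_nonneg (Finset.range_subset_range.2 (by omega))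
        fun τ' h' _ => (hpos τ' (Nat.lt_succ_iff.1 (Finset.mem_range.1 h'))).le
    have hM := le_ceBatch (Δ := Δ) (δ := δ) (T := T) θ τ i b
    rw [← hrun.ce_batch τ (by omega) ω i, ← hldef, div_le_iff₀ (by positivity)] at hM
    have hq := hpos τ hτ'
    rw [mul_div_assoc', div_le_div_iff₀ (by positivity) (by positivity)]
    have h1 : 64 * l * θ τ i b ≤ I.batch (elimLength u Δ + τ) ω i * (Δ ^ 2 * S) :=
      hM.trans (by gcongr)
    nlinarith [mul_le_mul_of_nonneg_left h1 hq.le]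
  refine (Finset.sum_le_sum hterm).trans (le_of_eq ?_)
  rw [← Finset.sum_mul, show ∑ τ ∈ Finset.range (t + 1), θ τ i b = S from rfl]
  ring

end UnionBound

/-! ### Assembly. -/

section Main

variable {Ω : Type*} [MeasurableSpace Ω] {μ : Measure Ω} [IsProbabilityMeasure μ]
  {N : ℕ} {k : Fin N → ℕ} {u : Fin N → Profile k → ℝ}
  {ε Δ δ : ℝ} {I : Interaction k Ω} {br : ℕ → Ω → Profile k}

/-- Dominating strategies for all actions eliminated in the next round. -/
theorem exists_dominating (u : Fin N → Profile k → ℝ) (Δ : ℝ) :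
    ∃ x : ℕ → (i : Fin N) → Fin (k i) → Fin (k i) → ℝ,
      (∀ l i a, x l i a ∈ stdSimplex ℝ (Fin (k i))) ∧
      ∀ l i a, a ∈ elim u Δ (l + 1) i → ∀ y : Profile k,
        (∀ j, j ≠ i → y j ∉ elim u Δ l j) → u i (Function.update y i a) ≤
          (∑ c, x l i a c * u i (Function.update y i c)) - Δ := by
  have : ∀ l i (a : Fin (k i)), ∃ x ∈ stdSimplex ℝ (Fin (k i)), a ∈ elim u Δ (l + 1) i →
      ∀ y : Profile k, (∀ j, j ≠ i → y j ∉ elim u Δ l j) → u i (Function.update y i a) ≤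
        (∑ c, x c * u i (Function.update y i c)) - Δ := by
    intro l i a
    by_cases ha : a ∈ elim u Δ (l + 1) i
    · obtain ⟨x, hx, hdom⟩ := mem_elim_succ.1 ha
      exact ⟨x, hx, fun _ => hdom⟩
    · exact ⟨Pi.single a 1, single_mem_stdSimplex ℝ a, fun h => absurd h ha⟩
  choose x hx hdom using this
  exact ⟨x, hx, hdom⟩

theorem one_sub_le_measureReal_isRationalizableCE (h : Admissible k ε Δ δ)
    (hu : ∀ i x, u i x ∈ Set.Icc (0 : ℝ) 1)
    (hI : I.IsBandit u μ (elimLength u Δ + ceRounds 4096 2 k ε Δ δ))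
    (hrun : IsAdaptiveHedgeRun u ε Δ δ (ceRounds 4096 2 k ε Δ δ) I br) :
    1 - 3 * δ ≤ μ.real {ω | IsRationalizableCE u ε Δ
      (ceOutput (thr k ε Δ) (ceRounds 4096 2 k ε Δ δ)
        (fun t => I.strat (elimLength u Δ + t) ω))} := by
  have hT0 := h.rounds_pos
  have hgrid := rounds_div_thr_lt h
  have hge := h.rounds_ge
  obtain ⟨x, hx, hdom⟩ := exists_dominating u Δ
  have hCE := isApproxCE_ceOutput h hu hI hrun
  set T := ceRounds 4096 2 k ε Δ δ with hT
  set L := elimLength u Δ with hL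
  have hT' : (0 : ℝ) < T := by exact_mod_cast hT0
  have hΔ := h.Δ_pos
  have hε := h.ε_pos
  have hl := Real.log_pos (h.one_lt_batch_arg hT0)
  set l := Real.log (maxActions k * N * T / δ) with hldef
  have hbad₁ := ibr_bad_le h hu hI hrun x hx
  -- The grid starts at order `l / (Δ * T)`, suited to cumulative weights near `T`, and grows by
  -- factors of 4 to serve smaller ones.
  have hbad₂ := expert_bad_le h hu hT0 hI hrun (x L) (hx L)
    (fun j => 12 * l * 4 ^ j / (Δ * T)) (fun j => by positivity)
  have hbad₃ := swap_bad_le h hu hI hrun (s := ε / 2) (by positivity)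
  set bad₁ : Set Ω := ⋃ r : Fin (elimLength u Δ), ⋃ i, ⋃ a, _ with hb₁
  set bad₂ : Set Ω := ⋃ t : Fin T, ⋃ i, ⋃ b, ⋃ a, ⋃ j : Fin (N * T), _ with hb₂
  set bad₃ : Set Ω := ⋃ i, ⋃ φ : Fin (k i) → Fin (k i), _ with hb₃
  set good : Set Ω := {ω | IsRationalizableCE u ε Δ
      (ceOutput (thr k ε Δ) T (fun t => I.strat (L + t) ω))} with hgood
  have hcover : ∀ ω, ω ∉ bad₁ → ω ∉ bad₂ → ω ∉ bad₃ → ω ∈ good := by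
    intro ω h₁ h₂ h₃
    simp only [hb₁, hb₂, hb₃, Set.mem_iUnion, Set.mem_ofPred_eq, not_exists, not_le] at h₁ h₂ h₃
    have hbr := br_notMem_elim h hu hrun ω x hx hdom (fun r hr i a => h₁ ⟨r, hr⟩ i a)
      L le_rfl
    -- Stability of the elimination at `L` lets actions of `elim u Δ L` be dominated against
    -- opponents avoiding that same set, so the invariant reproduces itself.
    have hsupp := ce_strat_le_thr h hu hrun ω (x L) (hx L)
      (fun i a ha => hdom L i a (by rw [hL, elim_elimLength_succ]; exact ha)) hbr
      (fun t ht i b a => by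
        have hpos : ∀ τ ≤ t, 0 < I.strat (L + τ) ω i b := fun τ hτ =>
          hrun.ce_strat_pos h (by omega) ω i b
        refine le_of_grid_bound hΔ hl h.thr_pos ?_ ?_ hgrid
          (expert_variance_le h hrun ω ht i b) fun j hj => h₂ ⟨t, ht⟩ i b a ⟨j, hj⟩
        · exact (hrun.thr_le_init h ω i b).trans
            (le_cumWeight (θ := fun τ => I.strat (L + τ) ω) hpos (Nat.zero_le t))
        · have h1 : ∀ τ ∈ Finset.range (t + 1), I.strat (L + τ) ω i b ≤ 1 := fun τ hτ =>
            hrun.ce_strat_le_one h (by have := Finset.mem_range.1 hτ; omega) ω i b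
          have h2 := Finset.sum_le_card_nsmul _ _ _ h1
          have h3 : ((t + 1 : ℕ) : ℝ) ≤ T := by exact_mod_cast ht
          simp only [Finset.card_range, nsmul_eq_mul, mul_one] at h2
          exact h2.trans h3)
    refine ⟨hCE ω fun i φ => ?_, fun y hy i hmem => ?_⟩
    · have h1 := h₃ i φ
      have h2 := log_swap_le h
      have hΛ := h.one_le_logFactor
      have hA := h.one_le_A
      have h3 : 16 * (maxActions k * logFactor k ε Δ δ) ≤ ε ^ 2 * T := by
        have h4 : 4096 * ((maxActions k : ℝ) / ε ^ 2) * logFactor k ε Δ δ ^ 2 ≤ T := by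
          refine le_trans ?_ hge
          have : 0 ≤ (maxActions k : ℝ) / Δ ^ 2 * logFactor k ε Δ δ ^ 2 := by positivity
          nlinarith
        have h5 := mul_le_mul_of_nonneg_left h4 (sq_nonneg ε)
        have e : ε ^ 2 * (4096 * ((maxActions k : ℝ) / ε ^ 2) * logFactor k ε Δ δ ^ 2) =
            4096 * maxActions k * logFactor k ε Δ δ ^ 2 := by field_simp
        rw [e] at h5
        have h6 : (maxActions k : ℝ) * logFactor k ε Δ δ ≤
            maxActions k * logFactor k ε Δ δ ^ 2 :=
          mul_le_mul_of_nonneg_left (by nlinarith) (by positivity)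
        have h7 : 0 ≤ (maxActions k : ℝ) * logFactor k ε Δ δ ^ 2 := by positivity
        linarith
      -- With slope `ε / 2`, noise above `ε * T / 4` would give an exponent above `ε² T / 8 - ε² T /
      -- 16 = ε² T / 16`, which exceeds the level by `h3`.
      by_contra! hcon
      nlinarith [mul_lt_mul_of_pos_left hcon (half_pos hε)]
    · apply hy
      unfold ceOutput
      rw [Finset.sum_eq_zero, zero_div]
      intro t ht
      refine Finset.prod_eq_zero (Finset.mem_univ i) ?_
      by_contra hne
      exact absurd (hsupp t (Finset.mem_range.1 ht) i (y i) hmem) (not_le.2 (lt_of_clip_ne_zero hne))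
  -- Subadditivity on a cover avoids any measurability claim about the good event.
  have huniv : (Set.univ : Set Ω) ⊆ good ∪ (bad₁ ∪ (bad₂ ∪ bad₃)) := by
    intro ω _
    by_cases h₁ : ω ∈ bad₁
    · exact Or.inr (Or.inl h₁)
    by_cases h₂ : ω ∈ bad₂
    · exact Or.inr (Or.inr (Or.inl h₂))
    by_cases h₃ : ω ∈ bad₃
    · exact Or.inr (Or.inr (Or.inr h₃))
    exact Or.inl (hcover ω h₁ h₂ h₃)
  have h1 := measureReal_mono (μ := μ) huniv
  rw [probReal_univ] at h1
  have h2 := measureReal_union_le (μ := μ) good (bad₁ ∪ (bad₂ ∪ bad₃))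
  have h3 := measureReal_union_le (μ := μ) bad₁ (bad₂ ∪ bad₃)
  have h4 := measureReal_union_le (μ := μ) bad₂ bad₃
  linarith

end Main

end RatCE

theorem mainTheorem2 :
    ∃ (C₁ C₂ : ℝ) (κ₁ κ₂ : ℕ), 0 < C₁ ∧ 0 < C₂ ∧
      ∀ (N : ℕ) (k : Fin N → ℕ) (u : Fin N → Profile k → ℝ) (ε Δ δ : ℝ),
        0 < N → (∀ i, 0 < k i) → (∀ i x, u i x ∈ Set.Icc (0 : ℝ) 1) →
        0 < ε → ε ≤ 1 → 0 < Δ → Δ ≤ 1 → 0 < δ → δ < 1 →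
        ∀ (Ω : Type*) [MeasurableSpace Ω] (μ : Measure Ω) [IsProbabilityMeasure μ]
          (I : Interaction k Ω) (br : ℕ → Ω → Profile k),
          I.IsBandit u μ (elimLength u Δ + ceRounds C₁ κ₁ k ε Δ δ) →
          IsAdaptiveHedgeRun u ε Δ δ (ceRounds C₁ κ₁ k ε Δ δ) I br →
          1 - 3 * δ ≤ μ.real {ω | IsRationalizableCE u ε Δ
            (ceOutput (thr k ε Δ) (ceRounds C₁ κ₁ k ε Δ δ)
              (fun t => I.strat (elimLength u Δ + t) ω))} ∧
          ∀ ω, (I.samples (elimLength u Δ + ceRounds C₁ κ₁ k ε Δ δ) ω : ℝ) ≤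
            C₂ * (elimLength u Δ * N * maxActions k / Δ ^ 2 +
              N * maxActions k ^ 2 / min (ε ^ 2) (Δ ^ 2)) * logFactor k ε Δ δ ^ κ₂ := by
  refine ⟨4096, 30000, 2, 2, by norm_num, by norm_num, ?_⟩
  intro N k u ε Δ δ hN hk hu hε hε1 hΔ hΔ1 hδ hδ1 Ω _ μ _ I br hI hrun
  have h : Admissible k ε Δ δ := ⟨hN, hk, hε, hε1, hΔ, hΔ1, hδ, hδ1⟩
  exact ⟨one_sub_le_measureReal_isRationalizableCE h hu hI hrun,
    fun ω => IsAdaptiveHedgeRun.samples_le h hrun ω⟩
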